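/- A \emph{uniform matroid} is a matroid whose independent sets are exactly the subsets of its ground set with at most $k$ elements, for some $k\in\mathbb Z_{\ge 0}$; a \emph{partition matroid} is a direct sum of finitely many uniform matroids (of arbitrary ranks). For an abelian group $\Gamma$, a labeling $\psi\colon E\to\Gamma$ and $X\subseteq E$ write $\psi(X)=\sum_{e\in X}\psi(e)$, and call $X$ \emph{non-zero} if $\psi(X)\neq 0$; for $w\colon E\to\mathbb R$ write $w(X)=\sum_{e\in X}w(e)$. Algorithms are deterministic programs of a random access machine with cells for natural numbers, for group elements and for real weights, where one step is one elementary operation: a read or write of a cell (with indirect addressing), an addition, (truncated) subtraction or comparison of natural numbers, a group operation (addition, negation) or a zero-test in $\Gamma$, an addition, subtraction or comparison of weights, a logical operation on tests, or one call of an independence oracle. A program is a fixed finite text that depends neither on $\Gamma$ nor on the instance, and the only constants for group elements and for weights are $0$. \textbf{Theorem.} (1) There are a program and a polynomial $f$ such that for every abelian group $\Gamma$, every $n\ge 0$, all partition matroids $M_1,M_2$ on a common ground set $E$ with $|E|=n$, given by independence oracles, every labeling $\psi\colon E\to\Gamma$ and every weight function $w\colon E\to\mathbb R$, the program halts after at most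 $f(n)$ steps and either outputs a non-zero common basis $B$ of $M_1$ and $M_2$ with $w(B)\le w(B')$ for every non-zero common basis $B'$, or correctly reports that $M_1$ and $M_2$ have no non-zero common basis. (2) There are a program, which makes no use of oracles for matroids, and a polynomial $f$ such that for every abelian group $\Gamma$, every finite bipartite graph $G$ (parallel edges allowed), given by its two colour classes and the list of its edges with their two ends, every $b\colon V(G)\to\mathbb Z_{\ge 0}$, every labeling $\psi\colon E(G)\to\Gamma$ and every weight function $w\colon E(G)\to\mathbb R$, the program halts after at most $f(|V(G)|+|E(G)|)$ steps and either outputs a non-zero perfect $b$-matching of $G$ of minimum weight among all non-zero perfect $b$-matchings, or correctly reports that $G$ has no non-zero perfect $b$-matching. Here a perfect $b$-matching is a set $F\subseteq E(G)$ such that every vertex $v$ is incident to exactly $b(v)$ edges of $F$. -/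

import Mathlib

universe u

/-! ## Partition matroids -/

/-- A uniform matroid (on an arbitrary ground set): for some `k`, the independent sets are exactly
the subsets of the ground set with at most `k` elements. -/
def IsUniformMatroid {α : Type*} (M : Matroid α) : Prop :=
  ∃ k : ℕ, ∀ I : Set α, M.Indep I ↔ I ⊆ M.E ∧ I.encard ≤ k

/-- A partition matroid: a direct sum of (finitely many) uniform matroids. -/
def IsPartitionMatroid {α : Type*} (M : Matroid α) : Prop :=
  ∃ (r : ℕ) (N : Fin r → Matroid α)
    (h : Pairwise (Function.onFun Disjoint fun j ↦ (N j).E)),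
    (∀ j, IsUniformMatroid (N j)) ∧ M = Matroid.disjointSigma N h

/-- The family of common bases of two matroids on the ground set `Fin n`. -/
def commonBases {n : ℕ} (M₁ M₂ : Matroid (Fin n)) : Set (Finset (Fin n)) :=
  {B | M₁.IsBase (B : Set (Fin n)) ∧ M₂.IsBase (B : Set (Fin n))}

/-! ## Perfect `b`-matchings in bipartite graphs -/

/-- The perfect `b`-matchings of the bipartite graph with colour classes `Fin p` and `Fin q` and
edges `Fin m`, where the edge `e` joins `left e` to `right e` (parallel edges are allowed). -/
def perfectBMatchings {p q m : ℕ} (left : Fin m → Fin p) (right : Fin m → Fin q)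
    (bl : Fin p → ℕ) (br : Fin q → ℕ) : Set (Finset (Fin m)) :=
  {F | (∀ v, (F.filter fun e ↦ left e = v).card = bl v) ∧
       (∀ v, (F.filter fun e ↦ right e = v).card = br v)}

/-! ## The optimization problem -/

/-- `B` is a minimum-weight non-zero member of the set family `𝓕`. -/
def IsMinWeightNonZero {Γ : Type u} [AddCommGroup Γ] {n : ℕ} (𝓕 : Set (Finset (Fin n)))
    (ψ : Fin n → Γ) (w : Fin n → ℝ) (B : Finset (Fin n)) : Prop :=
  (B ∈ 𝓕 ∧ ∑ e ∈ B, ψ e ≠ 0) ∧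
    ∀ B' ∈ 𝓕, ∑ e ∈ B', ψ e ≠ 0 → ∑ e ∈ B, w e ≤ ∑ e ∈ B', w e

/-! ## The machine model

Programs work on finitely many one-dimensional arrays of natural numbers, of group elements and of
real weights, with indirect addressing. Naturals can be added, subtracted and compared; group
elements can be added, negated and tested for being zero; weights can be added, subtracted and
compared; and the independence oracles can be queried. Each such operation is one step. -/

namespace OracleRAM

/-- The memory: the cell with index `i` of the array with name `a` of each of the three sorts. -/
structure State (Γ : Type u) where
  nat : ℕ → ℕ → ℕ
  grp : ℕ → ℕ → Γ
  wt : ℕ → ℕ → ℝ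

/-- Expressions for natural numbers; `read a i` is the cell `i` of array `a`, and `sub` is
truncated. -/
inductive NExp : Type
  | const (c : ℕ)
  | read (a : ℕ) (i : NExp)
  | add (x y : NExp)
  | sub (x y : NExp)

/-- Expressions for group elements. -/
inductive GExp : Type
  | zero
  | read (a : ℕ) (i : NExp)
  | add (x y : GExp)
  | neg (x : GExp)

/-- Expressions for weights. -/
inductive WExp : Type
  | zero
  | read (a : ℕ) (i : NExp)
  | add (x y : WExp)
  | sub (x y : WExp)

/-- Tests. `indep k a` asks the `k`-th independence oracle whether the set whose characteristic
vector is stored in the array `a` of natural numbers is independent. -/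
inductive Test : Type
  | natLe (x y : NExp)
  | wtLe (x y : WExp)
  | isZero (x : GExp)
  | indep (k : Fin 2) (a : ℕ)
  | not (b : Test)
  | and (b c : Test)

/-- Programs. -/
inductive Prog : Type
  | skip
  | setNat (a : ℕ) (i : NExp) (x : NExp)
  | setGrp (a : ℕ) (i : NExp) (x : GExp)
  | setWt (a : ℕ) (i : NExp) (x : WExp)
  | seq (c d : Prog)
  | ite (b : Test) (c d : Prog)
  | loop (b : Test) (c : Prog)

/-- Two oracles, each answering yes or no to the contents of an array of natural numbers. -/
abbrev Oracle : Type := Fin 2 → (ℕ → ℕ) → Prop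

section semantics

variable {Γ : Type u}

/-- The value of an expression. -/
def NExp.eval (s : State Γ) : NExp → ℕ
  | const c => c
  | read a i => s.nat a (i.eval s)
  | add x y => x.eval s + y.eval s
  | sub x y => x.eval s - y.eval s

/-- The number of steps for evaluating an expression: one for each operation in it. -/
def NExp.cost : NExp → ℕ
  | const _ => 1
  | read _ i => i.cost + 1
  | add x y => x.cost + y.cost + 1
  | sub x y => x.cost + y.cost + 1

/-- The value of an expression. -/
def GExp.eval [AddCommGroup Γ] (s : State Γ) : GExp → Γ
  | zero => 0
  | read a i => s.grp a (i.eval s)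
  | add x y => x.eval s + y.eval s
  | neg x => - x.eval s

/-- The number of steps for evaluating an expression. -/
def GExp.cost : GExp → ℕ
  | zero => 1
  | read _ i => i.cost + 1
  | add x y => x.cost + y.cost + 1
  | neg x => x.cost + 1

/-- The value of an expression. -/
noncomputable def WExp.eval (s : State Γ) : WExp → ℝ
  | zero => 0
  | read a i => s.wt a (i.eval s)
  | add x y => x.eval s + y.eval s
  | sub x y => x.eval s - y.eval s

/-- The number of steps for evaluating an expression. -/
def WExp.cost : WExp → ℕ
  | zero => 1
  | read _ i => i.cost + 1
  | add x y => x.cost + y.cost + 1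
  | sub x y => x.cost + y.cost + 1

/-- The outcome of a test, with the given oracles. -/
def Test.holds [AddCommGroup Γ] (O : Oracle) (s : State Γ) : Test → Prop
  | natLe x y => x.eval s ≤ y.eval s
  | wtLe x y => x.eval s ≤ y.eval s
  | isZero x => x.eval s = 0
  | indep k a => O k (s.nat a)
  | not b => ¬ b.holds O s
  | and b c => b.holds O s ∧ c.holds O s

/-- The number of steps for a test; a call of an oracle is one step. -/
def Test.cost : Test → ℕ
  | natLe x y => x.cost + y.cost + 1
  | wtLe x y => x.cost + y.cost + 1
  | isZero x => x.cost + 1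
  | indep _ _ => 1
  | not b => b.cost + 1
  | and b c => b.cost + c.cost + 1

/-- Writing one cell. -/
def State.setNat (s : State Γ) (a i x : ℕ) : State Γ :=
  { s with nat := Function.update s.nat a (Function.update (s.nat a) i x) }

/-- Writing one cell. -/
def State.setGrp (s : State Γ) (a i : ℕ) (x : Γ) : State Γ :=
  { s with grp := Function.update s.grp a (Function.update (s.grp a) i x) }

/-- Writing one cell. -/
noncomputable def State.setWt (s : State Γ) (a i : ℕ) (x : ℝ) : State Γ :=
  { s with wt := Function.update s.wt a (Function.update (s.wt a) i x) }

/-- `Exec O c s t s'`: with the oracles `O`, the program `c` started in the memory `s` halts after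
exactly `t` steps with the memory `s'`. -/
inductive Exec [AddCommGroup Γ] (O : Oracle) : Prog → State Γ → ℕ → State Γ → Prop
  | skip (s : State Γ) : Exec O Prog.skip s 1 s
  | setNat (s : State Γ) (a : ℕ) (i x : NExp) :
      Exec O (Prog.setNat a i x) s (i.cost + x.cost + 1) (s.setNat a (i.eval s) (x.eval s))
  | setGrp (s : State Γ) (a : ℕ) (i : NExp) (x : GExp) :
      Exec O (Prog.setGrp a i x) s (i.cost + x.cost + 1) (s.setGrp a (i.eval s) (x.eval s))
  | setWt (s : State Γ) (a : ℕ) (i : NExp) (x : WExp) :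
      Exec O (Prog.setWt a i x) s (i.cost + x.cost + 1) (s.setWt a (i.eval s) (x.eval s))
  | seq {c d : Prog} {s s' s'' : State Γ} {t t' : ℕ} :
      Exec O c s t s' → Exec O d s' t' s'' → Exec O (Prog.seq c d) s (t + t') s''
  | iteTrue {b : Test} {c d : Prog} {s s' : State Γ} {t : ℕ} :
      b.holds O s → Exec O c s t s' → Exec O (Prog.ite b c d) s (b.cost + t) s'
  | iteFalse {b : Test} {c d : Prog} {s s' : State Γ} {t : ℕ} :
      ¬ b.holds O s → Exec O d s t s' → Exec O (Prog.ite b c d) s (b.cost + t) s'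
  | loopStop {b : Test} {c : Prog} {s : State Γ} :
      ¬ b.holds O s → Exec O (Prog.loop b c) s b.cost s
  | loopStep {b : Test} {c : Prog} {s s' s'' : State Γ} {t t' : ℕ} :
      b.holds O s → Exec O c s t s' → Exec O (Prog.loop b c) s' t' s'' →
      Exec O (Prog.loop b c) s (b.cost + t + t') s''

/-- Execution is deterministic: the final memory and the number of steps are unique. -/
theorem Exec.unique [AddCommGroup Γ] {O : Oracle} {c : Prog} {s s₁ s₂ : State Γ} {t₁ t₂ : ℕ}
    (h₁ : Exec O c s t₁ s₁) (h₂ : Exec O c s t₂ s₂) : t₁ = t₂ ∧ s₁ = s₂ := by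
  induction h₁ generalizing t₂ s₂ with
  | skip | setNat | setGrp | setWt => cases h₂; exact ⟨rfl, rfl⟩
  | seq _ _ ih ih' =>
    cases h₂ with
    | seq h h' =>
      obtain ⟨rfl, rfl⟩ := ih h
      obtain ⟨rfl, rfl⟩ := ih' h'
      exact ⟨rfl, rfl⟩
  | iteTrue hb _ ih =>
    cases h₂ with
    | iteTrue _ h => obtain ⟨rfl, rfl⟩ := ih h; exact ⟨rfl, rfl⟩
    | iteFalse hb' _ => exact absurd hb hb'
  | iteFalse hb _ ih =>
    cases h₂ with
    | iteTrue hb' _ => exact absurd hb' hb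
    | iteFalse _ h => obtain ⟨rfl, rfl⟩ := ih h; exact ⟨rfl, rfl⟩
  | loopStop hb =>
    cases h₂ with
    | loopStop _ => exact ⟨rfl, rfl⟩
    | loopStep hb' _ _ => exact absurd hb' hb
  | loopStep hb _ _ ih ih' =>
    cases h₂ with
    | loopStop hb' => exact absurd hb hb'
    | loopStep _ h h' =>
      obtain ⟨rfl, rfl⟩ := ih h
      obtain ⟨rfl, rfl⟩ := ih' h'
      exact ⟨rfl, rfl⟩

end semantics

/-! ### Inputs, oracles and outputs -/

/-- The array that holds `f 0, …, f (n - 1)`, and zeros afterwards. -/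
def pad {α : Type u} [Zero α] {n : ℕ} (f : Fin n → α) : ℕ → α :=
  fun i ↦ if h : i < n then f ⟨i, h⟩ else 0

/-- The independence oracles of two matroids on `Fin n`: the array `x` stands for the set of all
`e` with `x e ≠ 0`. -/
def indepOracle {n : ℕ} (M₁ M₂ : Matroid (Fin n)) : Oracle
  | 0, x => M₁.Indep {e | x e ≠ 0}
  | 1, x => M₂.Indep {e | x e ≠ 0}

/-- The oracles that answer no to every query and so are of no use. -/
def trivialOracle : Oracle := fun _ _ ↦ False

/-- The initial memory for two matroids on `Fin n` that are given by oracles: the size `n` of the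
ground set, the labels, the weights, and zeros elsewhere. -/
def matroidInput {Γ : Type u} [AddCommGroup Γ] {n : ℕ} (ψ : Fin n → Γ) (w : Fin n → ℝ) :
    State Γ where
  nat
    | 0 => fun i ↦ if i = 0 then n else 0
    | _ => fun _ ↦ 0
  grp
    | 0 => pad ψ
    | _ => fun _ ↦ 0
  wt
    | 0 => pad w
    | _ => fun _ ↦ 0

/-- The initial memory for a bipartite graph: the sizes of the colour classes and of the edge set,
the ends of the edges, the prescribed degrees, the labels, the weights, and zeros elsewhere. -/
def graphInput {Γ : Type u} [AddCommGroup Γ] {p q m : ℕ} (left : Fin m → Fin p)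
    (right : Fin m → Fin q) (bl : Fin p → ℕ) (br : Fin q → ℕ) (ψ : Fin m → Γ) (w : Fin m → ℝ) :
    State Γ where
  nat
    | 0 => fun i ↦ if i = 0 then p else if i = 1 then q else if i = 2 then m else 0
    | 1 => pad fun e ↦ (left e : ℕ)
    | 2 => pad fun e ↦ (right e : ℕ)
    | 3 => pad bl
    | 4 => pad br
    | _ => fun _ ↦ 0
  grp
    | 0 => pad ψ
    | _ => fun _ ↦ 0
  wt
    | 0 => pad w
    | _ => fun _ ↦ 0

/-- The subset of `Fin n` that the memory holds as an output, as a characteristic vector. -/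
def State.outputSet {Γ : Type u} (s : State Γ) (n : ℕ) : Finset (Fin n) :=
  Finset.univ.filter fun e ↦ s.nat 6 e ≠ 0

/-- The output is correct: either the flag is `1` and the output set is a minimum-weight non-zero
member of `𝓕`, or the flag is `0` and `𝓕` has no non-zero member. -/
def State.IsCorrectOutput {Γ : Type u} [AddCommGroup Γ] {n : ℕ} (𝓕 : Set (Finset (Fin n)))
    (ψ : Fin n → Γ) (w : Fin n → ℝ) (s : State Γ) : Prop :=
  (s.nat 5 0 = 1 ∧ IsMinWeightNonZero 𝓕 ψ w (s.outputSet n)) ∨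
    (s.nat 5 0 = 0 ∧ ∀ B ∈ 𝓕, ∑ e ∈ B, ψ e = 0)

/-- With the oracles `O`, the program `P` started in the memory `s` halts within `T` steps, in a
memory that satisfies `post`. -/
def HaltsWithin {Γ : Type u} [AddCommGroup Γ] (O : Oracle) (P : Prog) (s : State Γ) (T : ℕ)
    (post : State Γ → Prop) : Prop :=
  ∃ t s', Exec O P s t s' ∧ t ≤ T ∧ post s'

end OracleRAM

/-! Both parts reduce to flows of unit capacity. Directing the edges of a bipartite graph from left
to right turns perfect `b`-matchings into arc sets with prescribed net degrees
(`Net.IsBipartite.completes_iff`). A common base of two partition matroids is such a matching in the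
graph whose edges are the elements and whose vertices are the classes of the two matroids.

Let `B` be a cheapest such set. Its residual digraph `G.flip B` has no closed walk of negative cost.
If `B` has non-zero label, it is the answer. Otherwise consider any `B'` with the same net degrees
and non-zero label. The symmetric difference of `B` and `B'` is balanced in the residual digraph, so
it decomposes into closed trails of non-negative cost, and one of them has non-zero label and costs
at most `w(B') - w(B)` (`Net.Conservative.sum_nonneg_and_exists`). So it suffices to flip a cheapest
non-zero closed trail. Trails are hard to enumerate, but walks are not: a closed walk that repeats
an arc splits into two closed walks, whose labels add up because the group is abelian. One part is
non-zero and the other costs at least `0`. Hence a cheapest non-zero closed walk with fewest arcs is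
already a trail (`Net.Conservative.nodup_of_min_nonzero`, `Net.Optimal.nonzero`).

Cheapest walks are found by dynamic programming over the number of arcs, the start and the end.
Storing one walk per label is impossible, but two entries are enough: a cheapest walk, and a
cheapest one among those whose label differs from the label of the first. Every condition that is
ever imposed on the label of a walk excludes at most one label, so one of the two entries always
does as well as any walk (`Tab.BestPair.dominates`). The same tables give the shortest augmenting
walks that lead from the empty set to `B`, in at most `m` rounds (`Net.Optimal.augment`,
`den_augment`).

For matroids given by oracles, a base `B` is found greedily. For `f ∈ B` and `g ∉ B`, the set `B - f
+ g` is independent exactly if `f` and `g` lie in one class (`CapBase.swap_iff`). This reveals the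
classes that meet both `B` and its complement. The other classes cannot be seen, but need not be:
every base contains them or avoids them as `B` does, so they may be cut into singletons
(`CapBase.iff_card_of_refine`).

Programs are written with counting loops whose bounds depend only on the array `0`, which is never
written. This gives a polynomial time bound by recursion on the program (`exec_compile`), and
correctness is proved for the state function `FProg.den` alone. -/

set_option linter.unusedSectionVars false

/-! ## Group-labelled weighted digraphs and flows of unit capacity -/

/-- A digraph on the arcs `0, …, m - 1` with costs and group labels. -/
structure Net (Γ : Type u) where
  m : ℕ
  tl : ℕ → ℕ
  hd : ℕ → ℕ
  c : ℕ → ℝ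
  lab : ℕ → Γ

namespace Net

open Finset

variable {Γ : Type u} [AddCommGroup Γ]

/-- `G.Walk s l t`: the arcs of `l`, in reverse order, form a walk from `s` to `t`. -/
def Walk (G : Net Γ) (s : ℕ) : List ℕ → ℕ → Prop
  | [], t => s = t
  | e :: l, t => e < G.m ∧ G.hd e = t ∧ Walk G s l (G.tl e)

/-- The cost of a walk. -/
def cost (G : Net Γ) (l : List ℕ) : ℝ := (l.map G.c).sum

/-- The label of a walk. -/
def label (G : Net Γ) (l : List ℕ) : Γ := (l.map G.lab).sum

/-- The contribution of the arc `e` to the net out-degree of `v`. -/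
def chi (G : Net Γ) (v e : ℕ) : ℤ :=
  (if G.tl e = v then 1 else 0) - (if G.hd e = v then 1 else 0)

/-- The net out-degree of `v` in the arc set `D`. -/
def net (G : Net Γ) (D : Finset ℕ) (v : ℕ) : ℤ := ∑ e ∈ D, G.chi v e

/-- The residual digraph: the arcs of `B` are reversed. -/
def flip (G : Net Γ) (B : Finset ℕ) : Net Γ where
  m := G.m
  tl e := if e ∈ B then G.hd e else G.tl e
  hd e := if e ∈ B then G.tl e else G.hd e
  c e := if e ∈ B then - G.c e else G.c e
  lab e := if e ∈ B then - G.lab e else G.lab e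

/-- No closed walk has negative cost. -/
def Conservative (G : Net Γ) : Prop := ∀ s l, G.Walk s l s → 0 ≤ G.cost l

/-- `B` has minimum cost among the arc sets with the same net degrees. -/
def Optimal (G : Net Γ) (B : Finset ℕ) : Prop :=
  ∀ B' ⊆ range G.m, (∀ v, G.net B' v = G.net B v) → ∑ e ∈ B, G.c e ≤ ∑ e ∈ B', G.c e

variable {G : Net Γ} {s t v : ℕ} {l l' : List ℕ} {D B B' : Finset ℕ}

@[simp] theorem cost_nil : G.cost [] = 0 := rfl
@[simp] theorem cost_cons (e : ℕ) : G.cost (e :: l) = G.c e + G.cost l := by simp [cost]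
@[simp] theorem cost_append : G.cost (l ++ l') = G.cost l + G.cost l' := by simp [cost]
@[simp] theorem label_nil : G.label [] = 0 := rfl
@[simp] theorem label_cons (e : ℕ) : G.label (e :: l) = G.lab e + G.label l := by simp [label]
@[simp] theorem label_append : G.label (l ++ l') = G.label l + G.label l' := by simp [label]

theorem cost_eq_sum (h : l.Nodup) : G.cost l = ∑ e ∈ l.toFinset, G.c e :=
  (List.sum_toFinset _ h).symm

theorem label_eq_sum (h : l.Nodup) : G.label l = ∑ e ∈ l.toFinset, G.lab e :=
  (List.sum_toFinset _ h).symm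

theorem walk_append : G.Walk s (l ++ l') t ↔ ∃ x, G.Walk s l' x ∧ G.Walk x l t := by
  induction l generalizing t with
  | nil => simp [Walk]
  | cons e l ih => simp only [List.cons_append, Walk, ih]; grind

theorem Walk.lt_m (h : G.Walk s l t) : ∀ e ∈ l, e < G.m := by
  induction l generalizing t with
  | nil => simp
  | cons e l ih => simp only [Walk] at h; simp only [List.mem_cons]; grind

theorem Walk.toFinset_subset (h : G.Walk s l t) : l.toFinset ⊆ range G.m := fun e he => by
  simpa using h.lt_m e (by simpa using he)

theorem length_le (hn : l.Nodup) (h : l.toFinset ⊆ range G.m) : l.length ≤ G.m := by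
  simpa [List.toFinset_card_of_nodup hn] using card_le_card h

/-- The contributions telescope along the walk. -/
theorem Walk.sum_chi (h : G.Walk s l t) :
    (l.map (G.chi v)).sum = (if s = v then 1 else 0) - (if t = v then 1 else 0) := by
  induction l generalizing t with
  | nil => simp only [Walk] at h; simp [h]
  | cons e l ih =>
    obtain ⟨-, rfl, h⟩ := h
    simp only [List.map_cons, List.sum_cons, ih h, chi]; ring

theorem Walk.net_eq (h : G.Walk s l t) (hn : l.Nodup) :
    G.net l.toFinset v = (if s = v then 1 else 0) - (if t = v then 1 else 0) := by
  rw [net, List.sum_toFinset _ hn, h.sum_chi]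

/-- A walk that repeats an arc splits into a shorter walk and a closed walk. -/
theorem Walk.split (h : G.Walk s l t) (hn : ¬ l.Nodup) :
    ∃ l₁ l₂ x, G.Walk s l₁ t ∧ G.Walk x l₂ x ∧ l₁.length < l.length ∧ l₂.length < l.length ∧
      G.cost l = G.cost l₁ + G.cost l₂ ∧ G.label l = G.label l₁ + G.label l₂ := by
  obtain ⟨e, he⟩ : ∃ e, List.Duplicate e l := by
    by_contra! hc; exact hn (List.nodup_iff_forall_not_duplicate.2 hc)
  obtain ⟨a, b, c, rfl⟩ : ∃ a b c, l = a ++ e :: (b ++ e :: c) := by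
    have h2 : [e, e].Sublist l := List.duplicate_iff_sublist.1 he
    obtain ⟨r₁, r₂, rfl, h3, h4⟩ := List.cons_sublist_iff.1 h2
    obtain ⟨a, b, rfl⟩ := List.append_of_mem h3
    obtain ⟨b', c, rfl⟩ := List.append_of_mem (List.singleton_sublist.1 h4)
    exact ⟨a, b ++ b', c, by simp⟩
  rw [walk_append] at h
  obtain ⟨x, hx, ha⟩ := h
  obtain ⟨hem, rfl, hx⟩ := hx
  rw [walk_append] at hx
  obtain ⟨y, ⟨_, rfl, hc⟩, hb⟩ := hx
  -- Lists are read backwards: the part between the two traversals of `e`, with the later one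
  -- included, starts and ends at the head of `e`.
  refine ⟨a ++ e :: c, e :: b, G.hd e, walk_append.2 ⟨_, ⟨hem, rfl, hc⟩, ha⟩, ⟨hem, rfl, hb⟩,
    by simp, by simp; omega, ?_, ?_⟩
  · simp; ring
  · simp [add_left_comm, add_comm]

/-- Repeated splitting reduces a closed walk to closed trails; only trails can be flipped, so only
these are tested against optimality. -/
theorem conservative_of_trails (h : ∀ s l, G.Walk s l s → l.Nodup → 0 ≤ G.cost l) :
    G.Conservative := by
  intro s l hl
  induction hk : l.length using Nat.strong_induction_on generalizing s l with
  | _ k ih =>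
    by_cases hn : l.Nodup
    · exact h s l hl hn
    · obtain ⟨l₁, l₂, x, h₁, h₂, hk₁, hk₂, hc, -⟩ := hl.split hn
      have := ih _ (hk ▸ hk₁) _ _ h₁ rfl
      have := ih _ (hk ▸ hk₂) _ _ h₂ rfl
      linarith

/-- A walk that no shorter walk can match has no repeated arc. -/
theorem Conservative.nodup_of_min (hG : G.Conservative) (hl : G.Walk s l t)
    (hmin : ∀ l', G.Walk s l' t → l'.length < l.length → G.cost l < G.cost l') : l.Nodup := by
  by_contra hn
  obtain ⟨l₁, l₂, x, h₁, h₂, hk₁, hk₂, hc, -⟩ := hl.split hn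
  have := hmin _ h₁ hk₁
  have := hG _ _ h₂
  linarith

/-- If an arc were repeated, one of the two closed parts would have non-zero label. It is shorter,
and no more expensive because the other part costs at least `0`. -/
theorem Conservative.nodup_of_min_nonzero (hG : G.Conservative) (hl : G.Walk s l s)
    (hne : G.label l ≠ 0)
    (hmin : ∀ s' l', G.Walk s' l' s' → G.label l' ≠ 0 → l'.length < l.length →
      G.cost l < G.cost l') : l.Nodup := by
  by_contra hn
  obtain ⟨l₁, l₂, x, h₁, h₂, hk₁, hk₂, hc, hlab⟩ := hl.split hn
  have := hG _ _ h₁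
  have := hG _ _ h₂
  by_cases h0 : G.label l₁ = 0
  · have := hmin _ _ h₂ (by rw [hlab, h0, zero_add] at hne; exact hne) hk₂
    linarith
  · have := hmin _ _ h₁ h0 hk₁
    linarith

/-! ### Decomposition of arc sets into trails -/

/-- A maximal trail inside `D`. -/
theorem exists_maximal_trail (hD : D ⊆ range G.m) (s : ℕ) :
    ∃ l x, G.Walk s l x ∧ l.Nodup ∧ l.toFinset ⊆ D ∧ ∀ e ∈ D, e ∉ l → G.tl e ≠ x := by
  suffices H : ∀ k l x, G.Walk s l x → l.Nodup → l.toFinset ⊆ D → (D \ l.toFinset).card = k →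
      ∃ l x, G.Walk s l x ∧ l.Nodup ∧ l.toFinset ⊆ D ∧ ∀ e ∈ D, e ∉ l → G.tl e ≠ x from
    H _ [] s rfl List.nodup_nil (by simp) rfl
  intro k
  induction k with
  | zero =>
    intro l x hl hn hs hk
    refine ⟨l, x, hl, hn, hs, fun e he hel => ?_⟩
    have : e ∈ D \ l.toFinset := by simp [he, hel]
    simp [card_eq_zero.1 hk] at this
  | succ k ih =>
    intro l x hl hn hs hk
    by_cases hc : ∀ e ∈ D, e ∉ l → G.tl e ≠ x
    · exact ⟨l, x, hl, hn, hs, hc⟩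
    · push Not at hc
      obtain ⟨e, he, hel, rfl⟩ := hc
      refine ih (e :: l) (G.hd e) ⟨by simpa using hD he, rfl, hl⟩ (by simp [hel, hn]) ?_ ?_
      · intro a ha
        simp only [List.toFinset_cons, mem_insert] at ha
        rcases ha with rfl | ha
        · exact he
        · exact hs ha
      · rw [List.toFinset_cons, sdiff_insert, card_erase_of_mem (by simp [he, hel]), hk]; rfl

theorem net_sdiff (h : B ⊆ D) : G.net (D \ B) v = G.net D v - G.net B v := by
  rw [net, net, net, ← sum_sdiff h]; ring

/-- In every set of arcs there is a trail from `s` that ends where the set has an excess of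
entering arcs. -/
theorem exists_trail (hD : D ⊆ range G.m) (s : ℕ) :
    ∃ l x, G.Walk s l x ∧ l.Nodup ∧ l.toFinset ⊆ D ∧
      G.net D x ≤ (if s = x then 1 else 0) - 1 ∧ (l = [] → ∀ e ∈ D, G.tl e ≠ s) := by
  obtain ⟨l, x, hl, hn, hs, hmax⟩ := exists_maximal_trail hD s
  refine ⟨l, x, hl, hn, hs, ?_, ?_⟩
  · have h1 := net_sdiff (G := G) (v := x) hs
    -- By maximality no unused arc of `D` leaves `x`, so the unused arcs can only enter it.
    have h2 : G.net (D \ l.toFinset) x ≤ 0 := sum_nonpos fun e he => by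
      have := hmax e (mem_sdiff.1 he).1 (by simpa using (mem_sdiff.1 he).2)
      simp only [chi, if_neg this]; split_ifs <;> simp
    rw [hl.net_eq hn] at h1
    simp at h1; linarith
  · rintro rfl e he
    obtain rfl : s = x := hl
    exact hmax e he (by simp)

/-- In a balanced set the excess condition at the end of a maximal trail forces the end to be the
start; starting at the tail of an arc of `D` makes the trail non-empty. -/
theorem exists_closed_trail (hD : D ⊆ range G.m) (h0 : ∀ v, G.net D v = 0) (hne : D.Nonempty) :
    ∃ s l, G.Walk s l s ∧ l.Nodup ∧ l.toFinset ⊆ D ∧ l ≠ [] := by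
  obtain ⟨e, he⟩ := hne
  obtain ⟨l, x, hl, hn, hs, hx, hnil⟩ := exists_trail hD (G.tl e)
  rw [h0] at hx
  split_ifs at hx with h
  · subst h; exact ⟨_, l, hl, hn, hs, fun h => hnil h e he rfl⟩
  · omega

/-- Closed trails are peeled off one by one. All of them cost at least `0`, so each is at most as
expensive as the whole set, and if the total label is non-zero then some trail has non-zero label.
-/
theorem Conservative.sum_nonneg_and_exists (hG : G.Conservative) (hD : D ⊆ range G.m)
    (h0 : ∀ v, G.net D v = 0) :
    0 ≤ ∑ e ∈ D, G.c e ∧ (∑ e ∈ D, G.lab e ≠ 0 → ∃ s l, G.Walk s l s ∧ l.Nodup ∧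
      G.label l ≠ 0 ∧ G.cost l ≤ ∑ e ∈ D, G.c e) := by
  induction hk : D.card using Nat.strong_induction_on generalizing D with
  | _ k ih =>
    rcases D.eq_empty_or_nonempty with rfl | hne
    · simp
    · obtain ⟨s, l, hl, hn, hs, hnil⟩ := exists_closed_trail hD h0 hne
      have hcard : (D \ l.toFinset).card < k := by
        rw [← hk]
        refine card_lt_card (sdiff_ssubset hs ?_)
        simpa using hnil
      obtain ⟨h1, h2⟩ := ih _ hcard (sdiff_subset.trans hD)
        (fun v => by rw [net_sdiff hs, h0, hl.net_eq hn]; simp) rfl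
      have hc := sum_sdiff (f := G.c) hs
      have hb := sum_sdiff (f := G.lab) hs
      rw [← cost_eq_sum hn] at hc
      rw [← label_eq_sum hn] at hb
      have h3 := hG _ _ hl
      refine ⟨by linarith, fun hlab => ?_⟩
      by_cases h4 : G.label l = 0
      · obtain ⟨s', l', h5, h6, h7, h8⟩ := h2 (by rw [← hb, h4, add_zero] at hlab; exact hlab)
        exact ⟨s', l', h5, h6, h7, by linarith⟩
      · exact ⟨s, l, hl, hn, h4, by linarith⟩

/-! ### Residual digraphs -/

/-- The common part of `B` and `B'` cancels. This one identity serves the net degrees, the costs and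
the labels of the residual digraph. -/
theorem sum_symmDiff_ite {A : Type*} [AddCommGroup A] (x : ℕ → A) (B B' : Finset ℕ) :
    ∑ e ∈ symmDiff B B', (if e ∈ B then - x e else x e) = ∑ e ∈ B', x e - ∑ e ∈ B, x e := by
  have h1 : ∑ e ∈ B \ B', (if e ∈ B then - x e else x e) = - ∑ e ∈ B \ B', x e := by
    rw [← sum_neg_distrib]; exact sum_congr rfl fun e he => by grind
  have h2 : ∑ e ∈ B' \ B, (if e ∈ B then - x e else x e) = ∑ e ∈ B' \ B, x e :=
    sum_congr rfl fun e he => by grind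
  rw [symmDiff_def, sup_eq_union, sum_union disjoint_sdiff_sdiff, h1, h2,
    ← sum_inter_add_sum_sdiff B B' x, ← sum_inter_add_sum_sdiff B' B x, inter_comm B' B]
  abel

theorem net_flip (B B' : Finset ℕ) :
    (G.flip B).net (symmDiff B B') v = G.net B' v - G.net B v := by
  rw [net, net, net, ← sum_symmDiff_ite]
  refine sum_congr rfl fun e _ => ?_
  simp only [chi, flip]; split_ifs <;> simp

theorem sum_c_flip (B B' : Finset ℕ) :
    ∑ e ∈ symmDiff B B', (G.flip B).c e = ∑ e ∈ B', G.c e - ∑ e ∈ B, G.c e :=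
  sum_symmDiff_ite _ _ _

theorem sum_lab_flip (B B' : Finset ℕ) :
    ∑ e ∈ symmDiff B B', (G.flip B).lab e = ∑ e ∈ B', G.lab e - ∑ e ∈ B, G.lab e :=
  sum_symmDiff_ite _ _ _

theorem net_symmDiff_flip (B D : Finset ℕ) :
    G.net (symmDiff B D) v = G.net B v + (G.flip B).net D v := by
  have := net_flip (G := G) (v := v) B (symmDiff B D)
  rw [symmDiff_symmDiff_cancel_left] at this
  linarith

theorem sum_c_symmDiff (B D : Finset ℕ) :
    ∑ e ∈ symmDiff B D, G.c e = ∑ e ∈ B, G.c e + ∑ e ∈ D, (G.flip B).c e := by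
  have := sum_c_flip (G := G) B (symmDiff B D)
  rw [symmDiff_symmDiff_cancel_left] at this
  linarith

theorem sum_lab_symmDiff (B D : Finset ℕ) :
    ∑ e ∈ symmDiff B D, G.lab e = ∑ e ∈ B, G.lab e + ∑ e ∈ D, (G.flip B).lab e := by
  have := sum_lab_flip (G := G) B (symmDiff B D)
  rw [symmDiff_symmDiff_cancel_left] at this
  rw [this]; abel

theorem symmDiff_subset_range (hB : B ⊆ range G.m) (hD : D ⊆ range G.m) :
    symmDiff B D ⊆ range G.m := by
  intro e he
  rw [mem_symmDiff] at he
  rcases he with h | h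
  · exact hB h.1
  · exact hD h.1

/-- Flipping a closed trail keeps the net degrees, so one of negative cost would improve `B`. -/
theorem Optimal.conservative (h : G.Optimal B) (hB : B ⊆ range G.m) :
    (G.flip B).Conservative := by
  refine conservative_of_trails fun s l hl hn => ?_
  have := h (symmDiff B l.toFinset) (symmDiff_subset_range hB hl.toFinset_subset) fun v => by
    rw [net_symmDiff_flip, hl.net_eq hn]; simp
  rw [sum_c_symmDiff, ← cost_eq_sum hn] at this
  linarith

/-- Augmenting along a shortest walk keeps optimality. -/
theorem Optimal.augment (h : G.Optimal B) (hB : B ⊆ range G.m) (hst : s ≠ t)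
    (hl : (G.flip B).Walk s l t)
    -- Competitors of at most `m` arcs are enough, since the competing walks that occur are trails
    -- or shorter than `l`; the tables only reach that far.
    (hmin : ∀ l', (G.flip B).Walk s l' t → l'.length ≤ G.m →
      (G.flip B).cost l ≤ (G.flip B).cost l' ∧
      (l'.length < l.length → (G.flip B).cost l < (G.flip B).cost l'))
    (hlen : l.length ≤ G.m) :
    l.Nodup ∧ G.Optimal (symmDiff B l.toFinset) ∧
      ∀ v, G.net (symmDiff B l.toFinset) v =
        G.net B v + ((if s = v then 1 else 0) - (if t = v then 1 else 0)) := by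
  have hc := h.conservative hB
  have hn : l.Nodup := hc.nodup_of_min hl fun l' h' hlt => (hmin l' h' (by omega)).2 hlt
  have hnet : ∀ v, G.net (symmDiff B l.toFinset) v =
      G.net B v + ((if s = v then 1 else 0) - (if t = v then 1 else 0)) := fun v => by
    rw [net_symmDiff_flip, hl.net_eq hn]
  refine ⟨hn, fun B' hB' hnet' => ?_, hnet⟩
  have hD : symmDiff B B' ⊆ range (G.flip B).m := symmDiff_subset_range hB hB'
  have hDnet : ∀ v, (G.flip B).net (symmDiff B B') v =
      (if s = v then 1 else 0) - (if t = v then 1 else 0) := fun v => by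
    rw [net_flip, hnet', hnet]; ring
  obtain ⟨l', x, hl', hn', hs', hx, -⟩ := exists_trail hD s
  -- The difference has net degree `1` at `s`, `-1` at `t` and `0` elsewhere, so `t` is the only
  -- possible end of the trail.
  have hxt : x = t := by
    rw [hDnet] at hx
    by_cases h1 : s = x
    · subst h1; simp [hst.symm] at hx
    · by_contra h2; simp [h1, Ne.symm h2] at hx
  subst hxt
  -- Without the trail from `s` to `t` the difference is balanced, hence costs at least `0`; and
  -- that trail costs at least as much as `l`.
  have h1 := (hc.sum_nonneg_and_exists (sdiff_subset.trans hD) (D := symmDiff B B' \ l'.toFinset)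
    fun v => by rw [net_sdiff hs', hDnet, hl'.net_eq hn']; ring).1
  have h2 := sum_sdiff (f := (G.flip B).c) hs'
  rw [sum_c_flip, ← cost_eq_sum hn'] at h2
  have h3 := (hmin l' hl' (length_le hn' hl'.toFinset_subset)).1
  rw [sum_c_symmDiff, ← cost_eq_sum hn]
  linarith

/-- As long as a set with the required net degrees exists, it can be approached. -/
theorem exists_augmenting_walk (hB : B ⊆ range G.m) (hB' : B' ⊆ range G.m)
    (hs : G.net B s < G.net B' s) :
    ∃ t l, (G.flip B).Walk s l t ∧ l.length ≤ G.m ∧ G.net B' t < G.net B t := by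
  obtain ⟨l, x, hl, hn, -, hx, -⟩ := exists_trail (G := G.flip B) (symmDiff_subset_range hB hB') s
  refine ⟨x, l, hl, length_le hn hl.toFinset_subset, ?_⟩
  rw [net_flip] at hx
  split_ifs at hx with h
  · subst h; omega
  · omega

/-- Flipping a shortest non-zero closed walk gives a cheapest non-zero set. -/
theorem Optimal.nonzero (h : G.Optimal B) (hB : B ⊆ range G.m)
    (h0 : ∑ e ∈ B, G.lab e = 0) (hl : (G.flip B).Walk s l s) (hne : (G.flip B).label l ≠ 0)
    (hmin : ∀ s' l', (G.flip B).Walk s' l' s' → (G.flip B).label l' ≠ 0 → l'.length ≤ G.m →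
      (G.flip B).cost l ≤ (G.flip B).cost l' ∧
      (l'.length < l.length → (G.flip B).cost l < (G.flip B).cost l'))
    (hlen : l.length ≤ G.m) :
    l.Nodup ∧ (∀ v, G.net (symmDiff B l.toFinset) v = G.net B v) ∧
      ∑ e ∈ symmDiff B l.toFinset, G.lab e ≠ 0 ∧
      ∀ B' ⊆ range G.m, (∀ v, G.net B' v = G.net B v) → ∑ e ∈ B', G.lab e ≠ 0 →
        ∑ e ∈ symmDiff B l.toFinset, G.c e ≤ ∑ e ∈ B', G.c e := by
  have hc := h.conservative hB
  have hn : l.Nodup := hc.nodup_of_min_nonzero hl hne fun s' l' h' hne' hlt =>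
    (hmin s' l' h' hne' (by omega)).2 hlt
  refine ⟨hn, fun v => by rw [net_symmDiff_flip, hl.net_eq hn]; simp, ?_, ?_⟩
  · rw [sum_lab_symmDiff, h0, zero_add, ← label_eq_sum hn]; exact hne
  · intro B' hB' hnet hlab
    obtain ⟨s', l', h1, h2, h3, h4⟩ := (hc.sum_nonneg_and_exists (D := symmDiff B B')
      (symmDiff_subset_range hB hB') fun v => by rw [net_flip, hnet]; simp).2
        (by rw [sum_lab_flip, h0, sub_zero]; exact hlab)
    have h5 := (hmin s' l' h1 h3 (length_le h2 h1.toFinset_subset)).1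
    rw [sum_c_flip] at h4
    rw [sum_c_symmDiff, ← cost_eq_sum hn]
    linarith

/-- This justifies a negative answer: if the search for non-zero closed walks of at most `m` arcs
fails, every feasible set has label zero. -/
theorem Optimal.exists_nonzero (h : G.Optimal B) (hB : B ⊆ range G.m)
    (h0 : ∑ e ∈ B, G.lab e = 0) (hB' : B' ⊆ range G.m) (hnet : ∀ v, G.net B' v = G.net B v)
    (hlab : ∑ e ∈ B', G.lab e ≠ 0) :
    ∃ s l, (G.flip B).Walk s l s ∧ l.length ≤ G.m ∧ (G.flip B).label l ≠ 0 := by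
  obtain ⟨s', l', h1, h2, h3, h4⟩ := ((h.conservative hB).sum_nonneg_and_exists (D := symmDiff B B')
    (symmDiff_subset_range hB hB') fun v => by rw [net_flip, hnet]; simp).2
      (by rw [sum_lab_flip, h0, sub_zero]; exact hlab)
  exact ⟨s', l', h1, length_le h2 h1.toFinset_subset, h3⟩

end Net

/-! ## Programs with counting loops -/

namespace OracleRAM

/-- Programs whose only loops are counting loops: `for_ a b c` runs `c` with the cell `0` of the
array `a` equal to `0, …, b - 1`. -/
inductive FProg : Type
  | nop
  | setNat (a : ℕ) (i x : NExp)
  | setGrp (a : ℕ) (i : NExp) (x : GExp)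
  | setWt (a : ℕ) (i : NExp) (x : WExp)
  | seq (c d : FProg)
  | ite (b : Test) (c d : FProg)
  | for_ (a : ℕ) (b : NExp) (c : FProg)

infixr:60 " ;; " => FProg.seq

/-- The cell `0` of an array. -/
abbrev NExp.cell (a : ℕ) : NExp := .read a (.const 0)

/-- The value of an expression depends on the array `0` only. -/
def NExp.isFixed : NExp → Bool
  | const _ => true
  | read a i => a == 0 && i.isFixed
  | add x y => x.isFixed && y.isFixed
  | sub x y => x.isFixed && y.isFixed

/-- A bound for the value of a fixed expression. -/
noncomputable def NExp.bound : NExp → Polynomial ℕ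
  | const c => Polynomial.C c
  | read _ _ => Polynomial.X
  | add x y => x.bound + y.bound
  | sub x _ => x.bound

namespace FProg

/-- The counter of a loop is below the bound. -/
def test (a : ℕ) (b : NExp) : Test := .natLe (.add (.cell a) (.const 1)) b

/-- Incrementing the counter of a loop. -/
def incr (a : ℕ) : Prog := .setNat a (.const 0) (.add (.cell a) (.const 1))

/-- The translation to the machine. -/
def compile : FProg → Prog
  | nop => .skip
  | setNat a i x => .setNat a i x
  | setGrp a i x => .setGrp a i x
  | setWt a i x => .setWt a i x
  | seq c d => .seq c.compile d.compile
  | ite b c d => .ite b c.compile d.compile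
  | for_ a b c => .seq (.setNat a (.const 0) (.const 0))
      (.loop (test a b) (.seq c.compile (incr a)))

/-- The arrays of natural numbers that a program may change. -/
def writesNat (x : ℕ) : FProg → Bool
  | nop => false
  | setNat a _ _ => x == a
  | setGrp _ _ _ => false
  | setWt _ _ _ => false
  | seq c d => c.writesNat x || d.writesNat x
  | ite _ c d => c.writesNat x || d.writesNat x
  | for_ a _ c => x == a || c.writesNat x

/-- The arrays of group elements that a program may change. -/
def writesGrp (x : ℕ) : FProg → Bool
  | nop => false
  | setNat _ _ _ => false
  | setGrp a _ _ => x == a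
  | setWt _ _ _ => false
  | seq c d => c.writesGrp x || d.writesGrp x
  | ite _ c d => c.writesGrp x || d.writesGrp x
  | for_ _ _ c => c.writesGrp x

/-- The arrays of weights that a program may change. -/
def writesWt (x : ℕ) : FProg → Bool
  | nop => false
  | setNat _ _ _ => false
  | setGrp _ _ _ => false
  | setWt a _ _ => x == a
  | seq c d => c.writesWt x || d.writesWt x
  | ite _ c d => c.writesWt x || d.writesWt x
  | for_ _ _ c => c.writesWt x

/-- Loop counters are not changed by the loop body, and loop bounds are fixed. -/
def wellFormed : FProg → Bool
  | seq c d => c.wellFormed && d.wellFormed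
  | ite _ c d => c.wellFormed && d.wellFormed
  | for_ a b c => !c.writesNat a && b.isFixed && c.wellFormed
  | _ => true

/-- A bound for the number of steps. -/
noncomputable def time : FProg → Polynomial ℕ
  | nop => 1
  | setNat _ i x => Polynomial.C (i.cost + x.cost + 1)
  | setGrp _ i x => Polynomial.C (i.cost + x.cost + 1)
  | setWt _ i x => Polynomial.C (i.cost + x.cost + 1)
  | seq c d => c.time + d.time
  | ite b c d => Polynomial.C b.cost + c.time + d.time
  | for_ a b c => 3 + Polynomial.C (test a b).cost +
      b.bound * (Polynomial.C ((test a b).cost + 6) + c.time)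

end FProg

section semantics

variable {Γ : Type u}

@[simp] theorem State.nat_setNat (s : State Γ) (a i x b : ℕ) :
    (s.setNat a i x).nat b = if b = a then Function.update (s.nat a) i x else s.nat b := by
  simp [State.setNat, Function.update_apply]

@[simp] theorem State.grp_setNat (s : State Γ) (a i x : ℕ) : (s.setNat a i x).grp = s.grp := rfl
@[simp] theorem State.wt_setNat (s : State Γ) (a i x : ℕ) : (s.setNat a i x).wt = s.wt := rfl

@[simp] theorem State.grp_setGrp (s : State Γ) (a i : ℕ) (x : Γ) (b : ℕ) :
    (s.setGrp a i x).grp b = if b = a then Function.update (s.grp a) i x else s.grp b := by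
  simp [State.setGrp, Function.update_apply]

@[simp] theorem State.nat_setGrp (s : State Γ) (a i : ℕ) (x : Γ) :
    (s.setGrp a i x).nat = s.nat := rfl
@[simp] theorem State.wt_setGrp (s : State Γ) (a i : ℕ) (x : Γ) :
    (s.setGrp a i x).wt = s.wt := rfl

@[simp] theorem State.wt_setWt (s : State Γ) (a i : ℕ) (x : ℝ) (b : ℕ) :
    (s.setWt a i x).wt b = if b = a then Function.update (s.wt a) i x else s.wt b := by
  simp [State.setWt, Function.update_apply]

@[simp] theorem State.nat_setWt (s : State Γ) (a i : ℕ) (x : ℝ) :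
    (s.setWt a i x).nat = s.nat := rfl
@[simp] theorem State.grp_setWt (s : State Γ) (a i : ℕ) (x : ℝ) :
    (s.setWt a i x).grp = s.grp := rfl

theorem NExp.eval_congr {x : NExp} (hx : x.isFixed = true) {s s' : State Γ}
    (h : s.nat 0 = s'.nat 0) : x.eval s = x.eval s' := by
  induction x with
  | const => rfl
  | read a i ih =>
    simp only [isFixed, Bool.and_eq_true, beq_iff_eq] at hx
    simp [eval, hx.1, ih hx.2, h]
  | add x y ihx ihy =>
    simp only [isFixed, Bool.and_eq_true] at hx
    simp [eval, ihx hx.1, ihy hx.2]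
  | sub x y ihx ihy =>
    simp only [isFixed, Bool.and_eq_true] at hx
    simp [eval, ihx hx.1, ihy hx.2]

theorem NExp.eval_le_bound {x : NExp} (hx : x.isFixed = true) {s : State Γ} {M : ℕ}
    (h : ∀ i, s.nat 0 i ≤ M) : x.eval s ≤ x.bound.eval M := by
  induction x with
  | const => simp [eval, bound]
  | read a i ih =>
    simp only [isFixed, Bool.and_eq_true, beq_iff_eq] at hx
    simpa [eval, hx.1, bound] using h _
  | add x y ihx ihy =>
    simp only [isFixed, Bool.and_eq_true] at hx
    simpa [eval, bound] using add_le_add (ihx hx.1) (ihy hx.2)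
  | sub x y ihx ihy =>
    simp only [isFixed, Bool.and_eq_true] at hx
    simp only [eval, bound]
    exact (Nat.sub_le _ _).trans (ihx hx.1)

variable [AddCommGroup Γ]

/-- The states reached by a counting loop with the counter `a` and the body `f`. -/
def iterate (a : ℕ) (f : State Γ → State Γ) (s : State Γ) : ℕ → State Γ
  | 0 => s.setNat a 0 0
  | k + 1 => (f (iterate a f s k)).setNat a 0 (k + 1)

open Classical in
/-- The state in which a program ends. -/
noncomputable def FProg.den (O : Oracle) : FProg → State Γ → State Γ
  | nop, s => s
  | setNat a i x, s => s.setNat a (i.eval s) (x.eval s)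
  | setGrp a i x, s => s.setGrp a (i.eval s) (x.eval s)
  | setWt a i x, s => s.setWt a (i.eval s) (x.eval s)
  | seq c d, s => d.den O (c.den O s)
  | ite b c d, s => if b.holds O s then c.den O s else d.den O s
  | for_ a b c, s => iterate a (c.den O) s (b.eval s)

section den

variable {O : Oracle} {b : Test} {c d : FProg} {s : State Γ}

theorem den_seq : (FProg.seq c d).den O s = d.den O (c.den O s) := rfl

theorem den_ite_pos (h : b.holds O s) : (FProg.ite b c d).den O s = c.den O s := by
  rw [FProg.den, if_pos h]

theorem den_ite_neg (h : ¬ b.holds O s) : (FProg.ite b c d).den O s = d.den O s := by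
  rw [FProg.den, if_neg h]

end den

/-- The states agree on all arrays that `P` does not change. -/
structure Agree (P : FProg) (s s' : State Γ) : Prop where
  nat : ∀ x, P.writesNat x = false → s'.nat x = s.nat x
  grp : ∀ x, P.writesGrp x = false → s'.grp x = s.grp x
  wt : ∀ x, P.writesWt x = false → s'.wt x = s.wt x

variable {O : Oracle} {P : FProg} {s s' : State Γ}

theorem agree_iterate {a : ℕ} {b : NExp} {c : FProg} (hc : ∀ s : State Γ, Agree c s (c.den O s))
    (s : State Γ) (k : ℕ) : Agree (.for_ a b c) s (iterate a (c.den O) s k) := by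
  induction k with
  | zero =>
    refine ⟨fun x hx => ?_, fun x _ => rfl, fun x _ => rfl⟩
    simp only [FProg.writesNat, Bool.or_eq_false_iff, beq_eq_false_iff_ne] at hx
    simp [iterate, hx.1]
  | succ k ih =>
    refine ⟨fun x hx => ?_, fun x hx => ?_, fun x hx => ?_⟩
    · rw [← ih.nat x hx]
      simp only [FProg.writesNat, Bool.or_eq_false_iff, beq_eq_false_iff_ne] at hx
      simp [iterate, hx.1, (hc _).nat x hx.2]
    · rw [← ih.grp x hx]; simp [iterate, (hc _).grp x hx]
    · rw [← ih.wt x hx]; simp [iterate, (hc _).wt x hx]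

/-- This is the frame rule: since `writesNat` and its companions are computable, that a given array
survives a given program is later proved by `rfl`. -/
theorem den_agree (O : Oracle) (P : FProg) (s : State Γ) : Agree P s (P.den O s) := by
  induction P generalizing s with
  | nop => exact ⟨fun _ _ => rfl, fun _ _ => rfl, fun _ _ => rfl⟩
  | setNat a i x =>
    refine ⟨fun x hx => ?_, fun _ _ => rfl, fun _ _ => rfl⟩
    simp only [FProg.writesNat, beq_eq_false_iff_ne] at hx
    simp [FProg.den, hx]
  | setGrp a i x =>
    refine ⟨fun _ _ => rfl, fun x hx => ?_, fun _ _ => rfl⟩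
    simp only [FProg.writesGrp, beq_eq_false_iff_ne] at hx
    simp [FProg.den, hx]
  | setWt a i x =>
    refine ⟨fun _ _ => rfl, fun _ _ => rfl, fun x hx => ?_⟩
    simp only [FProg.writesWt, beq_eq_false_iff_ne] at hx
    simp [FProg.den, hx]
  | seq c d ihc ihd =>
    refine ⟨fun x hx => ?_, fun x hx => ?_, fun x hx => ?_⟩
    · simp only [FProg.writesNat, Bool.or_eq_false_iff] at hx
      rw [FProg.den, (ihd _).nat x hx.2, (ihc _).nat x hx.1]
    · simp only [FProg.writesGrp, Bool.or_eq_false_iff] at hx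
      rw [FProg.den, (ihd _).grp x hx.2, (ihc _).grp x hx.1]
    · simp only [FProg.writesWt, Bool.or_eq_false_iff] at hx
      rw [FProg.den, (ihd _).wt x hx.2, (ihc _).wt x hx.1]
  | ite b c d ihc ihd =>
    refine ⟨fun x hx => ?_, fun x hx => ?_, fun x hx => ?_⟩
    · simp only [FProg.writesNat, Bool.or_eq_false_iff] at hx
      rw [FProg.den]; split_ifs
      exacts [(ihc _).nat x hx.1, (ihd _).nat x hx.2]
    · simp only [FProg.writesGrp, Bool.or_eq_false_iff] at hx
      rw [FProg.den]; split_ifs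
      exacts [(ihc _).grp x hx.1, (ihd _).grp x hx.2]
    · simp only [FProg.writesWt, Bool.or_eq_false_iff] at hx
      rw [FProg.den]; split_ifs
      exacts [(ihc _).wt x hx.1, (ihd _).wt x hx.2]
  | for_ a b c ih => exact agree_iterate ih s _

theorem iterate_counter (a : ℕ) (f : State Γ → State Γ) (s : State Γ) (k : ℕ) :
    (iterate a f s k).nat a 0 = k := by
  cases k <;> simp [iterate]

/-- The rule for counting loops. -/
theorem den_for {a : ℕ} {b : NExp} {c : FProg} (n : ℕ) (hn : b.eval s = n)
    (Inv : ℕ → State Γ → Prop) (h0 : Inv 0 (s.setNat a 0 0))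
    (hstep : ∀ k < n, ∀ s', Inv k s' → s'.nat a 0 = k → Agree (.for_ a b c) s s' →
      Inv (k + 1) ((c.den O s').setNat a 0 (k + 1))) :
    Inv n ((FProg.for_ a b c).den O s) := by
  rw [FProg.den, hn]
  suffices ∀ k ≤ n, Inv k (iterate a (c.den O) s k) from this n le_rfl
  intro k
  induction k with
  | zero => exact fun _ => h0
  | succ k ih =>
    intro hk
    exact hstep k hk _ (ih (Nat.le_of_succ_le hk)) (iterate_counter _ _ _ _)
      (agree_iterate (den_agree O c) s k)

/-- The array `0` is never written, so a loop bound, which the machine evaluates anew in each round,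
keeps its value, and this value is polynomial in `M`. The time of a loop is therefore at most the
bound times the time of its body, up to the tests. -/
theorem exec_compile (O : Oracle) {P : FProg} (hP : P.wellFormed = true)
    (h0 : P.writesNat 0 = false) {M : ℕ} (s : State Γ) (hM : ∀ i, s.nat 0 i ≤ M) :
    ∃ t, Exec O P.compile s t (P.den O s) ∧ t ≤ P.time.eval M := by
  induction P generalizing s with
  | nop => exact ⟨_, .skip s, by simp [FProg.time]⟩
  | setNat a i x => exact ⟨_, .setNat s a i x, by simp [FProg.time]⟩
  | setGrp a i x => exact ⟨_, .setGrp s a i x, by simp [FProg.time]⟩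
  | setWt a i x => exact ⟨_, .setWt s a i x, by simp [FProg.time]⟩
  | seq c d ihc ihd =>
    simp only [FProg.wellFormed, Bool.and_eq_true, FProg.writesNat, Bool.or_eq_false_iff] at hP h0
    obtain ⟨t, ht, htl⟩ := ihc hP.1 h0.1 s hM
    obtain ⟨t', ht', htl'⟩ := ihd hP.2 h0.2 (c.den O s)
      (by rw [(den_agree O c s).nat 0 h0.1]; exact hM)
    exact ⟨_, .seq ht ht', by simp only [FProg.time, Polynomial.eval_add]; omega⟩
  | ite b c d ihc ihd =>
    simp only [FProg.wellFormed, Bool.and_eq_true, FProg.writesNat, Bool.or_eq_false_iff] at hP h0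
    rw [FProg.den]
    split_ifs with hb
    · obtain ⟨t, ht, htl⟩ := ihc hP.1 h0.1 s hM
      exact ⟨_, .iteTrue hb ht, by
        simp only [FProg.time, Polynomial.eval_add, Polynomial.eval_C]; omega⟩
    · obtain ⟨t, ht, htl⟩ := ihd hP.2 h0.2 s hM
      exact ⟨_, .iteFalse hb ht, by
        simp only [FProg.time, Polynomial.eval_add, Polynomial.eval_C]; omega⟩
  | for_ a b c ih =>
    have h0' := h0
    simp only [FProg.wellFormed, Bool.and_eq_true, FProg.writesNat, Bool.or_eq_false_iff,
      Bool.not_eq_true'] at hP h0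
    obtain ⟨⟨hca, hb⟩, hc⟩ := hP
    set n := b.eval s with hn
    have hag := agree_iterate (a := a) (b := b) (den_agree O c) s
    have hbk : ∀ k, b.eval (iterate a (c.den O) s k) = n := fun k =>
      NExp.eval_congr hb ((hag k).nat 0 h0')
    -- Induction on the number `j` of rounds that remain, because an execution of a loop is built
    -- from its end. The constant `6` is the cost of `incr`.
    have key : ∀ j k, k + j = n → ∃ t, Exec O (.loop (FProg.test a b)
        (.seq c.compile (FProg.incr a))) (iterate a (c.den O) s k) t (iterate a (c.den O) s n) ∧
        t ≤ (FProg.test a b).cost + j * ((FProg.test a b).cost + 6 + c.time.eval M) := by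
      intro j
      induction j with
      | zero =>
        rintro k rfl
        refine ⟨_, .loopStop ?_, by simp⟩
        simp [FProg.test, Test.holds, NExp.eval, iterate_counter, hbk]
      | succ j ihj =>
        intro k hk
        obtain ⟨t, ht, htl⟩ := ih hc h0.2 (iterate a (c.den O) s k)
          (by rw [(hag k).nat 0 h0']; exact hM)
        obtain ⟨t', ht', htl'⟩ := ihj (k + 1) (by omega)
        have hx : Exec O (FProg.incr a) (c.den O (iterate a (c.den O) s k)) 6
            (iterate a (c.den O) s (k + 1)) := by
          have := Exec.setNat (O := O) (c.den O (iterate a (c.den O) s k)) a (.const 0)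
            (.add (.cell a) (.const 1))
          simpa [FProg.incr, NExp.eval, NExp.cost, (den_agree O c _).nat a hca, iterate_counter, iterate]
            using this
        refine ⟨_, .loopStep ?_ (.seq ht hx) ht', by rw [add_mul]; omega⟩
        simp only [FProg.test, Test.holds, NExp.eval, iterate_counter, hbk]
        omega
    obtain ⟨t, ht, htl⟩ := key n 0 (by simp)
    refine ⟨_, .seq (.setNat s a (.const 0) (.const 0)) ht, ?_⟩
    have hle : n ≤ _ := NExp.eval_le_bound hb hM
    have := Nat.mul_le_mul_right ((FProg.test a b).cost + 6 + c.time.eval M) hle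
    simp only [FProg.time, Polynomial.eval_add, Polynomial.eval_C, Polynomial.eval_mul,
      Polynomial.eval_ofNat, NExp.cost]
    omega

theorem haltsWithin_compile {P : FProg} (hP : P.wellFormed = true)
    (h0 : P.writesNat 0 = false) {M : ℕ} (hM : ∀ i, s.nat 0 i ≤ M) {post : State Γ → Prop}
    (h : post (P.den O s)) : HaltsWithin O P.compile s (P.time.eval M) post := by
  obtain ⟨t, ht, htl⟩ := exec_compile O hP h0 s hM
  exact ⟨t, _, ht, htl, h⟩

end semantics

end OracleRAM

/-! ## Tables of shortest walks with two different labels -/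

/-- A table of walks: an entry stores whether there is a walk, its last arc, the entry of the
rest of the walk, its cost and its label. -/
structure Tab (Γ : Type u) where
  valid : ℕ → ℕ
  arc : ℕ → ℕ
  prev : ℕ → ℕ
  d : ℕ → ℝ
  g : ℕ → Γ

namespace Tab

variable {Γ : Type u} [AddCommGroup Γ]

/-- The list `l` is obtained by following the pointers from the entry `y`. -/
def Traced (T : Tab Γ) : ℕ → List ℕ → Prop
  | _, [] => True
  | y, e :: l => T.arc y = e ∧ T.prev y < y ∧ Traced T (T.prev y) l

/-- The entry `y` describes the walk `l`. -/
structure Holds (T : Tab Γ) (G : Net Γ) (y : ℕ) (l : List ℕ) : Prop where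
  traced : T.Traced y l
  d : T.d y = G.cost l
  g : T.g y = G.label l

/-- The entry `y` describes a cheapest member of `W`. -/
def Best (T : Tab Γ) (G : Net Γ) (y : ℕ) (W : Set (List ℕ)) : Prop :=
  (T.valid y = 0 ∧ W = ∅) ∨
    (T.valid y ≠ 0 ∧ ∃ l ∈ W, T.Holds G y l ∧ ∀ l' ∈ W, G.cost l ≤ G.cost l')

/-- The tables agree below `n`. -/
structure EqBelow (T T' : Tab Γ) (n : ℕ) : Prop where
  valid : ∀ x < n, T'.valid x = T.valid x
  arc : ∀ x < n, T'.arc x = T.arc x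
  prev : ∀ x < n, T'.prev x = T.prev x
  d : ∀ x < n, T'.d x = T.d x
  g : ∀ x < n, T'.g x = T.g x

/-- Storing the extension of the walk of the entry `y` by the arc `e`. -/
noncomputable def write (T : Tab Γ) (G : Net Γ) (y z e : ℕ) : Tab Γ where
  valid := Function.update T.valid z 1
  arc := Function.update T.arc z e
  prev := Function.update T.prev z y
  d := Function.update T.d z (G.c e + T.d y)
  g := Function.update T.g z (G.lab e + T.g y)

open Classical in
/-- Storing the extension if it satisfies `C` and improves the entry. -/
noncomputable def relax (T : Tab Γ) (G : Net Γ) (C : Prop) (y z e : ℕ) : Tab Γ :=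
  if T.valid y ≠ 0 ∧ C ∧ ¬ (T.valid z ≠ 0 ∧ T.d z ≤ G.c e + T.d y) then T.write G y z e else T

variable {T T' T'' : Tab Γ} {G : Net Γ} {y y₁ y₂ z e n n' : ℕ} {l : List ℕ} {W W' : Set (List ℕ)}
  {C : Prop}

theorem EqBelow.refl (T : Tab Γ) (n : ℕ) : EqBelow T T n := by constructor <;> simp

theorem EqBelow.trans (h : EqBelow T T' n) (h' : EqBelow T' T'' n) : EqBelow T T'' n where
  valid x hx := (h'.valid x hx).trans (h.valid x hx)
  arc x hx := (h'.arc x hx).trans (h.arc x hx)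
  prev x hx := (h'.prev x hx).trans (h.prev x hx)
  d x hx := (h'.d x hx).trans (h.d x hx)
  g x hx := (h'.g x hx).trans (h.g x hx)

theorem EqBelow.mono (h : EqBelow T T' n) (hn : n' ≤ n) : EqBelow T T' n' where
  valid x hx := h.valid x (by omega)
  arc x hx := h.arc x (by omega)
  prev x hx := h.prev x (by omega)
  d x hx := h.d x (by omega)
  g x hx := h.g x (by omega)

theorem eqBelow_write (h : n ≤ z) : EqBelow T (T.write G y z e) n := by
  constructor <;> intro x hx <;> simp [write, show x ≠ z by omega]

theorem eqBelow_relax (h : n ≤ z) : EqBelow T (T.relax G C y z e) n := by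
  unfold relax; split_ifs
  exacts [eqBelow_write h, EqBelow.refl _ _]

/-- Pointers strictly decrease, so a trace that starts below `n` never leaves the part where the
tables agree. -/
theorem Traced.of_eqBelow (h : EqBelow T T' n) (hy : y < n) (hl : T.Traced y l) :
    T'.Traced y l := by
  induction l generalizing y with
  | nil => trivial
  | cons e l ih =>
    obtain ⟨h1, h2, h3⟩ := hl
    refine ⟨by rw [h.arc y hy, h1], by rwa [h.prev y hy], ?_⟩
    rw [h.prev y hy]
    exact ih (by omega) h3

theorem Holds.of_eqBelow (h : EqBelow T T' n) (hy : y < n) (hl : T.Holds G y l) :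
    T'.Holds G y l :=
  ⟨hl.1.of_eqBelow h hy, by rw [h.d y hy, hl.2], by rw [h.g y hy, hl.3]⟩

theorem Best.of_eqBelow (h : EqBelow T T' n) (hy : y < n) (hW : T.Best G y W) :
    T'.Best G y W := by
  rcases hW with ⟨h1, h2⟩ | ⟨h1, l, h2, h3, h4⟩
  · exact .inl ⟨by rw [h.valid y hy, h1], h2⟩
  · exact .inr ⟨by rwa [h.valid y hy], l, h2, h3.of_eqBelow h hy, h4⟩

/-- It passes from the few walks that the program looks at to all walks of a kind. -/
theorem Best.of_dominated (h : T.Best G y W') (hsub : W' ⊆ W)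
    (hdom : ∀ l ∈ W, ∃ l' ∈ W', G.cost l' ≤ G.cost l) : T.Best G y W := by
  rcases h with ⟨h1, rfl⟩ | ⟨h1, l, h2, h3, h4⟩
  · exact .inl ⟨h1, Set.eq_empty_of_forall_notMem fun l hl => by simpa using hdom l hl⟩
  · refine .inr ⟨h1, l, hsub h2, h3, fun l' hl' => ?_⟩
    obtain ⟨l'', h5, h6⟩ := hdom l' hl'
    exact (h4 _ h5).trans h6

theorem Holds.write (hyz : y < z) (hl : T.Holds G y l) :
    (T.write G y z e).Holds G z (e :: l) := by
  refine ⟨⟨by simp [Tab.write], by simpa [Tab.write] using hyz, ?_⟩, ?_, ?_⟩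
  · have := hl.1.of_eqBelow (eqBelow_write (G := G) (y := y) (e := e) le_rfl) hyz
    simpa [Tab.write] using this
  · simp [Tab.write, hl.2]
  · simp [Tab.write, hl.3]

/-- The added set has at most one element: it is empty if the entry `y` is void or the condition `C`
fails. -/
theorem Best.relax (hyz : y < z) (hl : T.valid y ≠ 0 → T.Holds G y l) (hW : T.Best G z W) :
    (T.relax G C y z e).Best G z (W ∪ {x | T.valid y ≠ 0 ∧ C ∧ x = e :: l}) := by
  by_cases h : T.valid y ≠ 0 ∧ C
  · have hset : {x | T.valid y ≠ 0 ∧ C ∧ x = e :: l} = {e :: l} := by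
      ext x; simp [h.1, h.2]
    have hy := hl h.1
    rw [hset]
    unfold Tab.relax
    simp only [h.1, h.2, ne_eq, not_false_eq_true, true_and]
    rcases hW with ⟨h1, rfl⟩ | ⟨h1, l', h2, h3, h4⟩
    · rw [if_pos (by simp [h1])]
      exact .inr ⟨by simp [Tab.write], _, by simp, hy.write hyz, by simp⟩
    · rw [h3.2, hy.2, ← Net.cost_cons]
      by_cases h5 : G.cost l' ≤ G.cost (e :: l)
      · rw [if_neg (by tauto)]
        refine .inr ⟨h1, l', .inl h2, h3, ?_⟩
        rintro x (hx | rfl)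
        · exact h4 x hx
        · exact h5
      · rw [if_pos (by tauto)]
        refine .inr ⟨by simp [Tab.write], _, by simp, hy.write hyz, ?_⟩
        rintro x (hx | rfl)
        · exact (le_of_not_ge h5).trans (h4 x hx)
        · exact le_rfl
  · have hset : {x | T.valid y ≠ 0 ∧ C ∧ x = e :: l} = ∅ := by
      ext x; simp only [Set.mem_ofPred_eq, Set.mem_empty_iff_false, iff_false]; tauto
    rw [hset, Set.union_empty, Tab.relax, if_neg (by tauto)]
    exact hW

/-- Two entries for the cheapest walk and the cheapest walk of a different label. -/
structure BestPair (T : Tab Γ) (G : Net Γ) (y₁ y₂ : ℕ) (W : Set (List ℕ)) : Prop where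
  fst : T.Best G y₁ W
  snd : T.Best G y₂ {l ∈ W | G.label l ≠ T.g y₁}

theorem BestPair.of_eqBelow (h : EqBelow T T' n) (h₁ : y₁ < n) (h₂ : y₂ < n)
    (hW : T.BestPair G y₁ y₂ W) : T'.BestPair G y₁ y₂ W :=
  ⟨hW.1.of_eqBelow h h₁, by rw [h.g _ h₁]; exact hW.2.of_eqBelow h h₂⟩

/-- Two walks suffice for every condition on labels that excludes at most one label. -/
theorem BestPair.dominates (h : T.BestPair G y₁ y₂ W) {P : Γ → Prop}
    (hP : ∀ a b, ¬ P a → ¬ P b → a = b) (hl : l ∈ W) (hPl : P (G.label l)) :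
    ∃ y, (y = y₁ ∨ y = y₂) ∧ T.valid y ≠ 0 ∧ P (T.g y) ∧ T.d y ≤ G.cost l := by
  obtain ⟨-, h2⟩ | ⟨h1, l₁, h2, h3, h4⟩ := h.1
  · simp [h2] at hl
  by_cases hP1 : P (T.g y₁)
  · exact ⟨y₁, .inl rfl, h1, hP1, h3.2 ▸ h4 _ hl⟩
  · have hne : G.label l ≠ T.g y₁ := fun h => hP1 (h ▸ hPl)
    obtain ⟨-, h6⟩ | ⟨h5, l₂, h6, h7, h8⟩ := h.2
    · exact absurd (show l ∈ {l ∈ W | G.label l ≠ T.g y₁} from ⟨hl, hne⟩) (by simp [h6])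
    · refine ⟨y₂, .inr rfl, h5, ?_, h7.2 ▸ h8 _ ⟨hl, hne⟩⟩
      by_contra hP2
      exact h6.2 (h7.3 ▸ hP _ _ hP2 hP1)

theorem BestPair.exists_holds (h : T.BestPair G y₁ y₂ W) (hy : y = y₁ ∨ y = y₂)
    (hv : T.valid y ≠ 0) : ∃ l ∈ W, T.Holds G y l := by
  rcases hy with rfl | rfl
  · obtain ⟨h1, -⟩ | ⟨-, l, h2, h3, -⟩ := h.1
    exacts [absurd h1 hv, ⟨l, h2, h3⟩]
  · obtain ⟨h1, -⟩ | ⟨-, l, h2, h3, -⟩ := h.2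
    exacts [absurd h1 hv, ⟨l, h2.1, h3⟩]

/-- The extensions by one of the first `E` arcs of the walks in `Wk` that end in `v` and have a
label satisfying `P`. -/
def ext (G : Net Γ) (Wk : ℕ → Set (List ℕ)) (P : ℕ → Γ → Prop) (v E : ℕ) : Set (List ℕ) :=
  {x | ∃ e l, x = e :: l ∧ e < E ∧ G.hd e = v ∧ l ∈ Wk (G.tl e) ∧ P v (G.lab e + G.label l)}

/-- An entry is cheapest, and its pointer is below `n`. -/
def BestFrom (T : Tab Γ) (G : Net Γ) (n z : ℕ) (W : Set (List ℕ)) : Prop :=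
  T.Best G z W ∧ (T.valid z ≠ 0 → T.prev z < n)

theorem BestFrom.relax (hy : y < n) (hz : n ≤ z) (hl : T.valid y ≠ 0 → T.Holds G y l)
    (hW : T.BestFrom G n z W) :
    (T.relax G C y z e).BestFrom G n z (W ∪ {x | T.valid y ≠ 0 ∧ C ∧ x = e :: l}) := by
  refine ⟨hW.1.relax (by omega) hl, ?_⟩
  unfold Tab.relax; split_ifs
  · simpa [Tab.write] using hy
  · exact hW.2

/-- The written entry `z'` may lie below `z`, so agreement below `z` is not available. The trace is
safe because it leaves `z` for an entry below `n`, where nothing is written. -/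
theorem BestFrom.relax_of_ne {z' : ℕ} (hne : z ≠ z') (hz : n ≤ z') (hW : T.BestFrom G n z W) :
    (T.relax G C y z' e).BestFrom G n z W := by
  have hE : EqBelow T (T.relax G C y z' e) n := eqBelow_relax hz
  have h1 : (T.relax G C y z' e).valid z = T.valid z := by
    unfold Tab.relax; split_ifs <;> simp [Tab.write, hne]
  have h2 : (T.relax G C y z' e).prev z = T.prev z := by
    unfold Tab.relax; split_ifs <;> simp [Tab.write, hne]
  have h3 : (T.relax G C y z' e).arc z = T.arc z := by
    unfold Tab.relax; split_ifs <;> simp [Tab.write, hne]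
  have h4 : (T.relax G C y z' e).d z = T.d z := by
    unfold Tab.relax; split_ifs <;> simp [Tab.write, hne]
  have h5 : (T.relax G C y z' e).g z = T.g z := by
    unfold Tab.relax; split_ifs <;> simp [Tab.write, hne]
  refine ⟨?_, by rw [h1, h2]; exact hW.2⟩
  rcases hW.1 with ⟨h6, h7⟩ | ⟨h6, l, h7, ⟨h8, h9, h10⟩, h11⟩
  · exact .inl ⟨by rw [h1, h6], h7⟩
  · refine .inr ⟨by rwa [h1], l, h7, ⟨?_, by rw [h4, h9], by rw [h5, h10]⟩, h11⟩
    cases l with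
    | nil => trivial
    | cons e l =>
      obtain ⟨h12, h13, h14⟩ := h8
      refine ⟨by rw [h3, h12], by rwa [h2], ?_⟩
      rw [h2]
      exact h14.of_eqBelow hE (hW.2 h6)

/-- Processing the arc `E` affects only the entry of its head. Instead of all walks to the tail,
only the two stored ones are extended: among the walks whose extension satisfies `P`, one of these
two is cheapest. -/
theorem bestFrom_ext_succ {V E zb v : ℕ} {Wk : ℕ → Set (List ℕ)} {P : ℕ → Γ → Prop}
    (hP : ∀ v a b, ¬ P v a → ¬ P v b → a = b)
    (hpair : T.BestPair G y₁ y₂ (Wk (G.tl E))) (h₁ : y₁ < zb) (h₂ : y₂ < zb)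
    (hT : ∀ v < V, T.BestFrom G zb (zb + v) (ext G Wk P v E))
    (hT' : T' = T.relax G (P (G.hd E) (G.lab E + T.g y₁)) y₁ (zb + G.hd E) E)
    (hT'' : T'' = T'.relax G (P (G.hd E) (G.lab E + T.g y₂)) y₂ (zb + G.hd E) E) (hv : v < V) :
    T''.BestFrom G zb (zb + v) (ext G Wk P v (E + 1)) := by
  have hE : EqBelow T T' zb := hT' ▸ eqBelow_relax (by omega)
  by_cases hvh : v = G.hd E
  · subst hvh
    obtain ⟨l₁, hl₁⟩ : ∃ l, T.valid y₁ ≠ 0 → l ∈ Wk (G.tl E) ∧ T.Holds G y₁ l := by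
      by_cases h : T.valid y₁ = 0
      · exact ⟨[], fun h' => absurd h h'⟩
      · obtain ⟨l, h3, h4⟩ := hpair.exists_holds (.inl rfl) h
        exact ⟨l, fun _ => ⟨h3, h4⟩⟩
    obtain ⟨l₂, hl₂⟩ : ∃ l, T.valid y₂ ≠ 0 → l ∈ Wk (G.tl E) ∧ T.Holds G y₂ l := by
      by_cases h : T.valid y₂ = 0
      · exact ⟨[], fun h' => absurd h h'⟩
      · obtain ⟨l, h3, h4⟩ := hpair.exists_holds (.inr rfl) h
        exact ⟨l, fun _ => ⟨h3, h4⟩⟩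
    have hB := (hT _ hv).relax (C := P (G.hd E) (G.lab E + T.g y₁)) (e := E) h₁ (by omega)
      (fun h => (hl₁ h).2)
    rw [← hT'] at hB
    have hB := hB.relax (C := P (G.hd E) (G.lab E + T.g y₂)) (e := E) h₂ (by omega)
      (l := l₂) (fun h => (hl₂ (by rwa [hE.valid _ h₂] at h)).2.of_eqBelow hE h₂)
    rw [← hT'', hE.valid _ h₂] at hB
    refine ⟨hB.1.of_dominated ?_ ?_, hB.2⟩
    · rintro x ((⟨e, l, rfl, h3, h4⟩ | ⟨h3, h4, rfl⟩) | ⟨h3, h4, rfl⟩)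
      · exact ⟨e, l, rfl, by omega, h4⟩
      · exact ⟨E, l₁, rfl, by omega, rfl, (hl₁ h3).1, by rwa [← (hl₁ h3).2.3]⟩
      · exact ⟨E, l₂, rfl, by omega, rfl, (hl₂ h3).1, by rwa [← (hl₂ h3).2.3]⟩
    · rintro x ⟨e, l, rfl, h3, h4, h5, h6⟩
      rcases Nat.lt_succ_iff_lt_or_eq.1 h3 with h7 | rfl
      · exact ⟨_, .inl (.inl ⟨e, l, rfl, h7, h4, h5, h6⟩), le_rfl⟩
      · obtain ⟨y, rfl | rfl, h7, h8, h9⟩ := hpair.dominates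
          (P := fun a => P (G.hd e) (G.lab e + a))
          -- Adding the label of the arc is injective, so the condition still excludes at most one
          -- label.
          (fun a b ha hb => add_left_cancel (hP _ _ _ ha hb)) h5 h6
        · refine ⟨_, .inl (.inr ⟨h7, h8, rfl⟩), ?_⟩
          rw [(hl₁ h7).2.2] at h9; simpa using h9
        · refine ⟨_, .inr ⟨h7, h8, rfl⟩, ?_⟩
          rw [(hl₂ h7).2.2] at h9; simpa using h9
  · have hB := ((hT v hv).relax_of_ne (C := P (G.hd E) (G.lab E + T.g y₁)) (y := y₁) (e := E)
      (z' := zb + G.hd E) (by omega) (by omega))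
    rw [← hT'] at hB
    have hB := hB.relax_of_ne (C := P (G.hd E) (G.lab E + T.g y₂)) (y := y₂) (e := E)
      (z' := zb + G.hd E) (by omega) (by omega)
    rw [← hT''] at hB
    have hset : ext G Wk P v E = ext G Wk P v (E + 1) := by
      ext x
      constructor
      · rintro ⟨e, l, rfl, h3, h4⟩
        exact ⟨e, l, rfl, by omega, h4⟩
      · rintro ⟨e, l, rfl, h3, h4, h5⟩
        refine ⟨e, l, rfl, ?_, h4, h5⟩
        rcases Nat.lt_succ_iff_lt_or_eq.1 h3 with h7 | rfl
        exacts [h7, absurd h4.symm hvh]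
    rwa [← hset]

end Tab

/-! ### One round of the dynamic program on the machine -/

namespace OracleRAM

variable {Γ : Type u} [AddCommGroup Γ]

/-- The digraph stored in the memory. -/
def State.net (s : State Γ) (m : ℕ) : Net Γ := ⟨m, s.nat 1, s.nat 2, s.wt 0, s.grp 0⟩

/-- The table stored in the memory. -/
def State.tab (s : State Γ) : Tab Γ := ⟨s.nat 10, s.nat 11, s.nat 12, s.wt 1, s.grp 1⟩

/-- The expressions `Vx` and `mx` are fixed and have the values `V` and `m`, and the cell `0` of
the array `8` holds `V`. -/
structure Sizes (Vx mx : NExp) (V m : ℕ) (s : State Γ) : Prop where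
  fixV : Vx.isFixed = true
  fixm : mx.isFixed = true
  evalV : Vx.eval s = V
  evalm : mx.eval s = m
  cell : s.nat 8 0 = V

theorem Sizes.congr {Vx mx : NExp} {V m : ℕ} {s s' : State Γ} (h : Sizes Vx mx V m s)
    (h0 : s'.nat 0 = s.nat 0) (h8 : s'.nat 8 = s.nat 8) : Sizes Vx mx V m s' :=
  ⟨h.1, h.2, by rw [NExp.eval_congr h.1 h0, h.3], by rw [NExp.eval_congr h.2 h0, h.4],
    by rw [h8, h.5]⟩

/-- The test that always succeeds. -/
def Test.always : Test := .natLe (.const 0) (.const 0)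

/-- The test whether a number is not zero. -/
def Test.ne0 (x : NExp) : Test := .not (.natLe x (.const 0))

@[simp] theorem Test.holds_always (O : Oracle) (s : State Γ) : Test.always.holds O s := le_rfl

@[simp] theorem Test.holds_ne0 (O : Oracle) (s : State Γ) (x : NExp) :
    (Test.ne0 x).holds O s ↔ x.eval s ≠ 0 := by
  simp [Test.ne0, Test.holds, NExp.eval]

namespace FProg

/-- Improving the entry `Z` by the extension of the entry `Y` by the current arc. -/
def relax (Y Z : NExp) (C : Test) : FProg :=
  setNat 33 (.const 0) Y ;; setNat 34 (.const 0) Z ;;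
  ite (.and (.ne0 (.read 10 (.cell 33))) (.and C (.not (.and (.ne0 (.read 10 (.cell 34)))
      (.wtLe (.read 1 (.cell 34)) (.add (.read 0 (.cell 24)) (.read 1 (.cell 33))))))))
    (setNat 11 (.cell 34) (.cell 24) ;;
     setNat 12 (.cell 34) (.cell 33) ;;
     setWt 1 (.cell 34) (.add (.read 0 (.cell 24)) (.read 1 (.cell 33))) ;;
     setGrp 1 (.cell 34) (.add (.read 0 (.cell 24)) (.read 1 (.cell 33))) ;;
     setNat 10 (.cell 34) (.const 1))
    nop

/-- Filling the `V` entries that start at `B` by extensions of the walks of the current block. -/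
def pass (Vx mx B : NExp) (C : Test) : FProg :=
  for_ 21 Vx (setNat 10 (.add B (.cell 21)) (.const 0)) ;;
  for_ 24 mx (
    relax (.add (.cell 30) (.read 1 (.cell 24))) (.add B (.read 2 (.cell 24))) C ;;
    relax (.add (.add (.cell 30) (.cell 8)) (.read 1 (.cell 24))) (.add B (.read 2 (.cell 24))) C)

end FProg

/-- The expression `Z` is evaluated after the cell for `y` has been written, hence the modified
memory in `hZ`; likewise `C` is tested after both writes. -/
theorem tab_den_relax {O : Oracle} {Y Z : NExp} {C : Test} {s : State Γ} {m y z : ℕ}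
    (hY : Y.eval s = y) (hZ : Z.eval (s.setNat 33 0 y) = z) :
    ((FProg.relax Y Z C).den O s).tab = s.tab.relax (s.net m)
      (C.holds O ((s.setNat 33 0 y).setNat 34 0 z)) y z (s.nat 24 0) := by
  set s₂ := (s.setNat 33 0 y).setNat 34 0 z with hs₂
  have h33 : s₂.nat 33 0 = y := by simp [hs₂]
  have h34 : s₂.nat 34 0 = z := by simp [hs₂]
  have h24 : s₂.nat 24 = s.nat 24 := by simp [hs₂]
  have htab : s₂.tab = s.tab := by simp [hs₂, State.tab]
  have hnet : s₂.net m = s.net m := by simp [hs₂, State.net]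
  rw [← htab, ← hnet, ← h24]
  rw [FProg.relax, den_seq, den_seq]
  simp only [FProg.den.eq_2, hY, hZ, NExp.eval, ← hs₂]
  by_cases h : s₂.tab.valid y ≠ 0 ∧ C.holds O s₂ ∧ ¬ (s₂.tab.valid z ≠ 0 ∧
      s₂.tab.d z ≤ (s₂.net m).c (s₂.nat 24 0) + s₂.tab.d y)
  · rw [den_ite_pos, Tab.relax, if_pos h]
    · simp [FProg.den, Tab.write, State.tab, State.net, GExp.eval, WExp.eval, NExp.eval, h33, h34]
    · simpa [Test.holds, NExp.eval, WExp.eval, h33, h34, State.tab, State.net] using h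
  · rw [den_ite_neg, Tab.relax, if_neg h]
    · simp [FProg.den]
    · simpa [Test.holds, NExp.eval, WExp.eval, h33, h34, State.tab, State.net] using h

/-- The entries that are read lie below `b + 2 * V ≤ zb` and those that are written start at `zb`,
so the walks being extended stay intact. The hypotheses on `B` and `C` speak of all memories that
can occur during the pass. -/
theorem den_pass {O : Oracle} {Vx mx B : NExp} {C : Test} {s : State Γ} {V m b zb : ℕ}
    {Wk : ℕ → Set (List ℕ)} {P : ℕ → Γ → Prop}
    (hs : Sizes Vx mx V m s) (hb : s.nat 30 0 = b) (hzb : b + 2 * V ≤ zb)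
    (hB : ∀ s' : State Γ, s'.nat 30 = s.nat 30 → s'.nat 31 = s.nat 31 → s'.nat 8 = s.nat 8 →
      B.eval s' = zb)
    (hC : ∀ s' : State Γ, s'.nat 30 = s.nat 30 → s'.nat 31 = s.nat 31 → s'.nat 8 = s.nat 8 →
      s'.net m = s.net m → s.tab.EqBelow s'.tab zb → s'.nat 24 0 < m → s'.nat 33 0 < zb →
      (C.holds O s' ↔ P (s.nat 2 (s'.nat 24 0)) (s.grp 0 (s'.nat 24 0) + s.grp 1 (s'.nat 33 0))))
    (hP : ∀ v a b, ¬ P v a → ¬ P v b → a = b)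
    (htl : ∀ e < m, s.nat 1 e < V) (hhd : ∀ e < m, s.nat 2 e < V)
    (hpair : ∀ u < V, s.tab.BestPair (s.net m) (b + u) (b + V + u) (Wk u)) :
    s.tab.EqBelow ((FProg.pass Vx mx B C).den O s).tab zb ∧
      ∀ v < V, ((FProg.pass Vx mx B C).den O s).tab.Best (s.net m) (zb + v)
        (Tab.ext (s.net m) Wk P v m) := by
  rw [FProg.pass, den_seq]
  have h1 := den_for (O := O) (a := 21) (c := .setNat 10 (.add B (.cell 21)) (.const 0)) V
    hs.evalV (fun k s' => s.tab.EqBelow s'.tab zb ∧ ∀ v < k, s'.nat 10 (zb + v) = 0)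
    ⟨by simpa [State.tab] using Tab.EqBelow.refl _ _, by simp⟩ (by
      intro k hk s' hI hk' hA
      have hBe := hB s' (hA.nat 30 rfl) (hA.nat 31 rfl) (hA.nat 8 rfl)
      simp only [FProg.den, NExp.eval, hBe, hk']
      refine ⟨hI.1.trans ?_, fun v hv => ?_⟩
      · constructor <;> intro x hx <;> simp [State.tab, show x ≠ zb + k by omega]
      · rcases Nat.lt_succ_iff_lt_or_eq.1 hv with h | rfl
        · simp [Function.update_apply, hI.2 v h]
        · simp)
  have hA1 := den_agree O (.for_ 21 Vx (.setNat 10 (.add B (.cell 21)) (.const 0))) s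
  set s₁ := (FProg.for_ 21 Vx (.setNat 10 (.add B (.cell 21)) (.const 0))).den O s
  have hnet1 : s₁.net m = s.net m := by
    simp only [State.net, hA1.nat 1 rfl, hA1.nat 2 rfl, hA1.wt 0 rfl, hA1.grp 0 rfl]
  have h2 := den_for (O := O) (s := s₁) (a := 24) (c :=
    .relax (.add (.cell 30) (.read 1 (.cell 24))) (.add B (.read 2 (.cell 24))) C ;;
    .relax (.add (.add (.cell 30) (.cell 8)) (.read 1 (.cell 24))) (.add B (.read 2 (.cell 24))) C)
    m (hs.congr (hA1.nat 0 rfl) (hA1.nat 8 rfl)).evalm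
    (fun k s' => s.tab.EqBelow s'.tab zb ∧
      ∀ v < V, s'.tab.BestFrom (s.net m) zb (zb + v) (Tab.ext (s.net m) Wk P v k))
    -- With no arc processed there are no extensions, which matches the entries just declared void.
    ⟨by simpa [State.tab] using h1.1, fun v hv => by
      have h3 := h1.2 v hv
      refine ⟨.inl ⟨by simpa [State.tab] using h3, ?_⟩, by simp [State.tab, h3]⟩
      ext x; simp [Tab.ext]⟩ (by
      intro k hk s' hI hk' hA
      have e30 : s'.nat 30 = s.nat 30 := (hA.nat 30 rfl).trans (hA1.nat 30 rfl)
      have e31 : s'.nat 31 = s.nat 31 := (hA.nat 31 rfl).trans (hA1.nat 31 rfl)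
      have e8 : s'.nat 8 = s.nat 8 := (hA.nat 8 rfl).trans (hA1.nat 8 rfl)
      have e1 : s'.nat 1 = s.nat 1 := (hA.nat 1 rfl).trans (hA1.nat 1 rfl)
      have e2 : s'.nat 2 = s.nat 2 := (hA.nat 2 rfl).trans (hA1.nat 2 rfl)
      have eg : s'.grp 0 = s.grp 0 := (hA.grp 0 rfl).trans (hA1.grp 0 rfl)
      have ew : s'.wt 0 = s.wt 0 := (hA.wt 0 rfl).trans (hA1.wt 0 rfl)
      have ht := htl k hk
      have hh := hhd k hk
      have hnet : s'.net m = s.net m := by simp only [State.net, e1, e2, eg, ew]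
      have r1 := tab_den_relax (O := O) (Y := .add (.cell 30) (.read 1 (.cell 24)))
        (Z := .add B (.read 2 (.cell 24))) (C := C) (s := s') (m := m) (y := b + s.nat 1 k)
        (z := zb + s.nat 2 k) (by simp [NExp.eval, e30, hb, hk', e1]) (by
          simp only [NExp.eval]
          rw [hB _ (by simpa using e30) (by simpa using e31) (by simpa using e8)]
          simp [hk', e2])
      have hA2 := den_agree O (.relax (.add (.cell 30) (.read 1 (.cell 24)))
        (.add B (.read 2 (.cell 24))) C) s'
      rw [den_seq]
      set s'' := (FProg.relax (.add (.cell 30) (.read 1 (.cell 24)))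
        (.add B (.read 2 (.cell 24))) C).den O s'
      have f30 : s''.nat 30 = s.nat 30 := (hA2.nat 30 rfl).trans e30
      have f31 : s''.nat 31 = s.nat 31 := (hA2.nat 31 rfl).trans e31
      have f8 : s''.nat 8 = s.nat 8 := (hA2.nat 8 rfl).trans e8
      have f1 : s''.nat 1 = s.nat 1 := (hA2.nat 1 rfl).trans e1
      have f2 : s''.nat 2 = s.nat 2 := (hA2.nat 2 rfl).trans e2
      have f24 : s''.nat 24 0 = k := by rw [hA2.nat 24 rfl, hk']
      have hnet2 : s''.net m = s.net m := by
        rw [← hnet]; simp only [State.net, hA2.nat 1 rfl, hA2.nat 2 rfl, hA2.wt 0 rfl, hA2.grp 0 rfl]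
      have r2 := tab_den_relax (O := O)
        (Y := .add (.add (.cell 30) (.cell 8)) (.read 1 (.cell 24)))
        (Z := .add B (.read 2 (.cell 24))) (C := C) (s := s'') (m := m) (y := b + V + s.nat 1 k)
        (z := zb + s.nat 2 k) (by simp [NExp.eval, f30, hb, f24, f1, f8, hs.cell]) (by
          simp only [NExp.eval]
          rw [hB _ (by simpa using f30) (by simpa using f31) (by simpa using f8)]
          simp [f24, f2])
      have y1 : b + s.nat 1 k < zb := by omega
      have y2 : b + V + s.nat 1 k < zb := by omega
      rw [hC _ (by simpa using e30) (by simpa using e31) (by simpa using e8)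
        (by simpa [State.net] using hnet) (by simpa [State.tab] using hI.1) (by simpa [hk'] using hk)
        (by simpa using y1)] at r1
      have hI2 : s.tab.EqBelow s''.tab zb := hI.1.trans (r1 ▸ Tab.eqBelow_relax (by omega))
      rw [hC _ (by simpa using f30) (by simpa using f31) (by simpa using f8)
        (by simpa [State.net] using hnet2) (by simpa [State.tab] using hI2)
        (by simpa [f24] using hk) (by simpa using y2)] at r2
      simp only [State.nat_setNat, hk', f24, Nat.reduceEqDiff, if_false,
        if_true, Function.update_self, hnet, hnet2] at r1 r2
      set s''' := (FProg.relax (.add (.add (.cell 30) (.cell 8)) (.read 1 (.cell 24)))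
        (.add B (.read 2 (.cell 24))) C).den O s''
      change s.tab.EqBelow s'''.tab zb ∧ ∀ v < V, s'''.tab.BestFrom (s.net m) zb (zb + v)
        (Tab.ext (s.net m) Wk P v (k + 1))
      refine ⟨hI2.trans (r2 ▸ Tab.eqBelow_relax (by omega)), fun v hv => ?_⟩
      have hp := (hpair _ ht).of_eqBelow hI.1 y1 y2
      refine Tab.bestFrom_ext_succ hP hp y1 y2 hI.2 (T' := s''.tab) ?_ ?_ hv
      · rw [r1, hI.1.g _ y1]; rfl
      · rw [r2, hI.1.g _ y2]; rfl)
  exact ⟨h2.1, fun v hv => (h2.2 v hv).1⟩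

end OracleRAM

/-! ### The table of walks by length, start and end -/

namespace OracleRAM

variable {Γ : Type u} [AddCommGroup Γ]

/-- The block `r` of the table describes the walks of length `r / V` that start in `r % V`. -/
def IsBlock (G : Net Γ) (V : ℕ) (T : Tab Γ) (r : ℕ) : Prop :=
  ∀ v < V, T.BestPair G (2 * V * r + v) (2 * V * r + V + v)
    {l | G.Walk (r % V) l v ∧ l.length = r / V}

theorem IsBlock.of_eqBelow {G : Net Γ} {V r n : ℕ} {T T' : Tab Γ} (h : IsBlock G V T r)
    (hE : T.EqBelow T' n) (hn : 2 * V * (r + 1) ≤ n) : IsBlock G V T' r := fun v hv => by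
  rw [mul_add] at hn
  exact (h v hv).of_eqBelow hE (by omega) (by omega)

/-- Blocks are numbered by length times `V` plus start, so `V` blocks further on the start is the
same and the walks have one more arc. -/
theorem ext_true {G : Net Γ} {V r v : ℕ} (hV : 0 < V) :
    Tab.ext G (fun u => {l | G.Walk (r % V) l u ∧ l.length = r / V}) (fun _ _ => True) v G.m =
      {l | G.Walk ((r + V) % V) l v ∧ l.length = (r + V) / V} := by
  rw [Nat.add_mod_right, Nat.add_div_right _ hV]
  ext x
  constructor
  · rintro ⟨e, l, rfl, h1, h2, ⟨h3, h4⟩, -⟩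
    exact ⟨⟨h1, h2, h3⟩, by simpa using h4⟩
  · rintro ⟨h1, h2⟩
    cases x with
    | nil => simp at h2
    | cons e l =>
      obtain ⟨h3, h4, h5⟩ := h1
      exact ⟨e, l, rfl, h3, h4, ⟨h5, by simpa using h2⟩, trivial⟩

theorem ext_ne {G : Net Γ} {Wk : ℕ → Set (List ℕ)} {v E : ℕ} (g : ℕ → Γ) :
    Tab.ext G Wk (fun v a => a ≠ g v) v E =
      {l ∈ Tab.ext G Wk (fun _ _ => True) v E | G.label l ≠ g v} := by
  ext x
  constructor
  · rintro ⟨e, l, rfl, h1, h2, h3, h4⟩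
    exact ⟨⟨e, l, rfl, h1, h2, h3, trivial⟩, by simpa using h4⟩
  · rintro ⟨⟨e, l, rfl, h1, h2, h3, -⟩, h4⟩
    exact ⟨e, l, rfl, h1, h2, h3, by simpa using h4⟩

namespace FProg

/-- The position of the current block of longer walks. -/
def nextBlock : NExp := .add (.cell 30) (.cell 31)

/-- The label of the extension differs from that of the cheapest walk. -/
def newLabel : Test := .not (.isZero (.add (.add (.read 0 (.cell 24)) (.read 1 (.cell 33)))
  (.neg (.read 1 (.add nextBlock (.read 2 (.cell 24)))))))

/-- Computing one block. -/
def block (Vx mx : NExp) : FProg :=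
  pass Vx mx nextBlock .always ;;
  pass Vx mx (.add nextBlock (.cell 8)) newLabel ;;
  setNat 30 (.const 0) (.add (.add (.cell 30) (.cell 8)) (.cell 8))

/-- Computing the blocks of the walks of length `0`. -/
def firstBlocks (Vx : NExp) : FProg :=
  setNat 30 (.const 0) (.const 0) ;;
  for_ 20 Vx (
    for_ 21 Vx (
      setNat 10 (.add (.cell 30) (.cell 21)) (.const 0) ;;
      setNat 10 (.add (.add (.cell 30) (.cell 8)) (.cell 21)) (.const 0)) ;;
    setNat 10 (.add (.cell 30) (.cell 20)) (.const 1) ;;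
    setWt 1 (.add (.cell 30) (.cell 20)) .zero ;;
    setGrp 1 (.add (.cell 30) (.cell 20)) .zero ;;
    setNat 30 (.const 0) (.add (.add (.cell 30) (.cell 8)) (.cell 8)))

/-- Computing the table. -/
def tables (Vx mx : NExp) : FProg :=
  firstBlocks Vx ;;
  setNat 31 (.const 0) (.cell 30) ;;
  setNat 30 (.const 0) (.const 0) ;;
  for_ 22 mx (for_ 23 Vx (block Vx mx))

end FProg

/-- Block `r + V` is filled from block `r` in two passes: the first finds the cheapest extensions,
the second the cheapest ones whose label differs from that of the first. The cell of the array `31`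
holds the distance `2 * V * V` of the two blocks. -/
theorem den_block {O : Oracle} {Vx mx : NExp} {s : State Γ} {V m r : ℕ}
    (hs : Sizes Vx mx V m s) (hV : 0 < V) (h30 : s.nat 30 0 = 2 * V * r)
    (h31 : s.nat 31 0 = 2 * V * V)
    (htl : ∀ e < m, s.nat 1 e < V) (hhd : ∀ e < m, s.nat 2 e < V)
    (hr : ∀ r' < r + V, IsBlock (s.net m) V s.tab r') :
    ((FProg.block Vx mx).den O s).nat 30 0 = 2 * V * (r + 1) ∧
      ∀ r' < r + V + 1, IsBlock (s.net m) V ((FProg.block Vx mx).den O s).tab r' := by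
  rw [FProg.block, den_seq, den_seq]
  have hle : 2 * V ≤ 2 * V * V := Nat.le_mul_of_pos_right _ hV
  have hm1 : 2 * V * (r + V) = 2 * V * r + 2 * V * V := by ring
  have hpair := hr r (by omega)
  have p1 := den_pass (O := O) (B := FProg.nextBlock) (C := .always) (zb := 2 * V * (r + V))
    (P := fun _ _ => True) hs h30 (by rw [hm1]; omega)
    (fun s' h1 h2 h3 => by simp [FProg.nextBlock, NExp.eval, h1, h2, h30, h31, hm1])
    (fun s' _ _ _ _ _ _ _ => by simp) (by simp) htl hhd hpair
  have hA1 := den_agree O (.pass Vx mx FProg.nextBlock .always) s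
  set s₁ := (FProg.pass Vx mx FProg.nextBlock .always).den O s
  have hnet1 : s₁.net m = s.net m := by
    simp only [State.net, hA1.nat 1 rfl, hA1.nat 2 rfl, hA1.wt 0 rfl, hA1.grp 0 rfl]
  have e30 : s₁.nat 30 = s.nat 30 := hA1.nat 30 rfl
  have e31 : s₁.nat 31 = s.nat 31 := hA1.nat 31 rfl
  have e8 : s₁.nat 8 = s.nat 8 := hA1.nat 8 rfl
  have hs1 : Sizes Vx mx V m s₁ := hs.congr (hA1.nat 0 rfl) e8
  have p2 := den_pass (O := O) (B := .add FProg.nextBlock (.cell 8)) (C := FProg.newLabel)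
    (zb := 2 * V * (r + V) + V) (s := s₁) (b := 2 * V * r)
    (Wk := fun u => {l | (s.net m).Walk (r % V) l u ∧ l.length = r / V})
    (P := fun v a => a ≠ s₁.grp 1 (2 * V * (r + V) + v)) hs1 (by rw [e30, h30])
    (by rw [hm1]; omega)
    (fun s' h1 h2 h3 => by
      simp [FProg.nextBlock, NExp.eval, h1, h2, h3, e30, e31, e8, h30, h31, hm1, hs.cell])
    -- The label to be avoided is stored in the first half of the new block, which lies below the
    -- entries written by the second pass and so does not change.
    (fun s' h1 h2 h3 h4 h5 h6 h7 => by
      have hn : s'.nat 2 = s₁.nat 2 := congrArg Net.hd h4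
      have hg : s'.grp 0 = s₁.grp 0 := congrArg Net.lab h4
      have hg2 := h5.g
      simp only [State.tab] at hg2
      have hh := hhd _ h6
      rw [← hA1.nat 2 rfl] at hh
      simp only [FProg.newLabel, FProg.nextBlock, Test.holds, GExp.eval, NExp.eval, h1, h2, e30,
        e31, h30, h31, hn, hg, ← hm1]
      rw [hg2 _ h7, hg2 _ (by omega), ← sub_eq_add_neg, sub_eq_zero])
    (fun v a b ha hb => by simp only [ne_eq, not_not] at ha hb; rw [ha, hb])
    (by rw [hA1.nat 1 rfl]; exact htl) (by rw [hA1.nat 2 rfl]; exact hhd)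
    (fun u hu => by
      rw [hnet1]
      have := hpair u hu
      exact this.of_eqBelow p1.1 (by rw [hm1]; omega)
        (by rw [hm1]; omega))
  have hA2 := den_agree O (.pass Vx mx (.add FProg.nextBlock (.cell 8)) FProg.newLabel) s₁
  set s₂ := (FProg.pass Vx mx (.add FProg.nextBlock (.cell 8)) FProg.newLabel).den O s₁
  have f30 : s₂.nat 30 = s.nat 30 := (hA2.nat 30 rfl).trans e30
  have f8 : s₂.nat 8 = s.nat 8 := (hA2.nat 8 rfl).trans e8
  refine ⟨by simp [FProg.den, NExp.eval, f30, f8, h30, hs.cell]; ring, ?_⟩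
  have htab : (FProg.den O (.setNat 30 (.const 0) (.add (.add (.cell 30) (.cell 8)) (.cell 8)))
    s₂).tab = s₂.tab := by simp [FProg.den, State.tab]
  rw [htab]
  intro r' hr'
  rcases Nat.lt_succ_iff_lt_or_eq.1 hr' with h | rfl
  · refine (hr r' h).of_eqBelow (p1.1.trans (p2.1.mono (by omega))) ?_
    exact Nat.mul_le_mul_left _ h
  · intro v hv
    refine ⟨?_, ?_⟩
    · have := (p1.2 v hv).of_eqBelow p2.1 (by omega)
      have h2 := ext_true (G := s.net m) (r := r) (v := v) hV
      rw [show (s.net m).m = m from rfl] at h2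
      rwa [h2] at this
    · have := p2.2 v hv
      rw [hnet1, ext_ne fun v => s₁.grp 1 (2 * V * (r + V) + v)] at this
      have h2 := ext_true (G := s.net m) (r := r) (v := v) hV
      rw [show (s.net m).m = m from rfl] at h2
      rw [h2] at this
      rw [p2.1.g _ (by omega)]
      exact this

/-- For `r < V` the walks have length `0`: only the end `r` is reached, by the empty walk, and there
is never a second label. -/
theorem den_firstBlocks {O : Oracle} {Vx mx : NExp} {s : State Γ} {V m : ℕ}
    (hs : Sizes Vx mx V m s) :
    ((FProg.firstBlocks Vx).den O s).nat 30 0 = 2 * V * V ∧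
      ∀ r < V, IsBlock (s.net m) V ((FProg.firstBlocks Vx).den O s).tab r := by
  rw [FProg.firstBlocks, den_seq]
  have := den_for (O := O) (s := (FProg.setNat 30 (.const 0) (.const 0)).den O s) (a := 20)
    (b := Vx) (c := 
    .for_ 21 Vx (
      .setNat 10 (.add (.cell 30) (.cell 21)) (.const 0) ;;
      .setNat 10 (.add (.add (.cell 30) (.cell 8)) (.cell 21)) (.const 0)) ;;
    .setNat 10 (.add (.cell 30) (.cell 20)) (.const 1) ;;
    .setWt 1 (.add (.cell 30) (.cell 20)) .zero ;;
    .setGrp 1 (.add (.cell 30) (.cell 20)) .zero ;;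
    .setNat 30 (.const 0) (.add (.add (.cell 30) (.cell 8)) (.cell 8))) V
    (hs.congr (by simp [FProg.den]) (by simp [FProg.den])).evalV
    (fun k s' => s'.nat 30 0 = 2 * V * k ∧ ∀ r < k, IsBlock (s.net m) V s'.tab r)
    ⟨by simp [FProg.den, NExp.eval], by simp⟩ (by
      intro k hk s' hI hk' hA
      have hs' : Sizes Vx mx V m s' := hs.congr (by rw [hA.nat 0 rfl]; simp [FProg.den])
        (by rw [hA.nat 8 rfl]; simp [FProg.den])
      have h1 := den_for (O := O) (s := s') (a := 21) (b := Vx) (c :=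
        .setNat 10 (.add (.cell 30) (.cell 21)) (.const 0) ;;
        .setNat 10 (.add (.add (.cell 30) (.cell 8)) (.cell 21)) (.const 0)) V hs'.evalV
        (fun j s'' => s'.tab.EqBelow s''.tab (2 * V * k) ∧
          ∀ v < j, s''.nat 10 (2 * V * k + v) = 0 ∧ s''.nat 10 (2 * V * k + V + v) = 0)
        ⟨by simpa [State.tab] using Tab.EqBelow.refl _ _, by simp⟩ (by
          intro j hj s'' hJ hj' hA'
          have e30 : s''.nat 30 0 = 2 * V * k := by rw [hA'.nat 30 rfl, hI.1]
          have e8 : s''.nat 8 0 = V := by rw [hA'.nat 8 rfl, hs'.cell]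
          simp only [FProg.den, NExp.eval, e30, e8, hj', State.nat_setNat, Nat.reduceEqDiff,
            if_false, if_true]
          refine ⟨hJ.1.trans ?_, fun v hv => ?_⟩
          · constructor <;> intro x hx <;>
              simp [State.tab, show x ≠ 2 * V * k + j by omega, show x ≠ 2 * V * k + V + j by omega]
          · rcases Nat.lt_succ_iff_lt_or_eq.1 hv with h | rfl
            · have := hJ.2 v h
              simp [Function.update_apply, this.1, this.2]
            · simp [Function.update_apply])
      have hA1 := den_agree O (.for_ 21 Vx (
        .setNat 10 (.add (.cell 30) (.cell 21)) (.const 0) ;;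
        .setNat 10 (.add (.add (.cell 30) (.cell 8)) (.cell 21)) (.const 0))) s'
      rw [den_seq]
      set s₁ := (FProg.for_ 21 Vx (
        .setNat 10 (.add (.cell 30) (.cell 21)) (.const 0) ;;
        .setNat 10 (.add (.add (.cell 30) (.cell 8)) (.cell 21)) (.const 0))).den O s'
      have e30 : s₁.nat 30 0 = 2 * V * k := by rw [hA1.nat 30 rfl, hI.1]
      have e20 : s₁.nat 20 0 = k := by rw [hA1.nat 20 rfl, hk']
      have e8 : s₁.nat 8 0 = V := by rw [hA1.nat 8 rfl, hs'.cell]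
      simp only [FProg.den, NExp.eval, WExp.eval, GExp.eval, e30, e8, e20, State.nat_setNat,
        State.nat_setWt, State.nat_setGrp, Nat.reduceEqDiff, if_false, if_true]
      refine ⟨by simp; ring, fun r hr => ?_⟩
      rcases Nat.lt_succ_iff_lt_or_eq.1 hr with h | rfl
      · refine (hI.2 r h).of_eqBelow (n := 2 * V * k) (h1.1.trans ?_) (Nat.mul_le_mul_left _ h)
        constructor <;> intro x hx <;> simp [State.tab, show x ≠ 2 * V * k + k by omega]
      · intro v hv
        rw [Nat.mod_eq_of_lt hk, Nat.div_eq_of_lt hk]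
        have hv1 := h1.2 v hv
        have hset : {l | (s.net m).Walk r l v ∧ l.length = 0} = {l | l = [] ∧ v = r} := by
          ext l
          constructor
          · rintro ⟨h1, h2⟩
            obtain rfl := List.length_eq_zero_iff.1 h2
            exact ⟨rfl, Eq.symm h1⟩
          · rintro ⟨rfl, rfl⟩; exact ⟨rfl, rfl⟩
        rw [hset]
        by_cases hvr : v = r
        · subst hvr
          refine ⟨.inr ⟨by simp [State.tab], [], by simp, ⟨trivial, by simp [State.tab],
            by simp [State.tab]⟩, by simp⟩, .inl ⟨?_, ?_⟩⟩
          · simp [State.tab, Function.update_apply, hv1.2]; omega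
          · ext l
            simp only [Set.mem_ofPred_eq, Set.mem_empty_iff_false, iff_false, not_and, not_not]
            rintro ⟨rfl, -⟩
            simp [State.tab]
        · refine ⟨.inl ⟨?_, by simp [hvr]⟩, .inl ⟨?_, by simp [hvr]⟩⟩
          · simp [State.tab, hv1.1, hvr]
          · simp [State.tab, Function.update_apply, hv1.2]; omega)
  exact this

/-- There are `(m + 1) * V` blocks because the lengths `0, …, m` are needed; trails are no longer
than `m`. The two counters of the loops together number the block that is being extended. -/
theorem den_tables {O : Oracle} {Vx mx : NExp} {s : State Γ} {V m : ℕ}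
    (hs : Sizes Vx mx V m s) (htl : ∀ e < m, s.nat 1 e < V) (hhd : ∀ e < m, s.nat 2 e < V) :
    ∀ r < (m + 1) * V, IsBlock (s.net m) V ((FProg.tables Vx mx).den O s).tab r := by
  rw [FProg.tables, den_seq, den_seq, den_seq]
  have h1 := den_firstBlocks (O := O) hs
  have hA1 := den_agree O (.firstBlocks Vx) s
  set s₁ := (FProg.firstBlocks Vx).den O s
  simp only [FProg.den.eq_2, NExp.eval, h1.1]
  set s₂ := (s₁.setNat 31 0 (2 * V * V)).setNat 30 0 0 with hs₂
  have hnet2 : s₂.net m = s.net m := by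
    simp [hs₂, State.net, hA1.nat 1 rfl, hA1.nat 2 rfl, hA1.wt 0 rfl, hA1.grp 0 rfl]
  have hsz : Sizes Vx mx V m s₂ := hs.congr (by simp [hs₂, hA1.nat 0 rfl])
    (by simp [hs₂, hA1.nat 8 rfl])
  have ht2 : s₂.nat 1 = s.nat 1 := congrArg Net.tl hnet2
  have hh2 : s₂.nat 2 = s.nat 2 := congrArg Net.hd hnet2
  have h31 : s₂.nat 31 0 = 2 * V * V := by simp [hs₂]
  have := den_for (O := O) (s := s₂) (a := 22) (b := mx) (c := .for_ 23 Vx (.block Vx mx)) m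
    hsz.evalm (fun k s' => s'.nat 30 0 = 2 * V * (k * V) ∧
      ∀ r < k * V + V, IsBlock (s.net m) V s'.tab r)
    ⟨by simp [hs₂], by simpa [hs₂, State.tab] using h1.2⟩ (by
      intro k hk s' hI hk' hA
      have := den_for (O := O) (s := s') (a := 23) (b := Vx) (c := .block Vx mx) V
        (hsz.congr (hA.nat 0 rfl) (hA.nat 8 rfl)).evalV
        (fun j s'' => s''.nat 30 0 = 2 * V * (k * V + j) ∧
          ∀ r < k * V + j + V, IsBlock (s.net m) V s''.tab r)
        ⟨by simpa using hI.1, by simpa [State.tab] using hI.2⟩ (by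
          intro j hj s'' hJ hj' hA'
          have e1 : s''.nat 1 = s₂.nat 1 := (hA'.nat 1 rfl).trans (hA.nat 1 rfl)
          have e2 : s''.nat 2 = s₂.nat 2 := (hA'.nat 2 rfl).trans (hA.nat 2 rfl)
          have eg : s''.grp 0 = s₂.grp 0 := (hA'.grp 0 rfl).trans (hA.grp 0 rfl)
          have ew : s''.wt 0 = s₂.wt 0 := (hA'.wt 0 rfl).trans (hA.wt 0 rfl)
          have hnet : s''.net m = s.net m := by
            rw [← hnet2]; simp only [State.net, e1, e2, eg, ew]
          have hb := den_block (O := O) (r := k * V + j) ((hsz.congr (hA.nat 0 rfl)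
            (hA.nat 8 rfl)).congr (hA'.nat 0 rfl) (hA'.nat 8 rfl)) (by omega) hJ.1
            (by rw [hA'.nat 31 rfl, hA.nat 31 rfl, h31]) (by rw [e1, ht2]; exact htl)
            (by rw [e2, hh2]; exact hhd) (by rw [hnet]; exact hJ.2)
          rw [hnet] at hb
          refine ⟨by simpa [add_assoc] using hb.1, fun r hr => ?_⟩
          have := hb.2 r (by omega)
          simpa [State.tab] using this)
      refine ⟨by simpa [add_mul] using this.1, fun r hr => ?_⟩
      have := this.2 r (by rw [add_mul, one_mul] at hr; exact hr)
      simpa [State.tab] using this)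
  intro r hr
  exact this.2 r (by rw [add_mul, one_mul] at hr; exact hr)

end OracleRAM

/-! ### Selecting a cheapest walk of fewest arcs -/

namespace OracleRAM

variable {Γ : Type u} [AddCommGroup Γ]

namespace FProg

/-- Considering the entry `Y` as a candidate. -/
def candidate (Y : NExp) (C : Test) : FProg :=
  setNat 33 (.const 0) Y ;;
  ite (.and (.ne0 (.read 10 (.cell 33))) (.and C (.not (.and (.ne0 (.cell 40))
      (.wtLe (.read 2 (.const 0)) (.read 1 (.cell 33)))))))
    (setNat 40 (.const 0) (.const 1) ;;
     setWt 2 (.const 0) (.read 1 (.cell 33)) ;;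
     setNat 41 (.const 0) (.cell 26) ;;
     setNat 42 (.const 0) (.cell 27) ;;
     setNat 43 (.const 0) (.cell 28) ;;
     setNat 44 (.const 0) (.cell 33))
    nop

/-- Selecting a cheapest entry that satisfies `C`, the shortest one among these. -/
def select (Vx mx : NExp) (C : Test) : FProg :=
  setNat 40 (.const 0) (.const 0) ;;
  setNat 30 (.const 0) (.const 0) ;;
  for_ 26 (.add mx (.const 1)) (for_ 27 Vx (
    for_ 28 Vx (
      candidate (.add (.cell 30) (.cell 28)) C ;;
      candidate (.add (.add (.cell 30) (.cell 8)) (.cell 28)) C) ;;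
    setNat 30 (.const 0) (.add (.add (.cell 30) (.cell 8)) (.cell 8))))

end FProg

/-- The walk `l` is cheapest, and shortest among these, in `W`. -/
def IsLexMin (G : Net Γ) (W : Set (ℕ × ℕ × List ℕ)) (l : List ℕ) : Prop :=
  ∀ x ∈ W, G.cost l ≤ G.cost x.2.2 ∧ (x.2.2.length < l.length → G.cost l < G.cost x.2.2)

/-- The memory holds the best member of `W`. -/
def Selected (G : Net Γ) (s : State Γ) (W : Set (ℕ × ℕ × List ℕ)) : Prop :=
  (s.nat 40 0 = 0 ∧ W = ∅) ∨
    (s.nat 40 0 ≠ 0 ∧ ∃ l, (s.nat 42 0, s.nat 43 0, l) ∈ W ∧ s.tab.Holds G (s.nat 44 0) l ∧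
      l.length = s.nat 41 0 ∧ s.wt 2 0 = G.cost l ∧ IsLexMin G W l)

/-- The walks that satisfy `Q` and belong to the blocks before `r`, or to the block `r` with an end
before `j`. -/
def walksBefore (G : Net Γ) (V : ℕ) (Q : ℕ → ℕ → Γ → Prop) (r j : ℕ) : Set (ℕ × ℕ × List ℕ) :=
  {x | G.Walk x.1 x.2.2 x.2.1 ∧ x.1 < V ∧ x.2.1 < V ∧ Q x.1 x.2.1 (G.label x.2.2) ∧
    (x.2.2.length * V + x.1 < r ∨ x.2.2.length * V + x.1 = r ∧ x.2.1 < j)}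

theorem Selected.of_dominated {G : Net Γ} {s : State Γ} {W W' : Set (ℕ × ℕ × List ℕ)}
    (h : Selected G s W') (hsub : W' ⊆ W)
    (hdom : ∀ x ∈ W, ∃ x' ∈ W', G.cost x'.2.2 ≤ G.cost x.2.2 ∧ x'.2.2.length = x.2.2.length) :
    Selected G s W := by
  rcases h with ⟨h1, rfl⟩ | ⟨h1, l, h2, h3, h4, h5, h6⟩
  · exact .inl ⟨h1, Set.eq_empty_of_forall_notMem fun l hl => by simpa using hdom l hl⟩
  · refine .inr ⟨h1, l, hsub h2, h3, h4, h5, fun x hx => ?_⟩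
    obtain ⟨x', h7, h8, h9⟩ := hdom x hx
    obtain ⟨h10, h11⟩ := h6 x' h7
    exact ⟨h10.trans h8, fun h => (h11 (h9 ▸ h)).trans_le h8⟩

/-- Candidates come in order of length and replace the stored walk only if they are strictly
cheaper, so ties are decided for fewer arcs. -/
theorem selected_candidate {O : Oracle} {Y : NExp} {C : Test} {s : State Γ} {G : Net Γ} {y : ℕ}
    {q : Prop} {W : Set (ℕ × ℕ × List ℕ)} {l : List ℕ} (hY : Y.eval s = y)
    (hC : C.holds O (s.setNat 33 0 y) ↔ q) (hW : Selected G s W)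
    (hl : s.tab.valid y ≠ 0 → s.tab.Holds G y l ∧ l.length = s.nat 26 0)
    (hlen : ∀ x ∈ W, x.2.2.length ≤ s.nat 26 0) :
    Selected G ((FProg.candidate Y C).den O s)
      (W ∪ {x | s.tab.valid y ≠ 0 ∧ q ∧ x = (s.nat 27 0, s.nat 28 0, l)}) := by
  have hW0 : Selected G (s.setNat 33 0 y) W := by simpa [Selected, State.tab] using hW
  rw [FProg.candidate, den_seq]
  simp only [FProg.den.eq_2, hY, NExp.eval]
  by_cases hq : s.tab.valid y ≠ 0 ∧ q
  · have hset : {x | s.tab.valid y ≠ 0 ∧ q ∧ x = (s.nat 27 0, s.nat 28 0, l)} =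
        {(s.nat 27 0, s.nat 28 0, l)} := by
      ext x; simp [hq.1, hq.2]
    obtain ⟨hl1, hl2⟩ := hl hq.1
    rw [hset]
    by_cases ht : s.nat 40 0 ≠ 0 ∧ s.wt 2 0 ≤ s.tab.d y
    · rw [den_ite_neg]
      · rcases hW0 with ⟨h1, -⟩ | ⟨h1, l', h2, h3, h4, h5, h6⟩
        · exact absurd (by simpa using h1) ht.1
        · refine .inr ⟨h1, l', .inl h2, h3, h4, h5, ?_⟩
          rintro x (hx | rfl)
          · exact h6 x hx
          · have h7 := ht.2
            rw [show s.wt 2 0 = G.cost l' from h5, hl1.d] at h7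
            -- The stored walk is not longer than the candidate, so there is nothing to show about
            -- shorter walks.
            refine ⟨h7, fun h => ?_⟩
            have := hlen _ h2
            simp only at this h
            omega
      · rintro ⟨-, -, h3⟩
        refine h3 ?_
        simpa [Test.holds, NExp.eval, WExp.eval, State.tab] using ht
    · rw [den_ite_pos]
      · refine .inr ⟨by simp [FProg.den, NExp.eval], l, .inr ?_, ?_, ?_, ?_, ?_⟩
        · simp [FProg.den, NExp.eval]
        · simpa [FProg.den, NExp.eval, State.tab] using hl1
        · simpa [FProg.den, NExp.eval] using hl2
        · simpa [FProg.den, NExp.eval, WExp.eval, State.tab] using hl1.d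
        · rintro x (hx | rfl)
          · rcases hW with ⟨-, rfl⟩ | ⟨h1, l', h2, h3, h4, h5, h6⟩
            · simp at hx
            · have h7 : G.cost l < G.cost l' := by
                rw [← hl1.d, ← h5]; by_contra hc; exact ht ⟨h1, not_lt.1 hc⟩
              have h8 := h7.trans_le (h6 x hx).1
              exact ⟨h8.le, fun _ => h8⟩
          · exact ⟨le_rfl, fun h => absurd h (lt_irrefl _)⟩
      · refine ⟨?_, hC.2 hq.2, ?_⟩
        · simpa [NExp.eval, State.tab] using hq.1
        · simpa [Test.holds, NExp.eval, WExp.eval, State.tab] using ht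
  · have hset : {x | s.tab.valid y ≠ 0 ∧ q ∧ x = (s.nat 27 0, s.nat 28 0, l)} = ∅ := by
      ext x; simp only [Set.mem_ofPred_eq, Set.mem_empty_iff_false, iff_false]; tauto
    rw [hset, Set.union_empty, den_ite_neg]
    · exact hW0
    · rintro ⟨h1, h2, -⟩
      refine hq ⟨?_, hC.1 h2⟩
      simpa [NExp.eval, State.tab] using h1

theorem walksBefore_length_le {G : Net Γ} {V k s j : ℕ} {Q : ℕ → ℕ → Γ → Prop} (hs : s < V)
    {x : ℕ × ℕ × List ℕ} (hx : x ∈ walksBefore G V Q (k * V + s) j) : x.2.2.length ≤ k := by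
  obtain ⟨-, -, -, -, hx⟩ := hx
  by_contra hc
  have := Nat.mul_le_mul_right V (not_le.1 hc)
  rw [Nat.succ_mul] at this
  omega

theorem walksBefore_succ {G : Net Γ} {V r : ℕ} {Q : ℕ → ℕ → Γ → Prop} :
    walksBefore G V Q (r + 1) 0 = walksBefore G V Q r V := by
  ext x
  simp only [walksBefore, Set.mem_ofPred_eq, Nat.not_lt_zero, and_false, or_false]
  constructor
  · rintro ⟨h1, h2, h3, h4, h5⟩; exact ⟨h1, h2, h3, h4, by omega⟩
  · rintro ⟨h1, h2, h3, h4, h5⟩; exact ⟨h1, h2, h3, h4, by omega⟩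

/-- The two entries for given start, end and length stand for all walks of that kind. In `hQ`, at
most one label is excluded wherever `Q` can be satisfied at all; a condition that fails for every
label, such as start and end being equal when they are not, admits no walk and does no harm. -/
theorem selected_end {O : Oracle} {C : Test} {s : State Γ} {G : Net Γ} {V k i j : ℕ}
    {Q : ℕ → ℕ → Γ → Prop} (hi : i < V) (hj : j < V)
    (h26 : s.nat 26 0 = k) (h27 : s.nat 27 0 = i) (h28 : s.nat 28 0 = j)
    (h30 : s.nat 30 0 = 2 * V * (k * V + i)) (h8 : s.nat 8 0 = V)
    (hC : ∀ s' : State Γ, s'.nat 3 = s.nat 3 → s'.nat 7 = s.nat 7 → s'.nat 27 = s.nat 27 →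
      s'.nat 28 = s.nat 28 → s'.grp 1 = s.grp 1 →
      (C.holds O s' ↔ Q i j (s.grp 1 (s'.nat 33 0))))
    (hQ : ∀ s t c, Q s t c → ∀ a b, ¬ Q s t a → ¬ Q s t b → a = b)
    (hblock : IsBlock G V s.tab (k * V + i))
    (hW : Selected G s (walksBefore G V Q (k * V + i) j)) :
    Selected G ((FProg.candidate (.add (.cell 30) (.cell 28)) C ;;
      FProg.candidate (.add (.add (.cell 30) (.cell 8)) (.cell 28)) C).den O s)
      (walksBefore G V Q (k * V + i) (j + 1)) := by
  set r := k * V + i with hr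
  have hmod : r % V = i := by rw [hr, mul_comm, Nat.mul_add_mod, Nat.mod_eq_of_lt hi]
  have hdiv : r / V = k := by
    rw [hr, mul_comm, Nat.mul_add_div (by omega), Nat.div_eq_of_lt hi, add_zero]
  have hpair := hblock j hj
  rw [hmod, hdiv] at hpair
  set y₁ := 2 * V * r + j with hy₁
  set y₂ := 2 * V * r + V + j with hy₂
  have hex : ∀ y, (y = y₁ ∨ y = y₂) → ∃ l, s.tab.valid y ≠ 0 →
      (G.Walk i l j ∧ l.length = k) ∧ s.tab.Holds G y l := by
    intro y hy
    by_cases h : s.tab.valid y = 0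
    · exact ⟨[], fun h' => absurd h h'⟩
    · obtain ⟨l, h3, h4⟩ := hpair.exists_holds hy h
      exact ⟨l, fun _ => ⟨h3, h4⟩⟩
  obtain ⟨l₁, hl₁⟩ := hex y₁ (.inl rfl)
  obtain ⟨l₂, hl₂⟩ := hex y₂ (.inr rfl)
  have c1 := selected_candidate (O := O) (Y := .add (.cell 30) (.cell 28)) (C := C) (s := s)
    (y := y₁) (q := Q i j (s.grp 1 y₁)) (l := l₁)
    (by simp [NExp.eval, h30, h28, hy₁])
    (by rw [hC _ (by simp) (by simp) (by simp) (by simp) (by simp)]; simp) hW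
    (fun h => ⟨(hl₁ h).2, by rw [h26, (hl₁ h).1.2]⟩)
    (fun x hx => by rw [h26]; exact walksBefore_length_le hi hx)
  have hA := den_agree O (.candidate (.add (.cell 30) (.cell 28)) C) s
  rw [den_seq]
  set s' := (FProg.candidate (.add (.cell 30) (.cell 28)) C).den O s
  have htab : s'.tab = s.tab := by
    simp only [State.tab, hA.nat 10 rfl, hA.nat 11 rfl, hA.nat 12 rfl, hA.wt 1 rfl, hA.grp 1 rfl]
  have c2 := selected_candidate (O := O) (Y := .add (.add (.cell 30) (.cell 8)) (.cell 28))
    (C := C) (s := s') (y := y₂) (q := Q i j (s.grp 1 y₂)) (l := l₂)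
    (by simp [NExp.eval, hA.nat 30 rfl, hA.nat 8 rfl, hA.nat 28 rfl, h30, h28, h8, hy₂])
    (by
      rw [hC _ (by simp [hA.nat 3 rfl]) (by simp [hA.nat 7 rfl]) (by simp [hA.nat 27 rfl])
        (by simp [hA.nat 28 rfl]) (by simp [hA.grp 1 rfl])]; simp) c1
    (fun h => by
      rw [htab] at h ⊢
      exact ⟨(hl₂ h).2, by rw [hA.nat 26 rfl, h26, (hl₂ h).1.2]⟩)
    (by
      rw [hA.nat 26 rfl, h26]
      rintro x (hx | ⟨h1, -, rfl⟩)
      · exact walksBefore_length_le hi hx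
      · exact (hl₁ h1).1.2.le)
  rw [htab, hA.nat 27 rfl, hA.nat 28 rfl, h27, h28] at c2
  refine c2.of_dominated ?_ ?_
  · rintro x ((⟨h1, h2, h3, h4, h5⟩ | ⟨h1, h2, rfl⟩) | ⟨h1, h2, rfl⟩)
    · exact ⟨h1, h2, h3, h4, by omega⟩
    · refine ⟨(hl₁ h1).1.1, hi, hj, ?_, .inr ⟨by simp [(hl₁ h1).1.2, hr], by simp⟩⟩
      rw [← (hl₁ h1).2.3]; exact h2
    · refine ⟨(hl₂ h1).1.1, hi, hj, ?_, .inr ⟨by simp [(hl₂ h1).1.2, hr], by simp⟩⟩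
      rw [← (hl₂ h1).2.3]; exact h2
  · rintro ⟨i', j', l⟩ ⟨h1, h2, h3, h4, h5⟩
    simp only at h1 h2 h3 h4 h5
    by_cases h6 : l.length * V + i' < r ∨ l.length * V + i' = r ∧ j' < j
    · exact ⟨(i', j', l), .inl (.inl ⟨h1, h2, h3, h4, h6⟩), le_rfl, rfl⟩
    · obtain ⟨h7, rfl⟩ : l.length * V + i' = r ∧ j' = j := by omega
      obtain rfl : i' = i := by
        rw [← hmod, ← h7, mul_comm, Nat.mul_add_mod, Nat.mod_eq_of_lt h2]
      have h8 : l.length = k := by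
        rw [hr] at h7
        exact Nat.eq_of_mul_eq_mul_right (by omega) (Nat.add_right_cancel h7)
      obtain ⟨y, rfl | rfl, h9, h10, h11⟩ := hpair.dominates (P := Q i' j') (hQ _ _ _ h4)
        (l := l) ⟨h1, h8⟩ h4
      · refine ⟨_, .inl (.inr ⟨h9, h10, rfl⟩), ?_, by rw [(hl₁ h9).1.2, h8]⟩
        rwa [(hl₁ h9).2.2] at h11
      · refine ⟨_, .inr ⟨h9, h10, rfl⟩, ?_, by rw [(hl₂ h9).1.2, h8]⟩
        rwa [(hl₂ h9).2.2] at h11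

/-- The test `C` may use the supplies and demands in the arrays `3` and `7`, the current ends and
the label of the entry; none of the arrays it relies on changes except the counters and the current
position. -/
theorem den_select {O : Oracle} {Vx mx : NExp} {C : Test} {s : State Γ} {G : Net Γ} {V m : ℕ}
    {Q : ℕ → ℕ → Γ → Prop} (hs : Sizes Vx mx V m s)
    (hC : ∀ s' : State Γ, s'.nat 3 = s.nat 3 → s'.nat 7 = s.nat 7 → s'.grp 1 = s.grp 1 →
      (C.holds O s' ↔ Q (s'.nat 27 0) (s'.nat 28 0) (s.grp 1 (s'.nat 33 0))))
    (hQ : ∀ s t c, Q s t c → ∀ a b, ¬ Q s t a → ¬ Q s t b → a = b)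
    (hblock : ∀ r < (m + 1) * V, IsBlock G V s.tab r) :
    Selected G ((FProg.select Vx mx C).den O s) {x | G.Walk x.1 x.2.2 x.2.1 ∧ x.1 < V ∧
      x.2.1 < V ∧ x.2.2.length ≤ m ∧ Q x.1 x.2.1 (G.label x.2.2)} := by
  rw [FProg.select, den_seq, den_seq]
  simp only [FProg.den.eq_2, NExp.eval]
  set s₁ := (s.setNat 40 0 0).setNat 30 0 0 with hs₁
  have hs1 : Sizes Vx mx V m s₁ := hs.congr (by simp [hs₁]) (by simp [hs₁])
  have htab1 : s₁.tab = s.tab := by simp [hs₁, State.tab]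
  have e3 : s₁.nat 3 = s.nat 3 := by simp [hs₁]
  have e7 : s₁.nat 7 = s.nat 7 := by simp [hs₁]
  have eg : s₁.grp 1 = s.grp 1 := by simp [hs₁]
  have hall := den_for (O := O) (s := s₁) (a := 26) (b := .add mx (.const 1)) (c := 
    .for_ 27 Vx (
    .for_ 28 Vx (
      .candidate (.add (.cell 30) (.cell 28)) C ;;
      .candidate (.add (.add (.cell 30) (.cell 8)) (.cell 28)) C) ;;
    .setNat 30 (.const 0) (.add (.add (.cell 30) (.cell 8)) (.cell 8)))) (m + 1)
    (by simp [NExp.eval, hs1.evalm])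
    (fun k s' => s'.nat 30 0 = 2 * V * (k * V) ∧ Selected G s' (walksBefore G V Q (k * V) 0))
    ⟨by simp [hs₁], .inl ⟨by simp [hs₁], by ext x; simp [walksBefore]⟩⟩ (by
      intro k hk s' hI hk' hA
      have hs2 : Sizes Vx mx V m s' := hs1.congr (hA.nat 0 rfl) (hA.nat 8 rfl)
      have := den_for (O := O) (s := s') (a := 27) (b := Vx) (c := 
        .for_ 28 Vx (
          .candidate (.add (.cell 30) (.cell 28)) C ;;
          .candidate (.add (.add (.cell 30) (.cell 8)) (.cell 28)) C) ;;
        .setNat 30 (.const 0) (.add (.add (.cell 30) (.cell 8)) (.cell 8))) V hs2.evalV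
        (fun i s'' => s''.nat 30 0 = 2 * V * (k * V + i) ∧
          Selected G s'' (walksBefore G V Q (k * V + i) 0))
        ⟨by simpa using hI.1, by simpa [Selected, State.tab] using hI.2⟩ (by
          intro i hi s'' hJ hi' hA'
          have hs3 : Sizes Vx mx V m s'' := hs2.congr (hA'.nat 0 rfl) (hA'.nat 8 rfl)
          have := den_for (O := O) (s := s'') (a := 28) (b := Vx) (c :=
            .candidate (.add (.cell 30) (.cell 28)) C ;;
            .candidate (.add (.add (.cell 30) (.cell 8)) (.cell 28)) C) V hs3.evalV
            (fun j s'' => Selected G s'' (walksBefore G V Q (k * V + i) j))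
            (by simpa [Selected, State.tab] using hJ.2) (by
              intro j hj s₃ hK hj' hA''
              have htab : s₃.tab = s.tab := by
                rw [← htab1]
                simp only [State.tab, hA''.nat 10 rfl, hA''.nat 11 rfl, hA''.nat 12 rfl,
                  hA''.wt 1 rfl, hA''.grp 1 rfl, hA'.nat 10 rfl, hA'.nat 11 rfl, hA'.nat 12 rfl,
                  hA'.wt 1 rfl, hA'.grp 1 rfl, hA.nat 10 rfl, hA.nat 11 rfl, hA.nat 12 rfl,
                  hA.wt 1 rfl, hA.grp 1 rfl]
              have g3 : s₃.nat 3 = s.nat 3 := by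
                rw [hA''.nat 3 rfl, hA'.nat 3 rfl, hA.nat 3 rfl, e3]
              have g7 : s₃.nat 7 = s.nat 7 := by
                rw [hA''.nat 7 rfl, hA'.nat 7 rfl, hA.nat 7 rfl, e7]
              have gg : s₃.grp 1 = s.grp 1 := congrArg Tab.g htab
              have h27 : s₃.nat 27 0 = i := by rw [hA''.nat 27 rfl, hi']
              have := selected_end (O := O) (C := C) (Q := Q) hi hj (s := s₃) (G := G) (k := k)
                (by rw [hA''.nat 26 rfl, hA'.nat 26 rfl, hk']) h27 hj'
                (by rw [hA''.nat 30 rfl, hJ.1]) (by rw [hA''.nat 8 rfl, hs3.cell])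
                (fun s' h1 h2 h3 h4 h5 => by
                  rw [hC s' (h1.trans g3) (h2.trans g7) (h5.trans gg), h3, h4, h27, hj', gg])
                hQ (by
                  rw [htab]; refine hblock _ ?_
                  have : k * V ≤ m * V := Nat.mul_le_mul_right _ (by omega)
                  rw [add_mul]; omega) hK
              simpa [Selected, State.tab] using this)
          have hA2 := den_agree O (.for_ 28 Vx (
            .candidate (.add (.cell 30) (.cell 28)) C ;;
            .candidate (.add (.add (.cell 30) (.cell 8)) (.cell 28)) C)) s''
          rw [den_seq]
          set s₄ := (FProg.for_ 28 Vx (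
            .candidate (.add (.cell 30) (.cell 28)) C ;;
            .candidate (.add (.add (.cell 30) (.cell 8)) (.cell 28)) C)).den O s''
          have e30 : s₄.nat 30 0 = 2 * V * (k * V + i) := by rw [hA2.nat 30 rfl, hJ.1]
          have e8 : s₄.nat 8 0 = V := by rw [hA2.nat 8 rfl, hs3.cell]
          refine ⟨?_, ?_⟩
          · simp [FProg.den, NExp.eval, e30, e8]; ring
          · rw [← add_assoc, walksBefore_succ]
            simpa [FProg.den, Selected, State.tab] using this)
      refine ⟨by simpa [add_mul] using this.1, ?_⟩
      rw [add_mul, one_mul]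
      have h2 := this.2
      simpa [Selected, State.tab] using h2)
  have hset : walksBefore G V Q ((m + 1) * V) 0 = {x | G.Walk x.1 x.2.2 x.2.1 ∧ x.1 < V ∧
      x.2.1 < V ∧ x.2.2.length ≤ m ∧ Q x.1 x.2.1 (G.label x.2.2)} := by
    ext x
    simp only [walksBefore, Set.mem_ofPred_eq, Nat.not_lt_zero, and_false, or_false]
    constructor
    · rintro ⟨h1, h2, h3, h4, h5⟩
      refine ⟨h1, h2, h3, ?_, h4⟩
      have : x.2.2.length * V < (m + 1) * V := by omega
      have := Nat.lt_of_mul_lt_mul_right this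
      omega
    · rintro ⟨h1, h2, h3, h4, h5⟩
      refine ⟨h1, h2, h3, h5, ?_⟩
      have := Nat.mul_le_mul_right V h4
      rw [add_mul]; omega
  rw [← hset]
  exact hall.2

end OracleRAM

/-! ### Supplies and demands -/

namespace Net

open Finset

variable {Γ : Type u} [AddCommGroup Γ] {G : Net Γ} {V v e : ℕ} {B B' : Finset ℕ}

/-- This is the effect on the residual digraph of swapping the ends of one arc and negating its cost
and label in place. -/
theorem flip_symmDiff_singleton (B : Finset ℕ) (e : ℕ) :
    G.flip (symmDiff B {e}) =
      ⟨G.m, Function.update (G.flip B).tl e ((G.flip B).hd e),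
        Function.update (G.flip B).hd e ((G.flip B).tl e),
        Function.update (G.flip B).c e (- (G.flip B).c e),
        Function.update (G.flip B).lab e (- (G.flip B).lab e)⟩ := by
  simp only [flip, Net.mk.injEq, true_and]
  refine ⟨?_, ?_, ?_, ?_⟩ <;> funext x <;> by_cases hx : x = e <;> by_cases hB : x ∈ B <;>
    simp_all [mem_symmDiff]

/-- All arcs have their ends below `V`. -/
def EndsBelow (G : Net Γ) (V : ℕ) : Prop := ∀ e < G.m, G.tl e < V ∧ G.hd e < V

theorem EndsBelow.flip (h : G.EndsBelow V) (B : Finset ℕ) : (G.flip B).EndsBelow V := by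
  intro e he
  have := h e he
  simp only [Net.flip]; split_ifs
  exacts [⟨this.2, this.1⟩, this]

theorem EndsBelow.net_eq_zero (h : G.EndsBelow V) (hB : B ⊆ range G.m) (hv : V ≤ v) :
    G.net B v = 0 := sum_eq_zero fun e he => by
  have := h e (by simpa using hB he)
  simp [chi, show G.tl e ≠ v by omega, show G.hd e ≠ v by omega]

theorem EndsBelow.sum_net (h : G.EndsBelow V) (hB : B ⊆ range G.m) :
    ∑ v ∈ range V, G.net B v = 0 := by
  simp only [net]
  rw [sum_comm]
  refine sum_eq_zero fun e he => ?_
  have := h e (by simpa using hB he)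
  simp [chi, sum_sub_distrib, this.1, this.2]

/-- The net degrees of `B` and the remaining supplies `p` and demands `q` add up to those of
`B'`. -/
def Completes (G : Net Γ) (V : ℕ) (p q : ℕ → ℕ) (B B' : Finset ℕ) : Prop :=
  B' ⊆ range G.m ∧ ∀ v < V, G.net B' v = G.net B v + p v - q v

/-- A vertex with supply has no demand, so at least `p v` arcs of `B'` leave it, and these arcs are
distinct for different vertices. This bounds the number of augmentations by `m`. -/
theorem sum_supply_le (hG : G.EndsBelow V) {p q : ℕ → ℕ} (hpq : ∀ v < V, p v = 0 ∨ q v = 0)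
    (hB' : G.Completes V p q ∅ B') : ∑ v ∈ range V, p v ≤ G.m := by
  obtain ⟨h1, h2⟩ := hB'
  have h3 : ∀ v ∈ range V, p v ≤ (B'.filter fun e => G.tl e = v).card := by
    intro v hv
    have hv' : v < V := by simpa using hv
    rcases hpq v hv' with h | h
    · omega
    · have h4 := h2 v hv'
      have h5 : G.net B' v ≤ ((B'.filter fun e => G.tl e = v).card : ℤ) := by
        rw [net, card_filter]
        push_cast
        refine sum_le_sum fun e _ => ?_
        simp only [chi]; split_ifs <;> simp
      have h6 : G.net ∅ v = 0 := by simp [net]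
      rw [h6, h] at h4
      omega
  calc ∑ v ∈ range V, p v ≤ ∑ v ∈ range V, (B'.filter fun e => G.tl e = v).card :=
        sum_le_sum h3
    _ = B'.card := (card_eq_sum_card_fiberwise fun e he => by
        simpa using (hG e (by simpa using h1 he)).1).symm
    _ ≤ G.m := by simpa using card_le_card h1

/-- Net degrees of any arc set sum to zero, so in a feasible instance the remaining supply and
demand are equal in total. -/
theorem sum_demand_eq_zero (hG : G.EndsBelow V) {p q : ℕ → ℕ} (hB : B ⊆ range G.m)
    (hB' : G.Completes V p q B B') (hp : ∑ v ∈ range V, p v = 0) : ∑ v ∈ range V, q v = 0 := by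
  have h1 : ∑ v ∈ range V, G.net B' v =
      ∑ v ∈ range V, G.net B v + ∑ v ∈ range V, (p v : ℤ) - ∑ v ∈ range V, (q v : ℤ) := by
    rw [← sum_add_distrib, ← sum_sub_distrib]
    exact sum_congr rfl fun v hv => hB'.2 v (by simpa using hv)
  rw [hG.sum_net hB, hG.sum_net hB'.1] at h1
  have : ∑ v ∈ range V, (p v : ℤ) = 0 := by exact_mod_cast hp
  have : ∑ v ∈ range V, (q v : ℤ) = 0 := by linarith
  exact_mod_cast this

end Net

/-! ### Successive shortest walks and the non-zero cycle -/

namespace OracleRAM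

open Finset

variable {Γ : Type u} [AddCommGroup Γ]

namespace FProg

/-- Reversing the arcs of the selected walk. -/
def flips (mx : NExp) : FProg :=
  for_ 29 mx (ite (.not (.natLe (.cell 41) (.cell 29)))
    (setNat 45 (.const 0) (.read 11 (.cell 44)) ;;
     setNat 46 (.const 0) (.read 1 (.cell 45)) ;;
     setNat 1 (.cell 45) (.read 2 (.cell 45)) ;;
     setNat 2 (.cell 45) (.cell 46) ;;
     setGrp 0 (.cell 45) (.neg (.read 0 (.cell 45))) ;;
     setWt 0 (.cell 45) (.sub .zero (.read 0 (.cell 45))) ;;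
     setNat 6 (.cell 45) (.sub (.const 1) (.read 6 (.cell 45))) ;;
     setNat 44 (.const 0) (.read 12 (.cell 44)))
    nop)

/-- Finding the best walk that satisfies `C`. -/
def search (Vx mx : NExp) (C : Test) : FProg := tables Vx mx ;; select Vx mx C

/-- Supply at the start, demand at the end. -/
def isAugmenting : Test := .and (.ne0 (.read 3 (.cell 27))) (.ne0 (.read 7 (.cell 28)))

/-- A closed walk with a non-zero label. -/
def isNonzeroCycle : Test :=
  .and (.and (.natLe (.cell 27) (.cell 28)) (.natLe (.cell 28) (.cell 27)))
    (.not (.isZero (.read 1 (.cell 33))))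

/-- One augmentation. -/
def augment (Vx mx : NExp) : FProg :=
  search Vx mx isAugmenting ;;
  ite (.ne0 (.cell 40))
    (flips mx ;;
     setNat 3 (.cell 42) (.sub (.read 3 (.cell 42)) (.const 1)) ;;
     setNat 7 (.cell 43) (.sub (.read 7 (.cell 43)) (.const 1)))
    nop

/-- Flipping a cheapest non-zero cycle. -/
def flipCycle (Vx mx : NExp) : FProg :=
  search Vx mx isNonzeroCycle ;;
  ite (.ne0 (.cell 40)) (flips mx ;; setNat 5 (.const 0) (.const 1)) nop

/-- Computing a cheapest non-zero set with the given supplies and demands. -/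
def core (Vx mx : NExp) : FProg :=
  for_ 47 mx (augment Vx mx) ;;
  setNat 48 (.const 0) (.const 0) ;;
  for_ 49 Vx (setNat 48 (.const 0)
    (.add (.cell 48) (.add (.read 3 (.cell 49)) (.read 7 (.cell 49))))) ;;
  setGrp 3 (.const 0) .zero ;;
  for_ 50 mx (ite (.ne0 (.read 6 (.cell 50)))
    (setGrp 3 (.const 0) (.add (.read 3 (.const 0)) (.read 0 (.cell 50)))) nop) ;;
  ite (.ne0 (.cell 48)) nop
    (ite (.not (.isZero (.read 3 (.const 0)))) (setNat 5 (.const 0) (.const 1)) (flipCycle Vx mx))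

end FProg

/-- The memory holds the set `B` and the residual digraph. -/
structure Residual (G : Net Γ) (B : Finset ℕ) (s : State Γ) : Prop where
  net : s.net G.m = G.flip B
  mem : ∀ e, s.nat 6 e = if e ∈ B then 1 else 0

theorem Residual.congr {G : Net Γ} {B : Finset ℕ} {s s' : State Γ} (h : Residual G B s)
    (h1 : s'.nat 1 = s.nat 1) (h2 : s'.nat 2 = s.nat 2) (h6 : s'.nat 6 = s.nat 6)
    (hw : s'.wt 0 = s.wt 0) (hg : s'.grp 0 = s.grp 0) : Residual G B s' :=
  ⟨by rw [← h.net]; simp only [State.net, h1, h2, hw, hg], by rw [h6]; exact h.mem⟩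

/-- After `j` rounds the first `j` arcs of `l` are flipped and the pointer traces the others. Loop
bounds must be fixed, so there are `m` rounds, those beyond the length of `l` being idle. -/
theorem den_flips {O : Oracle} {mx : NExp} {s : State Γ} {G : Net Γ} {B : Finset ℕ} {l : List ℕ}
    (hm : mx.eval s = G.m) (h : Residual G B s) (hl : s.tab.Traced (s.nat 44 0) l)
    (hlen : l.length = s.nat 41 0) (hn : l.Nodup) (hle : l.length ≤ G.m) :
    Residual G (symmDiff B l.toFinset) ((FProg.flips mx).den O s) := by
  have := den_for (O := O) (s := s) (a := 29) (b := mx) (c := .ite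
    (.not (.natLe (.cell 41) (.cell 29)))
    (.setNat 45 (.const 0) (.read 11 (.cell 44)) ;;
     .setNat 46 (.const 0) (.read 1 (.cell 45)) ;;
     .setNat 1 (.cell 45) (.read 2 (.cell 45)) ;;
     .setNat 2 (.cell 45) (.cell 46) ;;
     .setGrp 0 (.cell 45) (.neg (.read 0 (.cell 45))) ;;
     .setWt 0 (.cell 45) (.sub .zero (.read 0 (.cell 45))) ;;
     .setNat 6 (.cell 45) (.sub (.const 1) (.read 6 (.cell 45))) ;;
     .setNat 44 (.const 0) (.read 12 (.cell 44)))
    .nop) G.m hm (fun j s' => Residual G (symmDiff B (l.take j).toFinset) s' ∧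
      s.tab.Traced (s'.nat 44 0) (l.drop j))
    ⟨by
      rw [List.take_zero, List.toFinset_nil, ← Finset.bot_eq_empty, symmDiff_bot]
      exact h.congr rfl rfl rfl rfl rfl, by simpa using hl⟩ (by
      intro j hj s' hI hj' hA
      obtain ⟨hR, hT⟩ := hI
      have e41 : s'.nat 41 0 = l.length := by rw [hA.nat 41 rfl, hlen]
      by_cases hjl : j < l.length
      · have hd : l.drop j = l[j] :: l.drop (j + 1) := List.drop_eq_getElem_cons hjl
        rw [hd] at hT
        obtain ⟨h1, -, h3⟩ := hT
        have e11 : s'.nat 11 (s'.nat 44 0) = l[j] := by rw [hA.nat 11 rfl]; exact h1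
        have e12 : s'.nat 12 = s.tab.prev := hA.nat 12 rfl
        have hset : symmDiff B (l.take (j + 1)).toFinset =
            symmDiff (symmDiff B (l.take j).toFinset) {l[j]} := by
          -- A repeated arc would be flipped back; this is where the walk has to be a trail.
          have hnot : l[j] ∉ l.take j := by
            have h4 := hn
            rw [← List.take_append_drop j l, List.nodup_append] at h4
            exact fun h5 => h4.2.2 _ h5 _ (by rw [hd]; exact List.mem_cons_self) rfl
          rw [symmDiff_assoc]
          congr 1
          ext x
          rw [List.take_add_one, List.getElem?_eq_getElem hjl]
          simp only [List.mem_toFinset, List.mem_append, Option.mem_toList,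
            Option.some.injEq, mem_symmDiff, mem_singleton]
          constructor
          · rintro (h6 | rfl)
            · exact .inl ⟨h6, fun h7 => hnot (h7 ▸ h6)⟩
            · exact .inr ⟨rfl, hnot⟩
          · rintro (h6 | h6)
            exacts [.inl h6.1, .inr h6.1.symm]
        rw [den_ite_pos (by simp only [Test.holds, NExp.eval, e41, hj']; omega)]
        rw [hset]
        refine ⟨⟨?_, ?_⟩, ?_⟩
        · rw [Net.flip_symmDiff_singleton, ← hR.net]
          simp only [FProg.den, NExp.eval, e11]
          simp [State.net, GExp.eval, WExp.eval, NExp.eval]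
        · intro e
          simp only [FProg.den, NExp.eval, e11]
          simp only [State.nat_setNat, State.nat_setGrp, State.nat_setWt, Nat.reduceEqDiff,
            if_false, if_true, Function.update_self, Function.update_apply, hR.mem]
          by_cases he : e = l[j]
          · subst he
            by_cases hB : l[j] ∈ symmDiff B (l.take j).toFinset <;>
              simp [mem_symmDiff (s := symmDiff B (l.take j).toFinset), hB]
          · simp [mem_symmDiff (s := symmDiff B (l.take j).toFinset), he]
        · simpa [FProg.den, NExp.eval, e11, e12] using h3
      · rw [den_ite_neg (by simp only [Test.holds, NExp.eval, e41, hj']; omega)]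
        rw [List.take_of_length_le (by omega)]
        rw [List.take_of_length_le (by omega)] at hR
        refine ⟨hR.congr rfl rfl rfl rfl rfl, ?_⟩
        rw [List.drop_eq_nil_of_le (by omega)]
        trivial)
  rw [List.take_of_length_le hle] at this
  exact this.1

theorem den_search {O : Oracle} {Vx mx : NExp} {C : Test} {s : State Γ} {G : Net Γ}
    {B : Finset ℕ} {V : ℕ} {Q : ℕ → ℕ → Γ → Prop} (hs : Sizes Vx mx V G.m s)
    (hG : G.EndsBelow V) (h : Residual G B s)
    (hC : ∀ s' : State Γ, s'.nat 3 = s.nat 3 → s'.nat 7 = s.nat 7 →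
      (C.holds O s' ↔ Q (s'.nat 27 0) (s'.nat 28 0) (s'.grp 1 (s'.nat 33 0))))
    (hQ : ∀ s t c, Q s t c → ∀ a b, ¬ Q s t a → ¬ Q s t b → a = b) :
    Selected (G.flip B) ((FProg.search Vx mx C).den O s) {x | (G.flip B).Walk x.1 x.2.2 x.2.1 ∧
      x.1 < V ∧ x.2.1 < V ∧ x.2.2.length ≤ G.m ∧ Q x.1 x.2.1 ((G.flip B).label x.2.2)} := by
  have hF := hG.flip B
  rw [← h.net] at hF ⊢
  have h1 := den_tables (O := O) hs (fun e he => (hF e he).1) (fun e he => (hF e he).2)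
  have hA := den_agree O (.tables Vx mx) s
  rw [FProg.search, den_seq]
  exact den_select (hs.congr (hA.nat 0 rfl) (hA.nat 8 rfl)) (fun s' h3 h7 hg => by
    rw [hC s' (h3.trans (hA.nat 3 rfl)) (h7.trans (hA.nat 7 rfl)), hg]) hQ h1

/-- The memory after some augmentations. -/
structure Progress (G : Net Γ) (V : ℕ) (p q : ℕ → ℕ) (j : ℕ) (B : Finset ℕ) (s : State Γ) :
    Prop where
  subset : B ⊆ range G.m
  residual : Residual G B s
  optimal : G.Optimal B
  net : ∀ v < V, G.net B v + s.nat 3 v - s.nat 7 v = p v - q v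
  disj : ∀ v < V, s.nat 3 v = 0 ∨ s.nat 7 v = 0
  sum : (∃ B', G.Completes V p q ∅ B') → ∑ v ∈ range V, s.nat 3 v ≤ G.m - j

theorem Progress.congr {G : Net Γ} {V j : ℕ} {p q : ℕ → ℕ} {B : Finset ℕ} {s s' : State Γ}
    (h : Progress G V p q j B s) (h1 : s'.nat 1 = s.nat 1) (h2 : s'.nat 2 = s.nat 2)
    (h3 : s'.nat 3 = s.nat 3) (h6 : s'.nat 6 = s.nat 6) (h7 : s'.nat 7 = s.nat 7)
    (hw : s'.wt 0 = s.wt 0) (hg : s'.grp 0 = s.grp 0) : Progress G V p q j B s' :=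
  ⟨h.1, h.2.congr h1 h2 h6 hw hg, h.3, by rw [h3, h7]; exact h.4, by rw [h3, h7]; exact h.5,
    by rw [h3]; exact h.6⟩

theorem Progress.completes {G : Net Γ} {V j : ℕ} {p q : ℕ → ℕ} {B B' : Finset ℕ} {s : State Γ}
    (h : Progress G V p q j B s) (hB' : G.Completes V p q ∅ B') :
    G.Completes V (s.nat 3) (s.nat 7) B B' :=
  ⟨hB'.1, fun v hv => by
    have h1 := hB'.2 v hv
    have h2 := h.net v hv
    have h3 : G.net ∅ v = 0 := by simp [Net.net]
    linarith⟩

theorem sum_update_sub_one {f : ℕ → ℕ} {V i : ℕ} (hi : i < V) (hf : f i ≠ 0) :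
    ∑ v ∈ range V, Function.update f i (f i - 1) v = ∑ v ∈ range V, f v - 1 := by
  have h1 := sum_update_of_mem (mem_range.2 hi) f (f i - 1)
  have h2 := sum_sdiff (f := f) (singleton_subset_iff.2 (mem_range.2 hi))
  rw [sum_singleton] at h2
  omega

/-- A round either moves one unit of supply along a shortest walk, or finds no walk. In the latter
case a feasible instance has no supply left, since an augmenting walk would exist otherwise; so the
bound `m - j` holds in both cases. -/
theorem den_augment {O : Oracle} {Vx mx : NExp} {s : State Γ} {G : Net Γ} {B : Finset ℕ}
    {V j : ℕ} {p q : ℕ → ℕ} (hs : Sizes Vx mx V G.m s) (hG : G.EndsBelow V)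
    (h : Progress G V p q j B s) :
    ∃ B', Progress G V p q (j + 1) B' ((FProg.augment Vx mx).den O s) := by
  rw [FProg.augment, den_seq]
  have hsel := den_search (O := O) (C := FProg.isAugmenting) (Q := fun i t _ => s.nat 3 i ≠ 0 ∧
    s.nat 7 t ≠ 0) hs hG h.residual
    (fun s' h3 h7 => by simp [FProg.isAugmenting, Test.holds, NExp.eval, h3, h7])
    -- The condition ignores labels: where it holds for one label it excludes none.
    (fun s t c h a b h' => absurd h h')
  have hA := den_agree O (.search Vx mx FProg.isAugmenting) s
  set s₁ := (FProg.search Vx mx FProg.isAugmenting).den O s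
  have h1 : Progress G V p q j B s₁ := h.congr (hA.nat 1 rfl) (hA.nat 2 rfl) (hA.nat 3 rfl)
    (hA.nat 6 rfl) (hA.nat 7 rfl) (hA.wt 0 rfl) (hA.grp 0 rfl)
  rw [← hA.nat 3 rfl, ← hA.nat 7 rfl] at hsel
  rcases hsel with ⟨h40, hW⟩ | ⟨h40, l, hl, hh, hlen, -, hmin⟩
  · rw [den_ite_neg (by simp [NExp.eval, h40])]
    refine ⟨B, h1.1, h1.2, h1.3, h1.4, h1.5, ?_⟩
    rintro ⟨B', hB'⟩
    by_contra hc
    have hpos : ∑ v ∈ range V, s₁.nat 3 v ≠ 0 := fun h0 => hc (by simp [FProg.den, h0])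
    obtain ⟨i, hi, hi0⟩ := exists_ne_zero_of_sum_ne_zero hpos
    have hi' : i < V := by simpa using hi
    have hcomp := h1.completes hB'
    obtain ⟨t, l, hl, hlen, ht⟩ := Net.exists_augmenting_walk (s := i) h1.subset hB'.1 (by
      have h2 := hcomp.2 i hi'
      have h3 := h1.disj i hi'
      omega)
    have htV : t < V := by
      by_contra htV
      rw [hG.net_eq_zero h1.subset (by omega), hG.net_eq_zero hB'.1 (by omega)] at ht
      omega
    have hmem : (i, t, l) ∈ (∅ : Set (ℕ × ℕ × List ℕ)) := by
      rw [← hW]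
      refine ⟨hl, hi', htV, hlen, hi0, ?_⟩
      have h2 := hcomp.2 t htV
      simp only
      omega
    exact hmem
  · rw [den_ite_pos (by simpa [NExp.eval] using h40), den_seq, den_seq]
    obtain ⟨hwalk, hi, ht, hle, hQ1, hQ2⟩ := hl
    simp only at hwalk hi ht hle hQ1 hQ2
    set i := s₁.nat 42 0 with hi_def
    set t := s₁.nat 43 0 with ht_def
    have hit : i ≠ t := by
      intro hit
      have := h1.disj i hi
      rw [← hit] at hQ2
      omega
    obtain ⟨hn, hopt, hnet⟩ := h1.optimal.augment h1.subset hit hwalk (fun l' hl' hle' =>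
      hmin (i, t, l') ⟨hl', hi, ht, hle', hQ1, hQ2⟩) hle
    have hsz : Sizes Vx mx V G.m s₁ := hs.congr (hA.nat 0 rfl) (hA.nat 8 rfl)
    have hR := den_flips (O := O) hsz.evalm h1.residual hh.traced hlen hn hle
    have hA2 := den_agree O (.flips mx) s₁
    set s₂ := (FProg.flips mx).den O s₁
    have e42 : s₂.nat 42 0 = i := by rw [hA2.nat 42 rfl]
    have e43 : s₂.nat 43 0 = t := by rw [hA2.nat 43 rfl]
    have e3 : s₂.nat 3 = s₁.nat 3 := hA2.nat 3 rfl
    have e7 : s₂.nat 7 = s₁.nat 7 := hA2.nat 7 rfl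
    simp only [FProg.den.eq_2, NExp.eval, e42, e43, e3, State.nat_setNat, Nat.reduceEqDiff,
      if_false, e7]
    refine ⟨symmDiff B l.toFinset, Net.symmDiff_subset_range h1.subset hwalk.toFinset_subset,
      hR.congr (by simp) (by simp) (by simp) (by simp) (by simp), hopt, ?_, ?_, ?_⟩
    · intro v hv
      have h2 := h1.net v hv
      rw [hnet]
      simp only [State.nat_setNat, Nat.reduceEqDiff, if_false, if_true, e3, e7,
        Function.update_apply]
      by_cases hv1 : v = i <;> by_cases hv2 : v = t
      · exact absurd (hv1.symm.trans hv2) hit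
      · subst hv1
        simp only [if_true, hv2, Ne.symm hv2, if_false]
        omega
      · subst hv2
        simp only [if_true, hv1, Ne.symm hv1, if_false]
        omega
      · simp only [hv1, hv2, Ne.symm hv1, Ne.symm hv2, if_false]
        omega
    · intro v hv
      have := h1.disj v hv
      simp only [State.nat_setNat, Nat.reduceEqDiff, if_false, if_true, e3, e7,
        Function.update_apply]
      have ha : v = i → s₁.nat 3 i = s₁.nat 3 v := fun h => by rw [h]
      have hb : v = t → s₁.nat 7 t = s₁.nat 7 v := fun h => by rw [h]
      split_ifs <;> omega
    · intro hf
      have h2 := h1.sum hf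
      simp only [State.nat_setNat, Nat.reduceEqDiff, if_false, if_true, e3]
      rw [sum_update_sub_one hi hQ1]
      omega

/-- The memory holds the negated labels on `B`, so the machine computes minus the label of `B`,
which is as good for a test for zero. -/
theorem sum_lab_residual {G : Net Γ} {B : Finset ℕ} (hB : B ⊆ range G.m) :
    ∑ e ∈ range G.m, (if e ∈ B then (G.flip B).lab e else 0) = - ∑ e ∈ B, G.lab e := by
  rw [← sum_filter, filter_mem_eq_inter, inter_eq_right.2 hB, ← sum_neg_distrib]
  exact sum_congr rfl fun e he => by simp [Net.flip, he]

/-- The flag and the output are correct for the sets with supplies `p` and demands `q`. -/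
def CoreCorrect (G : Net Γ) (V : ℕ) (p q : ℕ → ℕ) (s : State Γ) : Prop :=
  (s.nat 5 0 = 1 ∧ ∃ B, G.Completes V p q ∅ B ∧ (∀ e, s.nat 6 e = if e ∈ B then 1 else 0) ∧
      ∑ e ∈ B, G.lab e ≠ 0 ∧ ∀ B', G.Completes V p q ∅ B' → ∑ e ∈ B', G.lab e ≠ 0 →
        ∑ e ∈ B, G.c e ≤ ∑ e ∈ B', G.c e) ∨
    (s.nat 5 0 = 0 ∧ ∀ B', G.Completes V p q ∅ B' → ∑ e ∈ B', G.lab e = 0)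

/-- Net degrees vanish outside the vertices below `V`, so all feasible sets have the same net
degrees everywhere, as the exchange argument for the optimal set `B` requires. -/
theorem den_flipCycle {O : Oracle} {Vx mx : NExp} {s : State Γ} {G : Net Γ} {B : Finset ℕ}
    {V : ℕ} {p q : ℕ → ℕ} (hs : Sizes Vx mx V G.m s) (hG : G.EndsBelow V)
    (hB : G.Completes V p q ∅ B) (hR : Residual G B s) (hopt : G.Optimal B)
    (h0 : ∑ e ∈ B, G.lab e = 0) (h5 : s.nat 5 0 = 0) :
    CoreCorrect G V p q ((FProg.flipCycle Vx mx).den O s) := by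
  have hnet : ∀ B', G.Completes V p q ∅ B' → ∀ v, G.net B' v = G.net B v := fun B' hB' v => by
    by_cases hv : v < V
    · rw [hB'.2 v hv, hB.2 v hv]
    · rw [hG.net_eq_zero hB.1 (by omega), hG.net_eq_zero hB'.1 (by omega)]
  rw [FProg.flipCycle, den_seq]
  have hsel := den_search (O := O) (C := FProg.isNonzeroCycle) (Q := fun i t a => i = t ∧ a ≠ 0)
    hs hG hR
    (fun s' h3 h7 => by
      simp [FProg.isNonzeroCycle, Test.holds, NExp.eval, GExp.eval, ← le_antisymm_iff])
    (fun s t c h a b ha hb => by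
      simp only [h.1, true_and, ne_eq, not_not] at ha hb; rw [ha, hb])
  have hA := den_agree O (.search Vx mx FProg.isNonzeroCycle) s
  set s₁ := (FProg.search Vx mx FProg.isNonzeroCycle).den O s
  have hR1 : Residual G B s₁ := hR.congr (hA.nat 1 rfl) (hA.nat 2 rfl) (hA.nat 6 rfl)
    (hA.wt 0 rfl) (hA.grp 0 rfl)
  have e5 : s₁.nat 5 0 = 0 := by rw [hA.nat 5 rfl, h5]
  -- A walk with non-zero label has an arc, so its end is one of the vertices that the tables cover.
  have hlt : ∀ i l, (G.flip B).Walk i l i → (G.flip B).label l ≠ 0 → i < V := by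
    intro i l hl hne
    cases l with
    | nil => simp at hne
    | cons e l =>
      obtain ⟨h1, h2, -⟩ := hl
      exact h2 ▸ (hG.flip B e h1).2
  rcases hsel with ⟨h40, hW⟩ | ⟨h40, l, hl, hh, hlen, -, hmin⟩
  · rw [den_ite_neg (by simp [NExp.eval, h40])]
    refine .inr ⟨e5, fun B' hB' => ?_⟩
    by_contra hne
    obtain ⟨i, l, h1, h2, h3⟩ := hopt.exists_nonzero hB.1 h0 hB'.1 (hnet B' hB') hne
    have hi := hlt i l h1 h3
    have hmem : (i, i, l) ∈ (∅ : Set (ℕ × ℕ × List ℕ)) := by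
      rw [← hW]
      exact ⟨h1, hi, hi, h2, rfl, h3⟩
    exact hmem
  · rw [den_ite_pos (by simpa [NExp.eval] using h40), den_seq]
    obtain ⟨hwalk, hi, -, hle, heq, hne⟩ := hl
    simp only at hwalk hi hle heq hne
    rw [← heq] at hwalk
    obtain ⟨hn, hnet', hlab, hbest⟩ := hopt.nonzero hB.1 h0 hwalk hne (fun s' l' h1 h2 h3 =>
      hmin (s', s', l') ⟨h1, hlt _ _ h1 h2, hlt _ _ h1 h2, h3, rfl, h2⟩) hle
    have hR2 := den_flips (O := O) (hs.congr (hA.nat 0 rfl) (hA.nat 8 rfl)).evalm hR1 hh.traced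
      hlen hn hle
    refine .inl ⟨by simp [FProg.den, NExp.eval], symmDiff B l.toFinset,
      ⟨Net.symmDiff_subset_range hB.1 hwalk.toFinset_subset, fun v hv => ?_⟩, ?_, hlab,
      fun B' hB' => hbest B' hB'.1 (hnet B' hB')⟩
    · rw [hnet', hB.2 v hv]
    · simpa [FProg.den] using hR2.mem

/-- After `m` rounds a feasible instance has neither supply nor demand left. So a non-zero remainder
in the cell of the array `48` means that there is no feasible set, and otherwise `B` is a cheapest
one. -/
theorem den_core {O : Oracle} {Vx mx : NExp} {s : State Γ} {G : Net Γ} {V : ℕ}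
    (hs : Sizes Vx mx V G.m s) (hG : G.EndsBelow V) (hnet : s.net G.m = G)
    (h6 : ∀ e, s.nat 6 e = 0) (h5 : s.nat 5 0 = 0) (hopt : G.Optimal ∅)
    (hdisj : ∀ v < V, s.nat 3 v = 0 ∨ s.nat 7 v = 0) :
    CoreCorrect G V (s.nat 3) (s.nat 7) ((FProg.core Vx mx).den O s) := by
  have hstart : Progress G V (s.nat 3) (s.nat 7) 0 ∅ s :=
    ⟨by simp, ⟨by simpa [Net.flip] using hnet, by simpa using h6⟩, hopt, fun v _ => by
      simp [Net.net], hdisj, fun ⟨B', hB'⟩ => Net.sum_supply_le hG hdisj hB'⟩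
  have h1 := den_for (O := O) (s := s) (a := 47) (b := mx) (c := .augment Vx mx) G.m hs.evalm
    (fun j s' => ∃ B, Progress G V (s.nat 3) (s.nat 7) j B s')
    ⟨∅, hstart.congr rfl rfl rfl rfl rfl rfl rfl⟩ (by
      rintro k hk s' ⟨B, hB⟩ - hA
      obtain ⟨B', hB'⟩ := den_augment (O := O) (hs.congr (hA.nat 0 rfl) (hA.nat 8 rfl)) hG hB
      exact ⟨B', hB'.congr (by simp) (by simp) (by simp) (by simp) (by simp) (by simp) (by simp)⟩)
  have hA1 := den_agree O (.for_ 47 mx (.augment Vx mx)) s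
  rw [FProg.core, den_seq]
  set s₁ := (FProg.for_ 47 mx (.augment Vx mx)).den O s
  have hs1 : Sizes Vx mx V G.m s₁ := hs.congr (hA1.nat 0 rfl) (hA1.nat 8 rfl)
  have e5 : s₁.nat 5 0 = 0 := by rw [hA1.nat 5 rfl, h5]
  obtain ⟨B, hB⟩ := h1
  rw [den_seq, den_seq, den_seq, den_seq]
  simp only [FProg.den.eq_2, FProg.den.eq_3, NExp.eval, GExp.eval]
  have h2 := den_for (O := O) (s := s₁.setNat 48 0 0) (a := 49) (b := Vx) (c := .setNat 48
    (.const 0) (.add (.cell 48) (.add (.read 3 (.cell 49)) (.read 7 (.cell 49))))) V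
    (hs1.congr (by simp) (by simp)).evalV (fun k s' => s'.nat 48 0 =
      ∑ v ∈ range k, (s₁.nat 3 v + s₁.nat 7 v)) (by simp) (by
      intro k hk s' hI hk' hA
      have a3 := hA.nat 3 rfl
      have a7 := hA.nat 7 rfl
      simp only [State.nat_setNat, Nat.reduceEqDiff, if_false] at a3 a7
      simp [FProg.den, NExp.eval, hI, hk', a3, a7, sum_range_succ])
  have hA2 := den_agree O (.for_ 49 Vx (.setNat 48 (.const 0) (.add (.cell 48)
    (.add (.read 3 (.cell 49)) (.read 7 (.cell 49)))))) (s₁.setNat 48 0 0)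
  set s₂ := (FProg.for_ 49 Vx (.setNat 48 (.const 0) (.add (.cell 48)
    (.add (.read 3 (.cell 49)) (.read 7 (.cell 49)))))).den O (s₁.setNat 48 0 0)
  have hP2 : Progress G V (s.nat 3) (s.nat 7) G.m B s₂ := hB.congr (hA2.nat 1 rfl)
    (hA2.nat 2 rfl) (hA2.nat 3 rfl) (hA2.nat 6 rfl) (hA2.nat 7 rfl) (hA2.wt 0 rfl) (hA2.grp 0 rfl)
  have hs2 : Sizes Vx mx V G.m s₂ := hs1.congr (hA2.nat 0 rfl) (hA2.nat 8 rfl)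
  have e52 : s₂.nat 5 0 = 0 := by rw [hA2.nat 5 rfl]; simpa using e5
  have e3 : s₂.nat 3 = s₁.nat 3 := hA2.nat 3 rfl
  have e7 : s₂.nat 7 = s₁.nat 7 := hA2.nat 7 rfl
  have h3 := den_for (O := O) (s := s₂.setGrp 3 0 0) (a := 50) (b := mx) (c :=
    .ite (.ne0 (.read 6 (.cell 50)))
    (.setGrp 3 (.const 0) (.add (.read 3 (.const 0)) (.read 0 (.cell 50)))) .nop) G.m
    (hs2.congr (by simp) (by simp)).evalm (fun k s' => s'.grp 3 0 =
      ∑ e ∈ range k, (if e ∈ B then (G.flip B).lab e else 0)) (by simp) (by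
      intro k hk s' hI hk' hA
      have a6 : s'.nat 6 = s₂.nat 6 := hA.nat 6 rfl
      have ag : s'.grp 0 = (G.flip B).lab := (hA.grp 0 rfl).trans (congrArg Net.lab hP2.residual.net)
      have hmem := hP2.residual.mem k
      rw [sum_range_succ]
      by_cases hk6 : k ∈ B
      · rw [den_ite_pos (by simp [NExp.eval, hk', a6, hmem, hk6])]
        simp [FProg.den, GExp.eval, NExp.eval, hI, hk', ag, hk6]
      · rw [den_ite_neg (by simp [NExp.eval, hk', a6, hmem, hk6])]
        simp [FProg.den, hI, hk6])
  have hA3 := den_agree O (.for_ 50 mx (.ite (.ne0 (.read 6 (.cell 50)))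
    (.setGrp 3 (.const 0) (.add (.read 3 (.const 0)) (.read 0 (.cell 50)))) .nop))
    (s₂.setGrp 3 0 0)
  set s₃ := (FProg.for_ 50 mx (.ite (.ne0 (.read 6 (.cell 50)))
    (.setGrp 3 (.const 0) (.add (.read 3 (.const 0)) (.read 0 (.cell 50)))) .nop)).den O
    (s₂.setGrp 3 0 0)
  have hP3 : Progress G V (s.nat 3) (s.nat 7) G.m B s₃ := hP2.congr (hA3.nat 1 rfl)
    (hA3.nat 2 rfl) (hA3.nat 3 rfl) (hA3.nat 6 rfl) (hA3.nat 7 rfl) (hA3.wt 0 rfl) (hA3.grp 0 rfl)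
  have hs3 : Sizes Vx mx V G.m s₃ := hs2.congr (hA3.nat 0 rfl) (hA3.nat 8 rfl)
  have e53 : s₃.nat 5 0 = 0 := by rw [hA3.nat 5 rfl]; simpa using e52
  have g3 : s₃.nat 3 = s₁.nat 3 := (hA3.nat 3 rfl).trans e3
  have g7 : s₃.nat 7 = s₁.nat 7 := (hA3.nat 7 rfl).trans e7
  have e48 : s₃.nat 48 0 = ∑ v ∈ range V, s₃.nat 3 v + ∑ v ∈ range V, s₃.nat 7 v := by
    rw [hA3.nat 48 rfl, g3, g7, ← sum_add_distrib]; exact h2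
  rw [sum_lab_residual hB.subset] at h3
  by_cases hdone : s₃.nat 48 0 = 0
  · have hz3 : ∀ v < V, s₃.nat 3 v = 0 := fun v hv =>
      sum_eq_zero_iff.1 (show ∑ v ∈ range V, s₃.nat 3 v = 0 by omega) v (by simpa using hv)
    have hz7 : ∀ v < V, s₃.nat 7 v = 0 := fun v hv =>
      sum_eq_zero_iff.1 (show ∑ v ∈ range V, s₃.nat 7 v = 0 by omega) v (by simpa using hv)
    have hcomp : G.Completes V (s.nat 3) (s.nat 7) ∅ B := ⟨hB.subset, fun v hv => by
      have h4 := hP3.net v hv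
      rw [hz3 v hv, hz7 v hv] at h4
      have h5 : G.net ∅ v = 0 := by simp [Net.net]
      rw [h5]; push_cast at h4; linarith⟩
    rw [den_ite_neg (by simp [NExp.eval, hdone])]
    by_cases h0 : ∑ e ∈ B, G.lab e = 0
    · rw [den_ite_neg (by simp [Test.holds, GExp.eval, NExp.eval, h3, h0])]
      exact den_flipCycle hs3 hG hcomp hP3.residual hB.optimal h0 e53
    · rw [den_ite_pos (by simpa [Test.holds, GExp.eval, NExp.eval, h3] using h0)]
      refine .inl ⟨by simp [FProg.den, NExp.eval], B, hcomp,
        by simpa [FProg.den] using hP3.residual.mem, h0, fun B' hB' _ => ?_⟩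
      refine hB.optimal B' hB'.1 fun v => ?_
      by_cases hv : v < V
      · rw [hB'.2 v hv, hcomp.2 v hv]
      · rw [hG.net_eq_zero hB.subset (by omega), hG.net_eq_zero hB'.1 (by omega)]
  · rw [den_ite_pos (by simpa [NExp.eval] using hdone)]
    refine .inr ⟨e53, fun B' hB' => absurd ?_ hdone⟩
    have h4 : ∑ v ∈ range V, s₃.nat 3 v = 0 := by
      have := hP3.sum ⟨B', hB'⟩
      omega
    have h5 := Net.sum_demand_eq_zero hG hB.subset (hP3.completes hB') h4
    rw [e48, h4, h5]

end OracleRAM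

/-! ## Perfect matchings as flows -/

section bipartite

open Finset

variable {Γ : Type u} [AddCommGroup Γ] {p q m : ℕ} {left : Fin m → Fin p} {right : Fin m → Fin q}
  {bl : Fin p → ℕ} {br : Fin q → ℕ}

/-- The arcs of `G` are the edges of a bipartite graph, directed from the left to the right. -/
structure Net.IsBipartite (G : Net Γ) (left : Fin m → Fin p) (right : Fin m → Fin q) : Prop where
  arcs : G.m = m
  tl : ∀ e : Fin m, G.tl e = left e
  hd : ∀ e : Fin m, G.hd e = p + right e

variable {G : Net Γ}

theorem Net.IsBipartite.endsBelow (h : G.IsBipartite left right) : G.EndsBelow (p + q) := by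
  intro e he
  rw [h.arcs] at he
  have h1 := h.tl ⟨e, he⟩
  have h2 := h.hd ⟨e, he⟩
  have h3 := (left ⟨e, he⟩).2
  have h4 := (right ⟨e, he⟩).2
  simp only at h1 h2
  omega

theorem Net.IsBipartite.net_left (h : G.IsBipartite left right) (F : Finset (Fin m)) (v : Fin p) :
    G.net (F.map Fin.valEmbedding) v = (F.filter fun e => left e = v).card := by
  rw [Net.net, sum_map, card_filter]
  push_cast
  refine sum_congr rfl fun e _ => ?_
  have := v.2
  simp only [Net.chi, Fin.valEmbedding_apply, h.tl, h.hd, Fin.ext_iff]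
  rw [if_neg (show ¬ p + (right e : ℕ) = v by omega), sub_zero]

theorem Net.IsBipartite.net_right (h : G.IsBipartite left right) (F : Finset (Fin m))
    (v : Fin q) :
    G.net (F.map Fin.valEmbedding) (p + v) = - (F.filter fun e => right e = v).card := by
  rw [Net.net, sum_map, card_filter]
  push_cast
  rw [← sum_neg_distrib]
  refine sum_congr rfl fun e _ => ?_
  have := (left e).2
  simp only [Net.chi, Fin.valEmbedding_apply, h.tl, h.hd, Fin.ext_iff]
  rw [if_neg (show ¬ (left e : ℕ) = p + v by omega), zero_sub]
  simp

theorem exists_map_eq {B : Finset ℕ} (hB : B ⊆ range m) :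
    (univ.filter fun e : Fin m => (e : ℕ) ∈ B).map Fin.valEmbedding = B := by
  ext e
  simp only [mem_map, mem_filter, mem_univ, true_and, Fin.valEmbedding_apply]
  constructor
  · rintro ⟨e, he, rfl⟩; exact he
  · exact fun he => ⟨⟨e, by simpa using hB he⟩, he, rfl⟩

/-- All arcs leave left vertices, so the empty set is the only one with net degree zero at every
left vertex. This starts the augmentations although weights may be negative. -/
theorem Net.IsBipartite.optimal_empty (h : G.IsBipartite left right) : G.Optimal ∅ := by
  intro B' hB' hnet
  rw [h.arcs] at hB'
  suffices B' = ∅ by simp [this]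
  rw [← exists_map_eq hB'] at hnet ⊢
  set F := univ.filter fun e : Fin m => (e : ℕ) ∈ B'
  refine map_eq_empty.2 (eq_empty_of_forall_notMem fun e he => ?_)
  have h1 := hnet (left e)
  rw [h.net_left] at h1
  have h2 : (F.filter fun e' => left e' = left e).card = 0 := by
    have : G.net ∅ (left e) = 0 := by simp [Net.net]
    rw [this] at h1; exact_mod_cast h1
  have h3 : e ∈ F.filter fun e' => left e' = left e := by simp [he]
  simp [card_eq_zero.1 h2] at h3

/-- At a left vertex the net degree is the degree, at a right vertex minus the degree; prescribed
degrees are thus supplies on the left and demands on the right. -/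
theorem Net.IsBipartite.completes_iff (h : G.IsBipartite left right) {a b : ℕ → ℕ}
    (hal : ∀ v : Fin p, a v = bl v) (har : ∀ v : Fin q, a (p + v) = 0)
    (hbl : ∀ v : Fin p, b v = 0) (hbr : ∀ v : Fin q, b (p + v) = br v) (F : Finset (Fin m)) :
    G.Completes (p + q) a b ∅ (F.map Fin.valEmbedding) ↔ F ∈ perfectBMatchings left right bl br := by
  have h0 : ∀ v, G.net ∅ v = 0 := fun v => by simp [Net.net]
  constructor
  · rintro ⟨-, h1⟩
    refine ⟨fun v => ?_, fun v => ?_⟩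
    · have := h1 v (by omega)
      rw [h.net_left, h0, hal, hbl] at this
      push_cast at this
      omega
    · have := h1 (p + v) (by omega)
      rw [h.net_right, h0, har, hbr] at this
      push_cast at this
      omega
  · rintro ⟨h1, h2⟩
    refine ⟨fun e he => ?_, fun v hv => ?_⟩
    · simp only [mem_map, Fin.valEmbedding_apply] at he
      obtain ⟨e, -, rfl⟩ := he
      simp [h.arcs]
    · by_cases hvp : v < p
      · have h3 := h.net_left F ⟨v, hvp⟩
        have h4 := hal ⟨v, hvp⟩
        have h5 := hbl ⟨v, hvp⟩
        simp only at h3 h4 h5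
        rw [h3, h1, h0, h4, h5]; simp
      · obtain ⟨u, rfl⟩ := Nat.exists_eq_add_of_le (not_lt.1 hvp)
        have hu : u < q := by omega
        have h3 := h.net_right F ⟨u, hu⟩
        have h4 := har ⟨u, hu⟩
        have h5 := hbr ⟨u, hu⟩
        simp only at h3 h4 h5
        rw [h3, h2, h0, h4, h5]; simp

end bipartite

/-! ### The program for bipartite graphs -/

namespace OracleRAM

open Finset

variable {Γ : Type u} [AddCommGroup Γ] {p q m : ℕ}

/-- The memory holds a bipartite graph. -/
structure HoldsGraph (px qx mx : NExp) (left : Fin m → Fin p) (right : Fin m → Fin q)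
    (bl : Fin p → ℕ) (br : Fin q → ℕ) (ψ : Fin m → Γ) (w : Fin m → ℝ) (s : State Γ) : Prop where
  fixp : px.isFixed = true
  fixq : qx.isFixed = true
  fixm : mx.isFixed = true
  evalp : px.eval s = p
  evalq : qx.eval s = q
  evalm : mx.eval s = m
  left : ∀ e : Fin m, s.nat 1 e = left e
  right : ∀ e : Fin m, s.nat 2 e = right e
  bl : ∀ v : Fin p, s.nat 3 v = bl v
  bl_ge : ∀ v, p ≤ v → s.nat 3 v = 0
  br : ∀ v : Fin q, s.nat 4 v = br v
  flag : s.nat 5 0 = 0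
  out : ∀ e, s.nat 6 e = 0
  demand : ∀ v, s.nat 7 v = 0
  grp : ∀ e : Fin m, s.grp 0 e = ψ e
  wt : ∀ e : Fin m, s.wt 0 e = w e

namespace FProg

/-- Numbering the right vertices after the left ones. -/
def shift (px qx mx : NExp) : FProg :=
  setNat 8 (.const 0) (.add px qx) ;;
  for_ 51 mx (setNat 2 (.cell 51) (.add (.read 2 (.cell 51)) px)) ;;
  for_ 52 qx (setNat 7 (.add px (.cell 52)) (.read 4 (.cell 52)))

/-- Computing a cheapest non-zero perfect matching. -/
def solve (px qx mx : NExp) : FProg := shift px qx mx ;; core (.add px qx) mx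

end FProg

/-- The right vertex `v` becomes `p + v`, and its degree becomes a demand in the array `7`. The
array `3` of left degrees already has the form of supplies, because it is zero from `p` on. -/
theorem den_solve {O : Oracle} {px qx mx : NExp} {left : Fin m → Fin p} {right : Fin m → Fin q}
    {bl : Fin p → ℕ} {br : Fin q → ℕ} {ψ : Fin m → Γ} {w : Fin m → ℝ} {s : State Γ}
    (h : HoldsGraph px qx mx left right bl br ψ w s) :
    ((FProg.solve px qx mx).den O s).IsCorrectOutput (perfectBMatchings left right bl br) ψ w := by
  have hpx : ∀ s' : State Γ, s'.nat 0 = s.nat 0 → px.eval s' = p := fun s' hs' => by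
    rw [NExp.eval_congr h.fixp hs', h.evalp]
  have hqx : ∀ s' : State Γ, s'.nat 0 = s.nat 0 → qx.eval s' = q := fun s' hs' => by
    rw [NExp.eval_congr h.fixq hs', h.evalq]
  have hmx : ∀ s' : State Γ, s'.nat 0 = s.nat 0 → mx.eval s' = m := fun s' hs' => by
    rw [NExp.eval_congr h.fixm hs', h.evalm]
  rw [FProg.solve, den_seq]
  have hA := den_agree O (.shift px qx mx) s
  have hpost : (∀ e : Fin m, ((FProg.shift px qx mx).den O s).nat 2 e = p + right e) ∧
      (∀ v : Fin p, ((FProg.shift px qx mx).den O s).nat 7 v = 0) ∧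
      (∀ v : Fin q, ((FProg.shift px qx mx).den O s).nat 7 (p + v) = br v) ∧
      ((FProg.shift px qx mx).den O s).nat 8 0 = p + q := by
    rw [FProg.shift, den_seq, den_seq]
    simp only [FProg.den.eq_2, NExp.eval, h.evalp, h.evalq]
    have h1 := den_for (O := O) (s := s.setNat 8 0 (p + q)) (a := 51) (b := mx) (c :=
      .setNat 2 (.cell 51) (.add (.read 2 (.cell 51)) px)) m (hmx _ (by simp))
      (fun k s' => ∀ e : Fin m, s'.nat 2 e = if (e : ℕ) < k then p + right e else right e)
      (by simpa using h.right) (by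
        intro k hk s' hI hk' hA'
        have h0 : px.eval s' = p := hpx _ (by rw [hA'.nat 0 rfl]; simp)
        intro e
        have hIe := hI e
        simp only [FProg.den, NExp.eval, hk', h0, State.nat_setNat, Nat.reduceEqDiff, if_false,
          if_true, Function.update_apply]
        by_cases hek : (e : ℕ) = k
        · rw [hek] at hIe
          simp only [hek, if_true, hIe, lt_irrefl, if_false, Nat.lt_succ_self]; omega
        · rw [if_neg hek, hIe]
          by_cases h3 : (e : ℕ) < k
          · rw [if_pos h3, if_pos (by omega)]
          · rw [if_neg h3, if_neg (by omega)])
    have hA1 := den_agree O (.for_ 51 mx (.setNat 2 (.cell 51) (.add (.read 2 (.cell 51)) px)))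
      (s.setNat 8 0 (p + q))
    set s₁ := (FProg.for_ 51 mx (.setNat 2 (.cell 51) (.add (.read 2 (.cell 51)) px))).den O
      (s.setNat 8 0 (p + q))
    have e0 : s₁.nat 0 = s.nat 0 := by rw [hA1.nat 0 rfl]; simp
    have e4 : s₁.nat 4 = s.nat 4 := by rw [hA1.nat 4 rfl]; simp
    have e7 : s₁.nat 7 = s.nat 7 := by rw [hA1.nat 7 rfl]; simp
    have e8 : s₁.nat 8 0 = p + q := by rw [hA1.nat 8 rfl]; simp
    have h2 := den_for (O := O) (s := s₁) (a := 52) (b := qx) (c :=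
      .setNat 7 (.add px (.cell 52)) (.read 4 (.cell 52))) q (hqx _ e0)
      (fun k s' => (∀ v : Fin p, s'.nat 7 v = 0) ∧ ∀ v < k, s'.nat 7 (p + v) = s.nat 4 v)
      ⟨fun v => by simp [e7, h.demand], by simp⟩ (by
        intro k hk s' hI hk' hA'
        have h0 : px.eval s' = p := hpx _ ((hA'.nat 0 rfl).trans e0)
        have e4' : s'.nat 4 = s.nat 4 := (hA'.nat 4 rfl).trans e4
        simp only [FProg.den, NExp.eval, hk', h0, e4', State.nat_setNat, Nat.reduceEqDiff,
          if_false, if_true, Function.update_apply]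
        refine ⟨fun v => ?_, fun v hv => ?_⟩
        · rw [if_neg (by omega), hI.1]
        · rcases Nat.lt_succ_iff_lt_or_eq.1 hv with h3 | rfl
          · rw [if_neg (by omega), hI.2 v h3]
          · rw [if_pos rfl])
    have hA2 := den_agree O (.for_ 52 qx (.setNat 7 (.add px (.cell 52)) (.read 4 (.cell 52)))) s₁
    refine ⟨fun e => ?_, h2.1, fun v => ?_, ?_⟩
    · rw [hA2.nat 2 rfl, h1 e, if_pos e.2]
    · rw [h2.2 v v.2, h.br]
    · rw [hA2.nat 8 rfl, e8]
  obtain ⟨k2, k7, k7', k8⟩ := hpost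
  set s₁ := (FProg.shift px qx mx).den O s
  have e0 : s₁.nat 0 = s.nat 0 := hA.nat 0 rfl
  have e3 : s₁.nat 3 = s.nat 3 := hA.nat 3 rfl
  set G : Net Γ := s₁.net m with hG
  have hbip : G.IsBipartite left right := ⟨rfl, fun e => by
    rw [← h.left e, ← hA.nat 1 rfl]; rfl, k2⟩
  have hdisj : ∀ v < p + q, s₁.nat 3 v = 0 ∨ s₁.nat 7 v = 0 := by
    intro v hv
    by_cases hvp : v < p
    · exact .inr (k7 ⟨v, hvp⟩)
    · exact .inl (by rw [e3]; exact h.bl_ge v (by omega))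
  have hcore := den_core (O := O) (Vx := .add px qx) (mx := mx) (s := s₁) (G := G) (V := p + q)
    ⟨by simp [NExp.isFixed, h.fixp, h.fixq], h.fixm, by simp [NExp.eval, hpx _ e0, hqx _ e0],
      hmx _ e0, k8⟩ hbip.endsBelow rfl (by rw [hA.nat 6 rfl]; exact h.out)
    (by rw [hA.nat 5 rfl]; exact h.flag) hbip.optimal_empty hdisj
  have hiff := hbip.completes_iff (a := s₁.nat 3) (b := s₁.nat 7) (bl := bl) (br := br)
    (by rw [e3]; exact h.bl) (fun v => by rw [e3]; exact h.bl_ge _ (by omega)) k7 k7'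
  have hlab : ∀ F : Finset (Fin m), ∑ e ∈ F.map Fin.valEmbedding, G.lab e = ∑ e ∈ F, ψ e := by
    intro F
    rw [sum_map]
    refine sum_congr rfl fun e _ => ?_
    rw [← h.grp e, ← hA.grp 0 rfl]; rfl
  have hc : ∀ F : Finset (Fin m), ∑ e ∈ F.map Fin.valEmbedding, G.c e = ∑ e ∈ F, w e := by
    intro F
    rw [sum_map]
    refine sum_congr rfl fun e _ => ?_
    rw [← h.wt e, ← hA.wt 0 rfl]; rfl
  rcases hcore with ⟨h5, B, hB, h6, hne, hmin⟩ | ⟨h5, hall⟩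
  · refine .inl ⟨h5, ?_⟩
    have hout : State.outputSet ((FProg.core (.add px qx) mx).den O s₁) m =
        univ.filter fun e : Fin m => (e : ℕ) ∈ B := by
      ext e; simp [State.outputSet, h6]
    have hmap := exists_map_eq (m := m) hB.1
    rw [hout]
    set F := univ.filter fun e : Fin m => (e : ℕ) ∈ B
    rw [← hmap, hiff] at hB
    rw [← hmap, hlab] at hne
    refine ⟨⟨hB, hne⟩, fun F' hF' hne' => ?_⟩
    have := hmin _ ((hiff F').2 hF') (by rwa [hlab])
    rwa [← hmap, hc, hc] at this
  · refine .inr ⟨h5, fun F hF => ?_⟩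
    rw [← hlab]
    exact hall _ ((hiff F).2 hF)

/-- The second part of the main theorem. -/
theorem exists_graph_program : ∃ (P : Prog) (f : Polynomial ℕ),
    ∀ (Γ : Type u) [AddCommGroup Γ] (p q m : ℕ) (left : Fin m → Fin p) (right : Fin m → Fin q)
      (bl : Fin p → ℕ) (br : Fin q → ℕ) (ψ : Fin m → Γ) (w : Fin m → ℝ),
      HaltsWithin trivialOracle P (graphInput left right bl br ψ w) (f.eval (p + q + m))
        (State.IsCorrectOutput (perfectBMatchings left right bl br) ψ w) := by
  -- The polynomial is the `time` of the program, and `p + q + m` bounds all cells of the array `0`.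
  -- Well-formedness and not writing that array are decided by computation.
  refine ⟨(FProg.solve (.read 0 (.const 0)) (.read 0 (.const 1)) (.read 0 (.const 2))).compile, _,
    fun Γ _ p q m left right bl br ψ w => haltsWithin_compile rfl rfl (fun i => ?_)
      (den_solve ?_)⟩
  · simp only [graphInput]; split_ifs <;> omega
  · constructor <;> first | rfl | (intro e; simp [graphInput, pad])
    intro he
    simp [show ¬ e < p by omega]

end OracleRAM

/-! ## Bases of partition matroids -/

section capacities

open Finset

variable {κ cap : ℕ → ℕ} {n g f e : ℕ} {B F I J : Finset ℕ}

/-- The set `I` contains at most `cap j` elements of every class `j`. -/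
def CapIndep (κ cap : ℕ → ℕ) (I : Finset ℕ) : Prop :=
  ∀ j, (I.filter fun e => κ e = j).card ≤ cap j

/-- A maximal set that respects the capacities. -/
structure CapBase (κ cap : ℕ → ℕ) (n : ℕ) (B : Finset ℕ) : Prop where
  subset : B ⊆ range n
  indep : CapIndep κ cap B
  max : ∀ e < n, e ∉ B → ¬ CapIndep κ cap (insert e B)

theorem CapIndep.mono (h : CapIndep κ cap J) (hIJ : I ⊆ J) : CapIndep κ cap I := fun j =>
  (card_le_card (filter_subset_filter _ hIJ)).trans (h j)

theorem card_filter_insert (he : e ∉ I) (j : ℕ) :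
    ((insert e I).filter fun e => κ e = j).card =
      (I.filter fun e => κ e = j).card + if κ e = j then 1 else 0 := by
  rw [filter_insert]
  split_ifs
  · rw [card_insert_of_notMem (by simp [he])]
  · rfl

theorem capIndep_insert (hI : CapIndep κ cap I) (he : e ∉ I) :
    CapIndep κ cap (insert e I) ↔ (I.filter fun x => κ x = κ e).card < cap (κ e) := by
  constructor
  · intro h
    have := h (κ e)
    rw [card_filter_insert he, if_pos rfl] at this
    omega
  · intro h j
    rw [card_filter_insert he]
    have := hI j
    split_ifs with hj
    · subst hj; omega
    · omega

/-- The class of `g` is full in `B`, because `g` cannot be added. Removing `f` makes room for `g`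
exactly if it frees a place in that class. -/
theorem CapBase.swap_iff (hB : CapBase κ cap n B) (hg : g < n) (hgB : g ∉ B) (hf : f ∈ B) :
    CapIndep κ cap (insert g (B.erase f)) ↔ κ f = κ g := by
  have h1 := hB.max g hg hgB
  rw [capIndep_insert hB.indep hgB] at h1
  have h2 := hB.indep (κ g)
  have hgE : g ∉ B.erase f := fun h => hgB (mem_of_mem_erase h)
  rw [capIndep_insert (hB.indep.mono (erase_subset _ _)) hgE]
  have h3 := card_filter_insert (κ := κ) (notMem_erase f B) (κ g)
  rw [insert_erase hf] at h3
  constructor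
  · intro h; by_contra hc; rw [if_neg hc] at h3; omega
  · intro h; rw [if_pos h] at h3; omega

/-- If one base had more elements of a class than another, one of them could be added to the latter.
So the class sizes determine the bases. -/
theorem CapBase.iff_card (hB : CapBase κ cap n B) (hF : F ⊆ range n) :
    CapBase κ cap n F ↔
      ∀ j, (F.filter fun e => κ e = j).card = (B.filter fun e => κ e = j).card := by
  have key : ∀ {B F : Finset ℕ}, CapBase κ cap n B → CapBase κ cap n F → ∀ j,
      (F.filter fun e => κ e = j).card ≤ (B.filter fun e => κ e = j).card := by
    intro B F hB hF j
    by_contra hc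
    obtain ⟨e, heF, heB⟩ : ∃ e ∈ F.filter fun e => κ e = j, e ∉ B.filter fun e => κ e = j := by
      by_contra! h; exact hc (card_le_card h)
    simp only [mem_filter, not_and] at heF heB
    obtain ⟨heF, rfl⟩ := heF
    have heB' : e ∉ B := fun h => heB h rfl
    have h1 := hB.max e (by simpa using hF.subset heF) heB'
    rw [capIndep_insert hB.indep heB'] at h1
    have := hF.indep (κ e)
    omega
  constructor
  · exact fun h j => (key hB h j).antisymm (key h hB j)
  · refine fun h => ⟨hF, fun j => h j ▸ hB.indep j, fun e he heF hi => ?_⟩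
    have hFi : CapIndep κ cap F := fun j => h j ▸ hB.indep j
    rw [capIndep_insert hFi heF, h] at hi
    -- If `F` had room in the class of `e`, so would `B`; being maximal, `B` then contains the whole
    -- class, and `F` with `e` added could not have more elements in it.
    have hsub : ((range n).filter fun x => κ x = κ e) ⊆ B.filter fun x => κ x = κ e := by
      intro x hx
      simp only [mem_filter, mem_range] at hx ⊢
      refine ⟨?_, hx.2⟩
      by_contra hxB
      refine hB.max x hx.1 hxB ?_
      rw [capIndep_insert hB.indep hxB, hx.2]
      exact hi
    have h1 : (insert e F).filter (fun x => κ x = κ e) ⊆ B.filter fun x => κ x = κ e := by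
      refine Subset.trans (filter_subset_filter _ ?_) hsub
      exact insert_subset (by simpa using he) hF
    have h2 := card_le_card h1
    rw [card_filter_insert heF, if_pos rfl, h] at h2
    omega

/-- Bases are described by finer classes, as long as a class is not divided unless it is contained
in the base or disjoint from it. -/
theorem CapBase.iff_card_of_refine (hB : CapBase κ cap n B) (hF : F ⊆ range n) {R : ℕ → ℕ}
    (hRn : ∀ e < n, R e < n) (hR : ∀ e < n, ∀ e' < n, R e = R e' → κ e = κ e')
    (hmix : ∀ g < n, g ∉ B → ∀ f ∈ B, κ f = κ g → ∀ e < n, ∀ e' < n, κ e = κ g → κ e' = κ g →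
      R e = R e') :
    CapBase κ cap n F ↔
      ∀ v < n, (F.filter fun e => R e = v).card = (B.filter fun e => R e = v).card := by
  have hBn := hB.subset
  rw [hB.iff_card hF]
  constructor
  · intro h v _
    by_cases hv : ∃ e₀ < n, R e₀ = v
    · obtain ⟨e₀, he₀, rfl⟩ := hv
      have h0 := h (κ e₀)
      -- Three kinds of classes: those meeting `B` and its complement are not divided; on those
      -- disjoint from `B` both counts are zero; on those contained in `B` the sets `F` and `B`
      -- coincide.
      by_cases hm : ∃ g < n, g ∉ B ∧ κ g = κ e₀
      · obtain ⟨g, hg, hgB, hge⟩ := hm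
        by_cases hm' : ∃ f ∈ B, κ f = κ e₀
        · obtain ⟨f, hf, hfe⟩ := hm'
          have hiff : ∀ e < n, R e = R e₀ ↔ κ e = κ e₀ := fun e he => ⟨hR e he e₀ he₀, fun hk =>
            hmix g hg hgB f hf (by rw [hfe, hge]) e he e₀ he₀ (by rw [hk, hge]) (by rw [hge])⟩
          rw [filter_congr fun e he => hiff e (by simpa using hF he),
            filter_congr fun e he => hiff e (by simpa using hBn he), h0]
        · push Not at hm'
          have hBe : B.filter (fun e => κ e = κ e₀) = ∅ := filter_eq_empty_iff.2 fun e he => hm' e he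
          rw [hBe, card_empty, card_eq_zero, filter_eq_empty_iff] at h0
          rw [filter_eq_empty_iff.2 fun e he hre => h0 he (hR _ (by simpa using hF he) _ he₀ hre),
            filter_eq_empty_iff.2 fun e he hre => hm' e he (hR _ (by simpa using hBn he) _ he₀ hre)]
      · push Not at hm
        have hsub : F.filter (fun e => κ e = κ e₀) ⊆ B.filter fun e => κ e = κ e₀ := by
          intro e he
          simp only [mem_filter] at he ⊢
          refine ⟨?_, he.2⟩
          by_contra heB
          exact hm e (by simpa using hF he.1) heB he.2
        have heq := eq_of_subset_of_card_le hsub h0.ge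
        congr 1
        ext e
        simp only [mem_filter]
        have h2 := Finset.ext_iff.1 heq e
        simp only [mem_filter] at h2
        constructor
        · rintro ⟨he, hre⟩
          exact ⟨(h2.1 ⟨he, hR _ (by simpa using hF he) _ he₀ hre⟩).1, hre⟩
        · rintro ⟨he, hre⟩
          exact ⟨(h2.2 ⟨he, hR _ (by simpa using hBn he) _ he₀ hre⟩).1, hre⟩
    · push Not at hv
      rw [filter_eq_empty_iff.2 fun e he => hv e (by simpa using hF he),
        filter_eq_empty_iff.2 fun e he => hv e (by simpa using hBn he)]
  · intro h j
    -- A class is the disjoint union of its finer classes, so its count is the sum of theirs.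
    have key : ∀ F : Finset ℕ, F ⊆ range n → (F.filter fun e => κ e = j).card =
        ∑ v ∈ range n, if ∃ e < n, κ e = j ∧ R e = v then (F.filter fun e => R e = v).card
          else 0 := by
      intro F hF
      rw [card_eq_sum_card_fiberwise (f := R) (t := range n) fun e he => by
        have := hF (mem_filter.1 he).1
        simpa using hRn e (by simpa using this)]
      refine sum_congr rfl fun v _ => ?_
      rw [filter_filter]
      split_ifs with hv
      · obtain ⟨e₀, he₀, rfl, rfl⟩ := hv
        rw [filter_congr fun e he => and_iff_right_of_imp (hR e (by simpa using hF he) e₀ he₀)]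
      · rw [card_eq_zero, filter_eq_empty_iff]
        rintro e he ⟨h1, h2⟩
        exact hv ⟨e, by simpa using hF he, h1, h2⟩
    rw [key F hF, key B hBn]
    refine sum_congr rfl fun v hv => ?_
    rw [h v (by simpa using hv)]

/-- The class of an element is the index of the summand that contains it, and the capacity is the
rank of the summand; indices from `r` on have no elements and get capacity `0`. -/
theorem IsPartitionMatroid.exists_capacities {n : ℕ} {M : Matroid (Fin n)}
    (hM : IsPartitionMatroid M) (hE : M.E = Set.univ) :
    ∃ κ cap : ℕ → ℕ, ∀ I : Finset (Fin n),
      M.Indep (I : Set (Fin n)) ↔ CapIndep κ cap (I.map Fin.valEmbedding) := by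
  obtain ⟨r, N, h, hN, rfl⟩ := hM
  choose k hk using hN
  rw [Matroid.disjointSigma_ground_eq] at hE
  have hex : ∀ e : Fin n, ∃ j, e ∈ (N j).E := fun e => by
    have : e ∈ ⋃ i, (N i).E := by rw [hE]; trivial
    simpa using this
  choose c hc using hex
  have hciff : ∀ e j, e ∈ (N j).E ↔ c e = j := by
    refine fun e j => ⟨fun hj => ?_, fun hj => hj ▸ hc e⟩
    by_contra hne
    exact Set.disjoint_left.1 (h hne) (hc e) hj
  refine ⟨fun e => if he : e < n then c ⟨e, he⟩ else 0, fun j => if hj : j < r then k ⟨j, hj⟩ else 0,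
    fun I => ?_⟩
  have hcard : ∀ j : Fin r, ((I : Set (Fin n)) ∩ (N j).E).encard =
      ((I.map Fin.valEmbedding).filter
        fun e => (if he : e < n then (c ⟨e, he⟩ : ℕ) else 0) = j).card := by
    intro j
    rw [filter_map, card_map, ← Set.encard_coe_eq_coe_finsetCard]
    congr 1
    ext e
    simp [hciff, Fin.ext_iff]
  rw [Matroid.disjointSigma_indep_iff, hE, and_iff_left (Set.subset_univ _)]
  simp only [hk, Set.inter_subset_right, true_and, hcard, Nat.cast_le]
  constructor
  · intro h1 j
    by_cases hj : j < r
    · simpa [hj] using h1 ⟨j, hj⟩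
    · rw [card_eq_zero.2]
      · exact Nat.zero_le _
      · rw [filter_eq_empty_iff]
        intro e he
        obtain ⟨e, -, rfl⟩ := mem_map.1 he
        simp only [Fin.valEmbedding_apply, e.2, dif_pos]
        have := (c e).2
        simp only [Fin.eta]
        omega
  · intro h1 j
    have := h1 j
    simpa using this

theorem isBase_iff_capBase {n : ℕ} {M : Matroid (Fin n)} (hE : M.E = Set.univ)
    (h : ∀ I : Finset (Fin n), M.Indep (I : Set (Fin n)) ↔ CapIndep κ cap (I.map Fin.valEmbedding))
    (F : Finset (Fin n)) : M.IsBase (F : Set (Fin n)) ↔ CapBase κ cap n (F.map Fin.valEmbedding) := by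
  have hins : ∀ e : Fin n, e ∉ F → (M.Indep (insert e (F : Set (Fin n))) ↔
      CapIndep κ cap (insert (e : ℕ) (F.map Fin.valEmbedding))) := fun e _ => by
    rw [← coe_insert, h, map_insert]; rfl
  constructor
  · intro hF
    refine ⟨fun e he => ?_, (h F).1 hF.indep, fun e he heF hi => ?_⟩
    · obtain ⟨e, -, rfl⟩ := mem_map.1 he
      simp
    · have heF' : (⟨e, he⟩ : Fin n) ∉ F := fun h' =>
        heF (mem_map.2 ⟨_, h', rfl⟩)
      exact hF.insert_dep ⟨by simp [hE], by simpa using heF'⟩ |>.not_indep ((hins _ heF').2 hi)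
  · rintro ⟨-, h1, h2⟩
    refine ((h F).2 h1).isBase_of_forall_insert fun e he hi => ?_
    have heF : e ∉ F := by simpa using he.2
    refine h2 e e.2 ?_ ((hins e heF).1 hi)
    simpa [Fin.val_inj] using heF

end capacities

/-! ## Computing the classes of a partition matroid -/

/-- The characteristic vector of a set. -/
def charVec (B : Finset ℕ) (e : ℕ) : ℕ := if e ∈ B then 1 else 0

theorem charVec_ne_zero {B : Finset ℕ} {e : ℕ} : charVec B e ≠ 0 ↔ e ∈ B := by simp [charVec]

theorem update_charVec_one (B : Finset ℕ) (e : ℕ) :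
    Function.update (charVec B) e 1 = charVec (insert e B) := by
  funext x; by_cases hx : x = e <;> simp [charVec, hx]

theorem update_charVec_zero (B : Finset ℕ) (e : ℕ) :
    Function.update (charVec B) e 0 = charVec (B.erase e) := by
  funext x; by_cases hx : x = e <;> simp [charVec, hx]

namespace OracleRAM

open Finset

variable {Γ : Type u} [AddCommGroup Γ]

namespace FProg

/-- The size of the ground set. -/
def size : NExp := .read 0 (.const 0)

/-- Computing a base. -/
def greedy (k : Fin 2) : FProg :=
  for_ 53 size (setNat 60 (.cell 53) (.const 0)) ;;
  for_ 53 size (setNat 60 (.cell 53) (.const 1) ;;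
    ite (.indep k 60) nop (setNat 60 (.cell 53) (.const 0)))

/-- Testing whether the element in the cell `54` of the base can be replaced by that in `53`. -/
def swapTest (k : Fin 2) : FProg :=
  setNat 60 (.cell 54) (.const 0) ;;
  setNat 60 (.cell 53) (.const 1) ;;
  ite (.indep k 60) (setNat 61 (.const 0) (.const 1)) (setNat 61 (.const 0) (.const 0)) ;;
  setNat 60 (.cell 54) (.const 1) ;;
  setNat 60 (.cell 53) (.const 0)

/-- Writing `x` to the cell `i` of the array `62` for every possible exchange. -/
def swapLoop (k : Fin 2) (i x : NExp) : FProg :=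
  for_ 53 size (ite (.ne0 (.read 60 (.cell 53))) nop
    (for_ 54 size (ite (.ne0 (.read 60 (.cell 54)))
      (swapTest k ;; ite (.ne0 (.cell 61)) (setNat 62 i x) nop) nop)))

/-- Computing representatives of the classes and the number of elements of the base for each. -/
def classes (k : Fin 2) : FProg :=
  greedy k ;;
  for_ 53 size (setNat 62 (.cell 53) (.cell 53)) ;;
  swapLoop k (.cell 53) (.cell 54) ;;
  swapLoop k (.cell 54) (.read 62 (.cell 53)) ;;
  for_ 53 size (setNat 63 (.cell 53) (.const 0)) ;;
  for_ 53 size (ite (.ne0 (.read 60 (.cell 53)))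
    (setNat 63 (.read 62 (.cell 53)) (.add (.read 63 (.read 62 (.cell 53))) (.const 1))) nop)

/-- Copying the first cells of the array `a` to the array `b`. -/
def copy (a b : ℕ) : FProg := for_ 53 size (setNat b (.cell 53) (.read a (.cell 53)))

end FProg

/-- The oracle `k` answers queries according to the capacities. -/
def OracleFor (O : Oracle) (k : Fin 2) (κ cap : ℕ → ℕ) (n : ℕ) : Prop :=
  ∀ B ⊆ range n, O k (charVec B) ↔ CapIndep κ cap B

variable {O : Oracle} {k : Fin 2} {κ cap : ℕ → ℕ} {n : ℕ} {s : State Γ} {B : Finset ℕ}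

/-- A rejected element stays rejected, since independence passes to subsets. The cells from `n` on
have to be zero for the array `60` to be a characteristic vector. -/
theorem den_greedy (hO : OracleFor O k κ cap n) (hn : s.nat 0 0 = n)
    (h60 : ∀ e, n ≤ e → s.nat 60 e = 0) :
    ∃ B, CapBase κ cap n B ∧ ((FProg.greedy k).den O s).nat 60 = charVec B := by
  have h1 := den_for (O := O) (s := s) (a := 53) (b := FProg.size)
    (c := .setNat 60 (.cell 53) (.const 0)) n (by simp [FProg.size, NExp.eval, hn])
    (fun j s' => ∀ e, e < j ∨ n ≤ e → s'.nat 60 e = 0) (by simpa using h60) (by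
      intro j hj s' hI hj' hA e he
      simp only [FProg.den, NExp.eval, hj', State.nat_setNat, Nat.reduceEqDiff, if_false, if_true,
        Function.update_apply]
      split_ifs with h
      · rfl
      · exact hI e (by omega))
  have hA1 := den_agree O (.for_ 53 FProg.size (.setNat 60 (.cell 53) (.const 0))) s
  rw [FProg.greedy, den_seq]
  set s₁ := (FProg.for_ 53 FProg.size (.setNat 60 (.cell 53) (.const 0))).den O s
  have hn1 : s₁.nat 0 0 = n := by rw [hA1.nat 0 rfl, hn]
  have h2 := den_for (O := O) (s := s₁) (a := 53) (b := FProg.size) (c :=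
    .setNat 60 (.cell 53) (.const 1) ;; .ite (.indep k 60) .nop (.setNat 60 (.cell 53) (.const 0)))
    n (by simp [FProg.size, NExp.eval, hn1])
    (fun j s' => ∃ B ⊆ range j, s'.nat 60 = charVec B ∧ CapIndep κ cap B ∧
      ∀ e < j, e ∉ B → ¬ CapIndep κ cap (insert e B))
    ⟨∅, by simp, by
      funext e; simpa [charVec] using h1 e (by omega), by simp [CapIndep], by simp⟩ (by
      rintro j hj s' ⟨B, hB, hBs, hBi, hmax⟩ hj' hA
      have hjB : j ∉ B := fun h => by simpa using hB h
      have hsub : insert j B ⊆ range n := insert_subset (by simpa using hj)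
        (hB.trans (range_subset_range.2 hj.le))
      rw [den_seq]
      simp only [FProg.den.eq_2, NExp.eval, hj']
      have h60 : (s'.setNat 60 j 1).nat 60 = charVec (insert j B) := by
        simp [hBs, update_charVec_one]
      by_cases hi : CapIndep κ cap (insert j B)
      · rw [den_ite_pos (by simp only [Test.holds, h60]; exact (hO _ hsub).2 hi)]
        refine ⟨insert j B, ?_, by simpa [FProg.den] using h60, hi, fun e he heB hi' => ?_⟩
        · rw [range_add_one]; exact insert_subset_insert _ hB
        · simp only [mem_insert, not_or] at heB
          exact hmax e (by omega) heB.2 (hi'.mono (insert_subset_insert _ (subset_insert _ _)))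
      · rw [den_ite_neg (by simp only [Test.holds, h60]; exact fun h => hi ((hO _ hsub).1 h))]
        refine ⟨B, hB.trans (range_subset_range.2 (by omega)), ?_, hBi, fun e he heB => ?_⟩
        · simp [FProg.den, NExp.eval, hj', hBs, update_charVec_zero, update_charVec_one,
            erase_insert hjB]
        · rcases Nat.lt_succ_iff_lt_or_eq.1 he with h | rfl
          exacts [hmax e h heB, hi])
  obtain ⟨B, hB, hBs, hBi, hmax⟩ := h2
  exact ⟨B, ⟨hB, hBi, hmax⟩, hBs⟩

theorem den_swapTest {g f : ℕ} (hO : OracleFor O k κ cap n) (hB : CapBase κ cap n B)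
    (h60 : s.nat 60 = charVec B) (h53 : s.nat 53 0 = g) (h54 : s.nat 54 0 = f) (hg : g < n)
    (hgB : g ∉ B) (hf : f ∈ B) :
    ((FProg.swapTest k).den O s).nat 60 = charVec B ∧
      (((FProg.swapTest k).den O s).nat 61 0 ≠ 0 ↔ κ f = κ g) := by
  have hgf : g ≠ f := fun h => hgB (h ▸ hf)
  have hsub : insert g (B.erase f) ⊆ range n :=
    insert_subset (by simpa using hg) ((erase_subset _ _).trans hB.subset)
  have hiff := (hO _ hsub).trans (hB.swap_iff hg hgB hf)
  rw [FProg.swapTest, den_seq, den_seq, den_seq, den_seq]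
  simp only [FProg.den.eq_2, NExp.eval, h54, State.nat_setNat, Nat.reduceEqDiff, if_false, h53]
  set s₁ := (s.setNat 60 f 0).setNat 60 g 1 with hs₁
  have e60 : s₁.nat 60 = charVec (insert g (B.erase f)) := by
    simp [hs₁, h60, update_charVec_zero, update_charVec_one]
  have e53 : s₁.nat 53 0 = g := by simpa [hs₁] using h53
  have e54 : s₁.nat 54 0 = f := by simpa [hs₁] using h54
  have hset : (insert f (insert g (B.erase f))).erase g = B := by
    ext x; simp only [mem_erase, mem_insert]; grind
  by_cases hk : κ f = κ g
  · rw [den_ite_pos (by simp only [Test.holds, e60]; exact hiff.2 hk)]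
    simp [FProg.den, NExp.eval, e53, e54, e60, update_charVec_one, update_charVec_zero, hset, hk]
  · rw [den_ite_neg (by simp only [Test.holds, e60]; exact fun h => hk (hiff.1 h))]
    simp [FProg.den, NExp.eval, e53, e54, e60, update_charVec_one, update_charVec_zero, hset, hk]

/-- An invariant rule for both uses of the loop: `Inv g f R` holds when the outer counter is `g`,
the inner one is `f` and the array `62` is `R`. Tests restore the array `60`, so the base is the
same throughout. -/
theorem den_swapLoop {i x : NExp} {φ ξ : ℕ → ℕ → (ℕ → ℕ) → ℕ} (hO : OracleFor O k κ cap n)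
    (hB : CapBase κ cap n B) (hn : s.nat 0 0 = n) (h60 : s.nat 60 = charVec B)
    (hi : ∀ s' : State Γ, i.eval s' = φ (s'.nat 53 0) (s'.nat 54 0) (s'.nat 62))
    (hx : ∀ s' : State Γ, x.eval s' = ξ (s'.nat 53 0) (s'.nat 54 0) (s'.nat 62))
    (Inv : ℕ → ℕ → (ℕ → ℕ) → Prop) (h0 : Inv 0 0 (s.nat 62))
    (hswap : ∀ g < n, ∀ f < n, ∀ R, g ∉ B → f ∈ B → κ f = κ g → Inv g f R →
      Inv g (f + 1) (Function.update R (φ g f R) (ξ g f R)))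
    (hskip : ∀ g < n, ∀ f < n, ∀ R, ¬ (g ∉ B ∧ f ∈ B ∧ κ f = κ g) → Inv g f R → Inv g (f + 1) R)
    (hnext : ∀ g < n, ∀ R, Inv g n R → Inv (g + 1) 0 R) :
    Inv n 0 (((FProg.swapLoop k i x).den O s).nat 62) ∧
      ((FProg.swapLoop k i x).den O s).nat 60 = charVec B := by
  refine den_for (O := O) (s := s) (a := 53) (b := FProg.size) n
    (by simp [FProg.size, NExp.eval, hn])
    (fun g s' => Inv g 0 (s'.nat 62) ∧ s'.nat 60 = charVec B) ⟨by simpa using h0, by simpa using h60⟩ ?_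
  rintro g hg s' ⟨hI, h60'⟩ hg' hA
  have hn' : s'.nat 0 0 = n := by rw [hA.nat 0 rfl, hn]
  by_cases hgB : g ∈ B
  · rw [den_ite_pos (by simpa [NExp.eval, hg', h60'] using charVec_ne_zero.2 hgB)]
    refine ⟨hnext g hg _ ?_, by simpa [FProg.den] using h60'⟩
    have : ∀ f ≤ n, Inv g f (s'.nat 62) := by
      intro f
      induction f with
      | zero => exact fun _ => hI
      | succ f ih => exact fun hf => hskip g hg f hf _ (by simp [hgB]) (ih (by omega))
    simpa [FProg.den] using this n le_rfl
  · rw [den_ite_neg (by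
      simpa [NExp.eval, hg', h60'] using not_not.1 (mt charVec_ne_zero.1 hgB))]
    have h1 := den_for (O := O) (s := s') (a := 54) (b := FProg.size) (c := 
      .ite (.ne0 (.read 60 (.cell 54)))
        (.swapTest k ;; .ite (.ne0 (.cell 61)) (.setNat 62 i x) .nop) .nop) n
      (by simp [FProg.size, NExp.eval, hn'])
      (fun f s'' => Inv g f (s''.nat 62) ∧ s''.nat 60 = charVec B)
      ⟨by simpa using hI, by simpa using h60'⟩ (by
        rintro f hf s'' ⟨hJ, h60''⟩ hf' hA'
        have h53 : s''.nat 53 0 = g := by rw [hA'.nat 53 rfl, hg']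
        by_cases hfB : f ∈ B
        · rw [den_ite_pos (by simpa [NExp.eval, hf', h60''] using charVec_ne_zero.2 hfB), den_seq]
          obtain ⟨h2, h3⟩ := den_swapTest (k := k) hO hB h60'' h53 hf' hg hgB hfB
          have hA2 := den_agree O (.swapTest k) s''
          set s₃ := (FProg.swapTest k).den O s''
          have e53 : s₃.nat 53 0 = g := by rw [hA2.nat 53 rfl, h53]
          have e54 : s₃.nat 54 0 = f := by rw [hA2.nat 54 rfl, hf']
          have e62 : s₃.nat 62 = s''.nat 62 := hA2.nat 62 rfl
          by_cases hk : κ f = κ g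
          · rw [den_ite_pos (by simpa [NExp.eval] using h3.2 hk)]
            have h4 := hswap g hg f hf _ hgB hfB hk hJ
            simpa [FProg.den, hi, hx, e53, e54, e62, h2] using h4
          · rw [den_ite_neg (by simpa [NExp.eval] using not_not.1 (mt h3.1 hk))]
            have h4 := hskip g hg f hf _ (fun h => hk h.2.2) hJ
            simpa [FProg.den, e62, h2] using h4
        · rw [den_ite_neg (by
            simpa [NExp.eval, hf', h60''] using not_not.1 (mt charVec_ne_zero.1 hfB))]
          have h4 := hskip g hg f hf _ (fun h => hfB h.2.1) hJ
          simpa [FProg.den, h60''] using h4)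
    exact ⟨by simpa using hnext g hg _ h1.1, by simpa using h1.2⟩

/-- The last element of the base in the class `j`. -/
def IsLast (κ : ℕ → ℕ) (B : Finset ℕ) (j x : ℕ) : Prop :=
  x ∈ B ∧ κ x = j ∧ ∀ f ∈ B, κ f = j → f ≤ x

theorem IsLast.unique {j x y : ℕ} (hx : IsLast κ B j x) (hy : IsLast κ B j y) : x = y :=
  le_antisymm (hy.2.2 x hx.1 hx.2.1) (hx.2.2 y hy.1 hy.2.1)

/-- For fixed `g` the candidates `f` come in increasing order and each overwrites the entry of `g`,
so the last base element of the class of `g` remains. -/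
theorem den_firstSwapLoop (hO : OracleFor O k κ cap n) (hB : CapBase κ cap n B)
    (hn : s.nat 0 0 = n) (h60 : s.nat 60 = charVec B) (h62 : ∀ e < n, s.nat 62 e = e) :
    (∀ e < n, (e ∈ B → ((FProg.swapLoop k (.cell 53) (.cell 54)).den O s).nat 62 e = e) ∧
      (e ∉ B → (∀ f ∈ B, κ f ≠ κ e) →
        ((FProg.swapLoop k (.cell 53) (.cell 54)).den O s).nat 62 e = e) ∧
      (e ∉ B → (∃ f ∈ B, κ f = κ e) →
        IsLast κ B (κ e) (((FProg.swapLoop k (.cell 53) (.cell 54)).den O s).nat 62 e))) ∧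
    ((FProg.swapLoop k (.cell 53) (.cell 54)).den O s).nat 60 = charVec B := by
  have := den_swapLoop (O := O) (k := k) (i := .cell 53) (x := .cell 54) (φ := fun g _ _ => g)
    (ξ := fun _ f _ => f) hO hB hn h60 (fun _ => rfl) (fun _ => rfl)
    (fun g f R => ∀ e < n, (e ∈ B → R e = e) ∧
      (e ∉ B → (∀ f' ∈ B, (e < g ∨ e = g ∧ f' < f) → κ f' ≠ κ e) → R e = e) ∧
      (e ∉ B → (∃ f' ∈ B, (e < g ∨ e = g ∧ f' < f) ∧ κ f' = κ e) → R e ∈ B ∧ κ (R e) = κ e ∧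
        ∀ f' ∈ B, (e < g ∨ e = g ∧ f' < f) → κ f' = κ e → f' ≤ R e))
    (fun e he => by simp [h62 e he]) (by
      intro g hg f hf R hgB hfB hk hI e he
      obtain ⟨h1, h2, h3⟩ := hI e he
      by_cases heg : e = g
      · subst heg
        simp only [Function.update_self]
        refine ⟨fun h => absurd h hgB, fun _ h => absurd hk (h f hfB (.inr ⟨trivial, Nat.lt_succ_self f⟩)), fun _ _ =>
          ⟨hfB, hk, fun f' _ h _ => by omega⟩⟩
      · simp only [Function.update_of_ne heg]
        refine ⟨h1, fun h4 h5 => h2 h4 fun f' hf' h6 => h5 f' hf' (by omega), fun h4 ⟨f', h5, h6, h7⟩ =>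
          ?_⟩
        obtain ⟨h8, h9, h10⟩ := h3 h4 ⟨f', h5, by omega, h7⟩
        exact ⟨h8, h9, fun f'' h11 h12 => h10 f'' h11 (by omega)⟩) (by
      intro g hg f hf R hno hI e he
      obtain ⟨h1, h2, h3⟩ := hI e he
      refine ⟨h1, fun h4 h5 => h2 h4 fun f' hf' h6 => h5 f' hf' (by omega), fun h4 ⟨f', h5, h6, h7⟩ =>
        ?_⟩
      have key : ∀ f' ∈ B, (e < g ∨ e = g ∧ f' < f + 1) → κ f' = κ e → e < g ∨ e = g ∧ f' < f := by
        intro f' h8 h9 h10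
        by_contra hc
        obtain ⟨rfl, rfl⟩ : e = g ∧ f' = f := by omega
        exact hno ⟨h4, h8, h10⟩
      obtain ⟨h8, h9, h10⟩ := h3 h4 ⟨f', h5, key f' h5 h6 h7, h7⟩
      exact ⟨h8, h9, fun f'' h11 h12 h13 => h10 f'' h11 (key f'' h11 h12 h13) h13⟩) (by
      intro g hg R hI e he
      obtain ⟨h1, h2, h3⟩ := hI e he
      have key : ∀ f' ∈ B, (e < g + 1 ∨ e = g + 1 ∧ f' < 0 ↔ e < g ∨ e = g ∧ f' < n) := by
        intro f' hf'
        have : f' < n := by simpa using hB.subset hf'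
        omega
      refine ⟨h1, fun h4 h5 => h2 h4 fun f' hf' h6 => h5 f' hf' ((key f' hf').2 h6),
        fun h4 ⟨f', h5, h6, h7⟩ => ?_⟩
      obtain ⟨h8, h9, h10⟩ := h3 h4 ⟨f', h5, (key f' h5).1 h6, h7⟩
      exact ⟨h8, h9, fun f'' h11 h12 => h10 f'' h11 ((key f'' h11).1 h12)⟩)
  refine ⟨fun e he => ?_, this.2⟩
  obtain ⟨h1, h2, h3⟩ := this.1 e he
  refine ⟨h1, fun h4 h5 => h2 h4 fun f hf _ => h5 f hf, fun h4 ⟨f, h5, h6⟩ => ?_⟩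
  obtain ⟨h7, h8, h9⟩ := h3 h4 ⟨f, h5, .inl he, h6⟩
  exact ⟨h7, h8, fun f hf => h9 f hf (.inl he)⟩

/-- The array `R` holds representatives of the classes. -/
def IsRep (κ : ℕ → ℕ) (n : ℕ) (B : Finset ℕ) (R : ℕ → ℕ) : Prop :=
  ∀ e < n, (R e = e ∨ IsLast κ B (κ e) (R e)) ∧
    ∀ g < n, g ∉ B → ∀ f ∈ B, κ f = κ g → κ e = κ g → IsLast κ B (κ e) (R e)

/-- Entries of elements outside the base no longer change, and base elements that can be exchanged
for `g` receive the entry of `g`. So all elements of a class that meets both sides obtain the same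
representative. -/
theorem den_secondSwapLoop (hO : OracleFor O k κ cap n) (hB : CapBase κ cap n B)
    (hn : s.nat 0 0 = n) (h60 : s.nat 60 = charVec B)
    (h62 : ∀ e < n, (e ∈ B → s.nat 62 e = e) ∧
      (e ∉ B → (∀ f ∈ B, κ f ≠ κ e) → s.nat 62 e = e) ∧
      (e ∉ B → (∃ f ∈ B, κ f = κ e) → IsLast κ B (κ e) (s.nat 62 e))) :
    IsRep κ n B (((FProg.swapLoop k (.cell 54) (.read 62 (.cell 53))).den O s).nat 62) ∧
    ((FProg.swapLoop k (.cell 54) (.read 62 (.cell 53))).den O s).nat 60 = charVec B := by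
  have := den_swapLoop (O := O) (k := k) (i := .cell 54) (x := .read 62 (.cell 53))
    (φ := fun _ f _ => f) (ξ := fun g _ R => R g) hO hB hn h60 (fun _ => rfl) (fun _ => rfl)
    (fun g f R => (∀ e < n, e ∉ B → R e = s.nat 62 e) ∧ ∀ e ∈ B,
      (R e = e ∨ IsLast κ B (κ e) (R e)) ∧
      ∀ g' < n, g' ∉ B → κ e = κ g' → (g' < g ∨ g' = g ∧ e < f) → IsLast κ B (κ e) (R e))
    ⟨fun _ _ _ => rfl, fun e he =>
      ⟨.inl ((h62 e (by simpa using hB.subset he)).1 he), by simp⟩⟩ (by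
      intro g hg f hf R hgB hfB hk ⟨hI, hJ⟩
      have hlast : IsLast κ B (κ f) (R g) := by
        rw [hI g hg hgB, hk]; exact (h62 g hg).2.2 hgB ⟨f, hfB, hk⟩
      refine ⟨fun e he heB => ?_, fun e he => ?_⟩
      · rw [Function.update_of_ne (fun h => heB (by rw [h]; exact hfB)), hI e he heB]
      · by_cases hef : e = f
        · subst hef
          simp only [Function.update_self]
          exact ⟨.inr hlast, fun _ _ _ _ _ => hlast⟩
        · simp only [Function.update_of_ne hef]
          refine ⟨(hJ e he).1, fun g' h1 h2 h3 h4 => (hJ e he).2 g' h1 h2 h3 (by omega)⟩) (by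
      intro g hg f hf R hno ⟨hI, hJ⟩
      refine ⟨hI, fun e he => ⟨(hJ e he).1, fun g' h1 h2 h3 h4 => (hJ e he).2 g' h1 h2 h3 ?_⟩⟩
      by_contra hc
      obtain ⟨rfl, rfl⟩ : g' = g ∧ e = f := by omega
      exact hno ⟨h2, he, h3⟩) (by
      intro g hg R ⟨hI, hJ⟩
      refine ⟨hI, fun e he => ⟨(hJ e he).1, fun g' h1 h2 h3 h4 => (hJ e he).2 g' h1 h2 h3 ?_⟩⟩
      have : e < n := by simpa using hB.subset he
      omega)
  refine ⟨fun e he => ?_, this.2⟩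
  by_cases heB : e ∈ B
  · obtain ⟨h1, h2⟩ := this.1.2 e heB
    exact ⟨h1, fun g hg hgB _ _ _ hk => h2 g hg hgB hk (.inl hg)⟩
  · rw [this.1.1 e he heB]
    obtain ⟨-, h1, h2⟩ := h62 e he
    refine ⟨?_, fun g hg hgB f hf hk hk' => h2 heB ⟨f, hf, by rw [hk, hk']⟩⟩
    by_cases h3 : ∃ f ∈ B, κ f = κ e
    · exact .inr (h2 heB h3)
    · push Not at h3
      exact .inl (h1 heB h3)

/-- The arrays `R` and `c` describe the bases: the representatives of the classes, and the number of
elements of a base with a given representative. -/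
def DescribesBases (κ cap : ℕ → ℕ) (n : ℕ) (R c : ℕ → ℕ) : Prop :=
  (∀ e < n, R e < n) ∧ ∀ F ⊆ range n,
    (CapBase κ cap n F ↔ ∀ v < n, (F.filter fun e => R e = v).card = c v)

/-- A representative lies in the class of its element, so equal representatives imply equal classes;
on mixed classes the converse holds because the last base element is unique. -/
theorem IsRep.describesBases {R c : ℕ → ℕ} (hR : IsRep κ n B R) (hB : CapBase κ cap n B)
    (hc : ∀ v < n, c v = (B.filter fun e => R e = v).card) : DescribesBases κ cap n R c := by
  have hlt : ∀ e < n, R e < n := fun e he => by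
    rcases (hR e he).1 with h | h
    · omega
    · simpa using hB.subset h.1
  have hk : ∀ e < n, κ (R e) = κ e := fun e he => by
    rcases (hR e he).1 with h | h
    exacts [by rw [h], h.2.1]
  refine ⟨hlt, fun F hF => ?_⟩
  rw [hB.iff_card_of_refine hF hlt (fun e he e' he' h => by rw [← hk e he, h, hk e' he'])
    (fun g hg hgB f hf hfg e he e' he' h h' => by
      have h1 := (hR e he).2 g hg hgB f hf hfg h
      have h2 := (hR e' he').2 g hg hgB f hf hfg h'
      rw [h] at h1; rw [h'] at h2
      exact h1.unique h2)]
  exact forall₂_congr fun v hv => by rw [hc v hv]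

theorem den_classes (hO : OracleFor O k κ cap n) (hn : s.nat 0 0 = n)
    (h60 : ∀ e, n ≤ e → s.nat 60 e = 0) :
    DescribesBases κ cap n (((FProg.classes k).den O s).nat 62)
      (((FProg.classes k).den O s).nat 63) ∧
      ∀ e, n ≤ e → ((FProg.classes k).den O s).nat 60 e = 0 := by
  rw [FProg.classes, den_seq, den_seq, den_seq, den_seq, den_seq]
  obtain ⟨B, hB, hBs⟩ := den_greedy (k := k) hO hn h60
  have hA1 := den_agree O (.greedy k) s
  set s₁ := (FProg.greedy k).den O s
  have hn1 : s₁.nat 0 0 = n := by rw [hA1.nat 0 rfl, hn]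
  have h2 := den_for (O := O) (s := s₁) (a := 53) (b := FProg.size)
    (c := .setNat 62 (.cell 53) (.cell 53)) n (by simp [FProg.size, NExp.eval, hn1])
    (fun j s' => ∀ e < j, s'.nat 62 e = e) (by simp) (by
      intro j hj s' hI hj' hA e he
      simp only [FProg.den, NExp.eval, hj', State.nat_setNat, Nat.reduceEqDiff, if_false, if_true,
        Function.update_apply]
      split_ifs with h
      · exact h.symm
      · exact hI e (by omega))
  have hA2 := den_agree O (.for_ 53 FProg.size (.setNat 62 (.cell 53) (.cell 53))) s₁
  set s₂ := (FProg.for_ 53 FProg.size (.setNat 62 (.cell 53) (.cell 53))).den O s₁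
  obtain ⟨h3, h3'⟩ := den_firstSwapLoop (k := k) hO hB (by rw [hA2.nat 0 rfl, hn1])
    (by rw [hA2.nat 60 rfl, hBs]) h2
  have hA3 := den_agree O (.swapLoop k (.cell 53) (.cell 54)) s₂
  set s₃ := (FProg.swapLoop k (.cell 53) (.cell 54)).den O s₂
  obtain ⟨h4, h4'⟩ := den_secondSwapLoop (k := k) hO hB
    (by rw [hA3.nat 0 rfl, hA2.nat 0 rfl, hn1]) h3' h3
  have hA4 := den_agree O (.swapLoop k (.cell 54) (.read 62 (.cell 53))) s₃
  set s₄ := (FProg.swapLoop k (.cell 54) (.read 62 (.cell 53))).den O s₃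
  have hn4 : s₄.nat 0 0 = n := by rw [hA4.nat 0 rfl, hA3.nat 0 rfl, hA2.nat 0 rfl, hn1]
  have h5 := den_for (O := O) (s := s₄) (a := 53) (b := FProg.size)
    (c := .setNat 63 (.cell 53) (.const 0)) n (by simp [FProg.size, NExp.eval, hn4])
    (fun j s' => ∀ e < j, s'.nat 63 e = 0) (by simp) (by
      intro j hj s' hI hj' hA e he
      simp only [FProg.den, NExp.eval, hj', State.nat_setNat, Nat.reduceEqDiff, if_false, if_true,
        Function.update_apply]
      split_ifs with h
      · rfl
      · exact hI e (by omega))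
  have hA5 := den_agree O (.for_ 53 FProg.size (.setNat 63 (.cell 53) (.const 0))) s₄
  set s₅ := (FProg.for_ 53 FProg.size (.setNat 63 (.cell 53) (.const 0))).den O s₄
  have e62 : s₅.nat 62 = s₄.nat 62 := hA5.nat 62 rfl
  have e60 : s₅.nat 60 = charVec B := (hA5.nat 60 rfl).trans h4'
  have h6 := den_for (O := O) (s := s₅) (a := 53) (b := FProg.size) (c :=
    .ite (.ne0 (.read 60 (.cell 53)))
    (.setNat 63 (.read 62 (.cell 53)) (.add (.read 63 (.read 62 (.cell 53))) (.const 1))) .nop) n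
    (by simp [FProg.size, NExp.eval, hA5.nat 0 rfl, hn4])
    (fun j s' => ∀ v < n, s'.nat 63 v =
      (((range j).filter (· ∈ B)).filter fun e => s₄.nat 62 e = v).card)
    (fun v hv => by simpa using h5 v hv) (by
      intro j hj s' hI hj' hA v hv
      have a60 : s'.nat 60 = charVec B := (hA.nat 60 rfl).trans e60
      have a62 : s'.nat 62 = s₄.nat 62 := (hA.nat 62 rfl).trans e62
      rw [range_add_one, filter_insert]
      by_cases hjB : j ∈ B
      · rw [den_ite_pos (by simpa [NExp.eval, hj', a60] using charVec_ne_zero.2 hjB), if_pos hjB,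
          card_filter_insert (by simp), ← hI v hv]
        simp only [FProg.den, NExp.eval, hj', a62, State.nat_setNat, Nat.reduceEqDiff, if_false,
          if_true, Function.update_apply]
        by_cases hvj : v = s₄.nat 62 j
        · simp [hvj]
        · simp [hvj, Ne.symm hvj]
      · rw [den_ite_neg (by
          simpa [NExp.eval, hj', a60] using not_not.1 (mt charVec_ne_zero.1 hjB)), if_neg hjB,
          ← hI v hv]
        simp [FProg.den])
  have hA6 := den_agree O (.for_ 53 FProg.size (.ite (.ne0 (.read 60 (.cell 53)))
    (.setNat 63 (.read 62 (.cell 53)) (.add (.read 63 (.read 62 (.cell 53))) (.const 1))) .nop)) s₅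
  rw [hA6.nat 62 rfl, hA6.nat 60 rfl, e62, e60]
  refine ⟨h4.describesBases hB fun v hv => ?_, fun e he => ?_⟩
  · rw [h6 v hv, filter_mem_eq_inter, inter_eq_right.2 hB.subset]
  · exact if_neg fun h => by
      have := hB.subset h
      simp at this
      omega

theorem den_copy {a b : ℕ} (hn : s.nat 0 0 = n) (ha : a ≠ 53) (hb : b ≠ 53) (hab : a ≠ b) :
    ∀ e, ((FProg.copy a b).den O s).nat b e = if e < n then s.nat a e else s.nat b e := by
  have := den_for (O := O) (s := s) (a := 53) (b := FProg.size)
    (c := .setNat b (.cell 53) (.read a (.cell 53))) n (by simp [FProg.size, NExp.eval, hn])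
    (fun j s' => ∀ e, s'.nat b e = if e < j then s.nat a e else s.nat b e) (by simp [hb]) (by
      intro j hj s' hI hj' hA e
      have h1 : s'.nat a = s.nat a := hA.nat a (by simp [FProg.writesNat, ha, hab])
      simp only [FProg.den, NExp.eval, hj', State.nat_setNat, hb, if_false, if_true, h1,
        Function.update_apply]
      by_cases hej : e = j
      · simp [hej]
      · rw [if_neg hej, hI e]
        by_cases h : e < j
        · rw [if_pos h, if_pos (by omega)]
        · rw [if_neg h, if_neg (by omega)])
  exact this

/-! ### From partition matroids to bipartite graphs -/

namespace FProg

/-- Computing the graph of two partition matroids. -/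
def frontEnd : FProg :=
  classes 0 ;; copy 62 1 ;; copy 63 3 ;; classes 1 ;; copy 62 2 ;; copy 63 4

end FProg

/-- The working arrays are used for both oracles in turn, so the results for the first are copied to
the arrays of the graph before the second is queried. -/
theorem den_frontEnd {κ' cap' : ℕ → ℕ} (h0 : OracleFor O 0 κ cap n) (h1 : OracleFor O 1 κ' cap' n)
    (hn : s.nat 0 0 = n) (h60 : ∀ e, s.nat 60 e = 0) :
    DescribesBases κ cap n ((FProg.frontEnd.den O s).nat 1) ((FProg.frontEnd.den O s).nat 3) ∧
      DescribesBases κ' cap' n ((FProg.frontEnd.den O s).nat 2) ((FProg.frontEnd.den O s).nat 4) ∧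
      ∀ e, n ≤ e → (FProg.frontEnd.den O s).nat 3 e = s.nat 3 e := by
  have hcongr : ∀ {κ cap R R' c c' : ℕ → ℕ}, DescribesBases κ cap n R c → (∀ e < n, R' e = R e) →
      (∀ e < n, c' e = c e) → DescribesBases κ cap n R' c' := by
    rintro κ cap R R' c c' ⟨h1, h2⟩ h3 h4
    refine ⟨fun e he => by rw [h3 e he]; exact h1 e he, fun F hF => ?_⟩
    rw [h2 F hF]
    refine forall₂_congr fun v hv => ?_
    have : {e ∈ F | R' e = v} = {e ∈ F | R e = v} :=
      filter_congr fun e he => by rw [h3 e (by simpa using hF he)]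
    rw [h4 v hv, this]
  rw [FProg.frontEnd, den_seq, den_seq, den_seq, den_seq, den_seq]
  obtain ⟨c1, c1'⟩ := den_classes (k := 0) h0 hn fun e _ => h60 e
  have hA1 := den_agree O (.classes 0) s
  set s₁ := (FProg.classes 0).den O s
  have hn1 : s₁.nat 0 0 = n := by rw [hA1.nat 0 rfl, hn]
  have c2 := den_copy (O := O) (s := s₁) (a := 62) (b := 1) hn1 (by simp) (by simp) (by simp)
  have hA2 := den_agree O (.copy 62 1) s₁
  set s₂ := (FProg.copy 62 1).den O s₁
  have hn2 : s₂.nat 0 0 = n := by rw [hA2.nat 0 rfl, hn1]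
  have c3 := den_copy (O := O) (s := s₂) (a := 63) (b := 3) hn2 (by simp) (by simp) (by simp)
  have hA3 := den_agree O (.copy 63 3) s₂
  set s₃ := (FProg.copy 63 3).den O s₂
  have hn3 : s₃.nat 0 0 = n := by rw [hA3.nat 0 rfl, hn2]
  obtain ⟨c4, -⟩ := den_classes (k := 1) h1 hn3
    (by rw [hA3.nat 60 rfl, hA2.nat 60 rfl]; exact c1')
  have hA4 := den_agree O (.classes 1) s₃
  set s₄ := (FProg.classes 1).den O s₃
  have hn4 : s₄.nat 0 0 = n := by rw [hA4.nat 0 rfl, hn3]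
  have c5 := den_copy (O := O) (s := s₄) (a := 62) (b := 2) hn4 (by simp) (by simp) (by simp)
  have hA5 := den_agree O (.copy 62 2) s₄
  set s₅ := (FProg.copy 62 2).den O s₄
  have hn5 : s₅.nat 0 0 = n := by rw [hA5.nat 0 rfl, hn4]
  have c6 := den_copy (O := O) (s := s₅) (a := 63) (b := 4) hn5 (by simp) (by simp) (by simp)
  have hA6 := den_agree O (.copy 63 4) s₅
  rw [hA6.nat 1 rfl, hA6.nat 2 rfl, hA6.nat 3 rfl, hA5.nat 1 rfl, hA5.nat 3 rfl, hA4.nat 1 rfl,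
    hA4.nat 3 rfl, hA3.nat 1 rfl]
  refine ⟨hcongr c1 (fun e he => by rw [c2, if_pos he]) (fun e he => ?_),
    hcongr c4 (fun e he => by rw [c5, if_pos he]) (fun e he => ?_), fun e he => ?_⟩
  · rw [c3, if_pos he, hA2.nat 63 rfl]
  · rw [c6, if_pos he, hA5.nat 63 rfl]
  · rw [c3, if_neg (by omega), hA2.nat 3 rfl, hA1.nat 3 rfl]

theorem oracleFor_indepOracle {n : ℕ} {M : Fin 2 → Matroid (Fin n)} (k : Fin 2)
    (h : ∀ I : Finset (Fin n), (M k).Indep (I : Set (Fin n)) ↔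
      CapIndep κ cap (I.map Fin.valEmbedding)) :
    OracleFor (indepOracle (M 0) (M 1)) k κ cap n := by
  intro B hB
  have h1 : indepOracle (M 0) (M 1) k (charVec B) ↔
      (M k).Indep ((univ.filter fun e : Fin n => (e : ℕ) ∈ B : Finset (Fin n)) : Set (Fin n)) := by
    have hset : {e : Fin n | charVec B e ≠ 0} =
        ((univ.filter fun e : Fin n => (e : ℕ) ∈ B : Finset (Fin n)) : Set (Fin n)) := by
      ext e; simp [charVec]
    rw [← hset]
    fin_cases k <;> rfl
  rw [h1, h, exists_map_eq hB]

/-- Both colour classes are taken to be the ground set: an element is the edge between its two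
representatives, and a vertex that represents no element is isolated. Hence all three sizes of the
graph are `n`. -/
theorem exists_matroid_program : ∃ (P : Prog) (f : Polynomial ℕ),
    ∀ (Γ : Type u) [AddCommGroup Γ] (n : ℕ) (M₁ M₂ : Matroid (Fin n))
      (ψ : Fin n → Γ) (w : Fin n → ℝ),
      M₁.E = Set.univ → M₂.E = Set.univ →
      IsPartitionMatroid M₁ → IsPartitionMatroid M₂ →
      HaltsWithin (indepOracle M₁ M₂) P (matroidInput ψ w) (f.eval n)
        (State.IsCorrectOutput (commonBases M₁ M₂) ψ w) := by
  refine ⟨(FProg.frontEnd ;; FProg.solve FProg.size FProg.size FProg.size).compile, _,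
    fun Γ _ n M₁ M₂ ψ w hE₁ hE₂ hM₁ hM₂ => haltsWithin_compile rfl rfl (fun i => ?_) ?_⟩
  · simp only [matroidInput]; split_ifs <;> omega
  obtain ⟨κ, cap, h1⟩ := hM₁.exists_capacities hE₁
  obtain ⟨κ', cap', h2⟩ := hM₂.exists_capacities hE₂
  have hO1 := oracleFor_indepOracle (M := ![M₁, M₂]) 0 h1
  have hO2 := oracleFor_indepOracle (M := ![M₁, M₂]) 1 h2
  simp only [Matrix.cons_val_zero, Matrix.cons_val_one] at hO1 hO2
  obtain ⟨d1, d2, d3⟩ := den_frontEnd (s := matroidInput ψ w) hO1 hO2 rfl fun e => rfl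
  have hA := den_agree (indepOracle M₁ M₂) FProg.frontEnd (matroidInput ψ w)
  rw [den_seq]
  set s := FProg.frontEnd.den (indepOracle M₁ M₂) (matroidInput ψ w)
  have hs0 : s.nat 0 0 = n := by rw [hA.nat 0 rfl]; rfl
  have hs3 : ∀ v, n ≤ v → s.nat 3 v = 0 := fun v hv => by rw [d3 v hv]; rfl
  have hs5 : s.nat 5 0 = 0 := by rw [hA.nat 5 rfl]; rfl
  have hs6 : ∀ e, s.nat 6 e = 0 := fun e => by rw [hA.nat 6 rfl]; rfl
  have hs7 : ∀ e, s.nat 7 e = 0 := fun e => by rw [hA.nat 7 rfl]; rfl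
  have hsg : s.grp 0 = (matroidInput ψ w).grp 0 := hA.grp 0 rfl
  have hsw : s.wt 0 = (matroidInput ψ w).wt 0 := hA.wt 0 rfl
  clear_value s
  -- Being a base of either matroid is the degree condition on one side of the graph.
  have hfam : commonBases M₁ M₂ = perfectBMatchings (fun e => (⟨s.nat 1 e, d1.1 e e.2⟩ : Fin n))
      (fun e => (⟨s.nat 2 e, d2.1 e e.2⟩ : Fin n)) (fun v => s.nat 3 v) (fun v => s.nat 4 v) := by
    ext F
    have hF : F.map Fin.valEmbedding ⊆ range n := fun e he => by
      obtain ⟨e, -, rfl⟩ := mem_map.1 he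
      simp
    have key : ∀ R c : ℕ → ℕ, ∀ hR : ∀ e < n, R e < n, (∀ v < n,
        ((F.map Fin.valEmbedding).filter fun e => R e = v).card = c v) ↔
        ∀ v : Fin n, (F.filter fun e : Fin n => (⟨R e, hR e e.2⟩ : Fin n) = v).card = c v := by
      intro R c hR
      have hc : ∀ v : Fin n, ((F.map Fin.valEmbedding).filter fun e => R e = v).card =
          (F.filter fun e : Fin n => (⟨R e, hR e e.2⟩ : Fin n) = v).card := by
        intro v
        rw [filter_map, card_map]
        congr 1
        ext e
        simp [Fin.ext_iff]
      exact ⟨fun h v => (hc v).symm.trans (h v v.2), fun h v hv => (hc ⟨v, hv⟩).trans (h ⟨v, hv⟩)⟩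
    change M₁.IsBase _ ∧ M₂.IsBase _ ↔ _ ∧ _
    rw [isBase_iff_capBase hE₁ h1, isBase_iff_capBase hE₂ h2, d1.2 _ hF, d2.2 _ hF,
      key _ _ d1.1, key _ _ d2.1]
  rw [hfam]
  refine den_solve ⟨rfl, rfl, rfl, hs0, hs0, hs0, fun _ => rfl, fun _ => rfl, fun _ => rfl,
    hs3, fun _ => rfl, hs5, hs6, hs7, fun e => ?_, fun e => ?_⟩
  · rw [hsg]; simp [matroidInput, pad]
  · rw [hsw]; simp [matroidInput, pad]

end OracleRAM

theorem mainTheorem12 :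
    (∃ (P : OracleRAM.Prog) (f : Polynomial ℕ),
      ∀ (Γ : Type u) [AddCommGroup Γ] (n : ℕ) (M₁ M₂ : Matroid (Fin n))
        (ψ : Fin n → Γ) (w : Fin n → ℝ),
        M₁.E = Set.univ → M₂.E = Set.univ →
        IsPartitionMatroid M₁ → IsPartitionMatroid M₂ →
        OracleRAM.HaltsWithin (OracleRAM.indepOracle M₁ M₂) P (OracleRAM.matroidInput ψ w) (f.eval n)
          (OracleRAM.State.IsCorrectOutput (commonBases M₁ M₂) ψ w)) ∧
    (∃ (P : OracleRAM.Prog) (f : Polynomial ℕ),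
      ∀ (Γ : Type u) [AddCommGroup Γ] (p q m : ℕ) (left : Fin m → Fin p) (right : Fin m → Fin q)
        (bl : Fin p → ℕ) (br : Fin q → ℕ) (ψ : Fin m → Γ) (w : Fin m → ℝ),
        OracleRAM.HaltsWithin OracleRAM.trivialOracle P (OracleRAM.graphInput left right bl br ψ w) (f.eval (p + q + m))
          (OracleRAM.State.IsCorrectOutput (perfectBMatchings left right bl br) ψ w)) :=
  ⟨OracleRAM.exists_matroid_program, OracleRAM.exists_graph_program⟩
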